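/- Let $\mathbb R_5$ be the real Clifford algebra with units $e_1,\dots,e_5$, $e_ie_j+e_je_i=0$ $(i\ne j)$, $e_i^2=-1$. Identify $x=(x_0,\dots,x_5)\in\mathbb R^6$ with the paravector $x_0+\sum_{i=1}^5x_ie_i\in\mathbb R_5$, put $\overline x=x_0-\sum_i x_ie_i$, let $\mathbb S$ be the sphere of the paravectors $J$ with $J_0=0$, $|J|=1$, and $\mathbb C_J=\{u+Jv: u,v\in\mathbb R\}$. A set $U\subseteq\mathbb R^6$ is axially symmetric if $u+Iv\in U$ for one $I\in\mathbb S$ implies $u+Jv\in U$ for all $J\in\mathbb S$. A slice Cauchy domain is an axially symmetric open set $U$ such that for each $J\in\mathbb S$ the boundary of $U\cap\mathbb C_J$ in $\mathbb C_J$ is the union of finitely many pairwise disjoint piecewise $C^1$ Jordan curves. For an axially symmetric open set $U$, $\mathcal{SH}_L(U)$ (resp. $\mathcal{SH}_R(U)$) is the set of functions $f:U\to\mathbb R_5$ of the form $f(u+Jv)=\alpha(u,v)+J\beta(u,v)$ (resp. $\alpha(u,v)+\beta(u,v)J$) for all $J\in\mathbb S$, where $\alpha,\beta$ are differentiable $\mathbb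 R_5$-valued functions with $\alpha(u,-v)=\alpha(u,v)$, $\beta(u,-v)=-\beta(u,v)$, $\partial_u\alpha=\partial_v\beta$, $\partial_v\alpha=-\partial_u\beta$. Let $\Delta$ be the Laplacian of $\mathbb R^6$ and $\mathcal Df=\partial_{x_0}f+\sum_ie_i\partial_{x_i}f$, $\overline{\mathcal D}f=\partial_{x_0}f-\sum_ie_i\partial_{x_i}f$; acting from the right, $f\mathcal D=\partial_{x_0}f+\sum_i(\partial_{x_i}f)e_i$, $f\overline{\mathcal D}=\partial_{x_0}f-\sum_i(\partial_{x_i}f)e_i$, $f\Delta=\Delta f$. Let $\mathsf P$ be one of $\Delta\mathcal D,\ \mathcal D,\ \Delta,\ \overline{\mathcal D},\ \overline{\mathcal D}^2,\ \Delta\overline{\mathcal D},\ \mathcal D^2$, of degree $3,1,2,1,2,3,2$ respectively, and put $t=\deg(\mathsf P)-1$. Let $V$ be a real Banach space, and let $\mathcal B(V_5)$ be the algebra of the operators $\sum_A T_Ae_A$, $T_A\in\mathcal B(V)$ (the $e_A$, $A\subseteq\{1,\dots,5\}$, being the basis of $\mathbb R_5$, and the coefficients $T_A$ commuting with the units). Let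 $T=T_0+\sum_{i=1}^5T_ie_i$ with pairwise commuting $T_0,\dots,T_5\in\mathcal B(V)$, and put $\overline T=T_0-\sum_iT_ie_i$. For $s\in\mathbb R^6$ let $\mathcal Q_{c,s}(T)=s^2\mathcal I-s(T+\overline T)+T\overline T$, and let $\sigma_S(T)$ be the set of $s\in\mathbb R^6$ for which $\mathcal Q_{c,s}(T)$ is not invertible. For $s\notin\sigma_S(T)$ put $\mathcal Q=\mathcal Q_{c,s}(T)$ and $$S^{-1}_{\Delta\mathcal D,L}=S^{-1}_{\Delta\mathcal D,R}=16\mathcal Q^{-2},\qquad S^{-1}_{\mathcal D,L}=S^{-1}_{\mathcal D,R}=-4\mathcal Q^{-1},$$ $$S^{-1}_{\Delta,L}=-8(s-\overline T)\mathcal Q^{-2},\qquad S^{-1}_{\overline{\mathcal D},L}=4(s-\overline T)\mathcal Q^{-2}(s-T_0)+2\mathcal Q^{-1},\qquad S^{-1}_{\overline{\mathcal D}^2,L}=32(s-\overline T)\mathcal Q^{-3}(s-T_0)^2,$$ $$S^{-1}_{\Delta\overline{\mathcal D},L}=-64(s-\overline T)\mathcal Q^{-3}(s-T_0),\qquad S^{-1}_{\mathcal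 D^2,L}=-8(s-T)\mathcal Q^{-2},$$ and let $S^{-1}_{\mathsf P,R}$ be given by the same expressions with the order of the factors reversed. If $f\in\mathcal{SH}_L(U)$ (resp. $f\in\mathcal{SH}_R(U)$) and $\sigma_S(T)\subset U$, one defines $$(\mathsf Pf)(T)=\frac1{2\pi}\int_{\partial(W\cap\mathbb C_J)}S^{-1}_{\mathsf P,L}(s,T)\,ds_J\,f(s),\qquad\text{resp.}\qquad (f\mathsf P)(T)=\frac1{2\pi}\int_{\partial(W\cap\mathbb C_J)}f(s)\,ds_J\,S^{-1}_{\mathsf P,R}(s,T),$$ where $ds_J=ds(-J)$, $J\in\mathbb S$, $W$ is a bounded slice Cauchy domain with $\sigma_S(T)\subset W$ and $\overline W\subset U$, and the boundary of $W\cap\mathbb C_J$ is positively oriented (the boundary curves together have winding number $1$ about the points of $W\cap\mathbb C_J$ and $0$ about the points of $\mathbb C_J$ off its closure). **Theorem.** Let $\Omega\subseteq\mathbb R^6$ be a connected slice Cauchy domain. 1. $\{f\in\mathcal{SH}_L(\Omega):\mathsf Pf=0\}=\{\alpha_0+x\alpha_1+\dots+x^t\alpha_t:\ \alpha_0,\dots,\alpha_t\in\mathbb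 R_5\}$ (as functions on $\Omega$). 2. $\{f\in\mathcal{SH}_R(\Omega):f\mathsf P=0\}=\{\alpha_0+\alpha_1x+\dots+\alpha_tx^t:\ \alpha_0,\dots,\alpha_t\in\mathbb R_5\}$ (as functions on $\Omega$). 3. Let $\sigma_S(T)\subset\Omega$. If $f,g\in\mathcal{SH}_L(\Omega)$ and $\mathsf Pf=\mathsf Pg$ on $\Omega$, then $(\mathsf Pf)(T)=(\mathsf Pg)(T)$; if $f,g\in\mathcal{SH}_R(\Omega)$ and $f\mathsf P=g\mathsf P$ on $\Omega$, then $(f\mathsf P)(T)=(g\mathsf P)(T)$. The equalities hold for any admissible choices of $W$, $J$ and of the boundary parametrisation on the two sides, which may be different. -/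

import Mathlib

open Set

/-! ### Clifford algebras with coefficients

`Cl 𝒜` is the set of formal sums `∑_A a_A e_A`, `A ⊆ {1, …, 5}`, with coefficients `a_A` in an
algebra `𝒜` that commute with the units `e_1, …, e_5`.  `Cl ℝ` is the real Clifford algebra `ℝ₅`
(`e_i e_j = - e_j e_i` for `i ≠ j` and `e_i ^ 2 = -1`), and `Cl (V →L[ℝ] V)` is the algebra
`ℬ(V₅)` of the operators `∑_A T_A e_A`, with composition as product. -/

/-- Elements `∑_A a_A e_A`, stored as the family of their coefficients `a_A`. -/
@[ext]
structure Cl (𝒜 : Type*) where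
  /-- The coefficient `a_A`. -/
  coeff : Finset (Fin 5) → 𝒜

namespace Cl

/-- The sign in `e_A e_B = ± e_{A ∆ B}`: a factor `-1` for every pair `(a, b) ∈ A × B` with
`b < a` (a transposition) and for every pair with `a = b` (as `e_a ^ 2 = -1`). -/
def sign (A B : Finset (Fin 5)) : ℤ := ∏ a ∈ A, ∏ b ∈ B, if b ≤ a then -1 else 1

theorem prod_symmDiff (f : Fin 5 → ℤ) (hf : ∀ a, f a * f a = 1) (A B : Finset (Fin 5)) :
    ∏ a ∈ symmDiff A B, f a = (∏ a ∈ A, f a) * ∏ a ∈ B, f a := by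
  have h : ∀ S : Finset (Fin 5), ∏ a ∈ S, f a = ∏ a, if a ∈ S then f a else 1 := by
    intro S
    rw [Finset.prod_ite_mem, Finset.univ_inter]
  rw [h, h A, h B, ← Finset.prod_mul_distrib]
  refine Finset.prod_congr rfl fun a _ => ?_
  by_cases hA : a ∈ A <;> by_cases hB : a ∈ B <;> simp [Finset.mem_symmDiff, hA, hB, hf]

theorem sign_symmDiff_left (A B C : Finset (Fin 5)) :
    sign (symmDiff A B) C = sign A C * sign B C := by
  unfold sign
  refine prod_symmDiff _ (fun a => ?_) A B
  rw [← Finset.prod_mul_distrib]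
  refine Finset.prod_eq_one fun b _ => ?_
  split_ifs <;> norm_num

theorem sign_symmDiff_right (A B C : Finset (Fin 5)) :
    sign A (symmDiff B C) = sign A B * sign A C := by
  unfold sign
  rw [← Finset.prod_mul_distrib]
  refine Finset.prod_congr rfl fun a _ => ?_
  refine prod_symmDiff _ (fun b => ?_) B C
  split_ifs <;> norm_num

section algebra
variable {𝒜 : Type*}

theorem ext_coeff {x y : Cl 𝒜} (h : ∀ A, x.coeff A = y.coeff A) : x = y := Cl.ext (funext h)

instance instAdd [AddCommGroup 𝒜] : Add (Cl 𝒜) := ⟨fun x y => ⟨fun A => x.coeff A + y.coeff A⟩⟩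
instance instZero [AddCommGroup 𝒜] : Zero (Cl 𝒜) := ⟨⟨fun _ => 0⟩⟩
instance instNeg [AddCommGroup 𝒜] : Neg (Cl 𝒜) := ⟨fun x => ⟨fun A => -x.coeff A⟩⟩
instance instSMul {R : Type*} [SMul R 𝒜] : SMul R (Cl 𝒜) := ⟨fun r x => ⟨fun A => r • x.coeff A⟩⟩

@[simp] theorem coeff_add [AddCommGroup 𝒜] (x y : Cl 𝒜) (C : Finset (Fin 5)) :
    (x + y).coeff C = x.coeff C + y.coeff C := rfl

@[simp] theorem coeff_neg [AddCommGroup 𝒜] (x : Cl 𝒜) (C : Finset (Fin 5)) :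
    (-x).coeff C = -x.coeff C := rfl

@[simp] theorem coeff_zero [AddCommGroup 𝒜] (C : Finset (Fin 5)) : (0 : Cl 𝒜).coeff C = 0 := rfl

@[simp] theorem coeff_smul {R : Type*} [SMul R 𝒜] (r : R) (x : Cl 𝒜) (C : Finset (Fin 5)) :
    (r • x).coeff C = r • x.coeff C := rfl

instance instAddCommGroup [AddCommGroup 𝒜] : AddCommGroup (Cl 𝒜) where
  add_assoc x y z := ext_coeff fun A => add_assoc _ _ _
  zero_add x := ext_coeff fun A => zero_add _
  add_zero x := ext_coeff fun A => add_zero _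
  neg_add_cancel x := ext_coeff fun A => neg_add_cancel _
  add_comm x y := ext_coeff fun A => add_comm _ _
  nsmul := nsmulRec
  zsmul := zsmulRec

instance instModule {R : Type*} [Ring R] [AddCommGroup 𝒜] [Module R 𝒜] : Module R (Cl 𝒜) where
  one_smul _ := ext_coeff fun _ => one_smul _ _
  mul_smul _ _ _ := ext_coeff fun _ => mul_smul _ _ _
  smul_zero _ := ext_coeff fun _ => smul_zero _
  smul_add _ _ _ := ext_coeff fun _ => smul_add _ _ _
  add_smul _ _ _ := ext_coeff fun _ => add_smul _ _ _
  zero_smul _ := ext_coeff fun _ => zero_smul _ _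

/-- The element `a e_A`. -/
def single [Zero 𝒜] (A : Finset (Fin 5)) (a : 𝒜) : Cl 𝒜 :=
  ⟨fun B => if B = A then a else 0⟩

/-- The product determined by `e_A e_B = sign A B • e_{A ∆ B}`. -/
instance instMul [Ring 𝒜] : Mul (Cl 𝒜) where
  mul x y := ⟨fun C => ∑ A, sign A (symmDiff A C) • (x.coeff A * y.coeff (symmDiff A C))⟩

instance instOne [Ring 𝒜] : One (Cl 𝒜) where
  one := single ∅ 1

@[simp] theorem coeff_mul [Ring 𝒜] (x y : Cl 𝒜) (C : Finset (Fin 5)) :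
    (x * y).coeff C = ∑ A, sign A (symmDiff A C) • (x.coeff A * y.coeff (symmDiff A C)) := rfl

@[simp] theorem coeff_single [Zero 𝒜] (A : Finset (Fin 5)) (a : 𝒜) (C : Finset (Fin 5)) :
    (single A a).coeff C = if C = A then a else 0 := rfl

@[simp] theorem coeff_one [Ring 𝒜] (C : Finset (Fin 5)) :
    (1 : Cl 𝒜).coeff C = if C = ∅ then 1 else 0 := rfl

instance instRing [Ring 𝒜] : Ring (Cl 𝒜) where
  __ := instAddCommGroup (𝒜 := 𝒜)
  __ := instMul (𝒜 := 𝒜)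
  __ := instOne (𝒜 := 𝒜)
  left_distrib x y z := by
    refine ext_coeff fun C => ?_
    simp only [coeff_mul, coeff_add, mul_add, smul_add, Finset.sum_add_distrib]
  right_distrib x y z := by
    refine ext_coeff fun C => ?_
    simp only [coeff_mul, coeff_add, add_mul, smul_add, Finset.sum_add_distrib]
  zero_mul x := by
    refine ext_coeff fun C => ?_
    simp only [coeff_mul, coeff_zero, zero_mul, smul_zero, Finset.sum_const_zero]
  mul_zero x := by
    refine ext_coeff fun C => ?_
    simp only [coeff_mul, coeff_zero, mul_zero, smul_zero, Finset.sum_const_zero]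
  one_mul x := by
    refine ext_coeff fun C => ?_
    rw [coeff_mul, Finset.sum_eq_single ∅]
    · have h : symmDiff ∅ C = C := bot_symmDiff C
      simp [sign, h]
    · intro A _ hA
      simp [hA]
    · simp
  mul_one x := by
    refine ext_coeff fun C => ?_
    rw [coeff_mul, Finset.sum_eq_single C]
    · simp [sign]
    · intro A _ hA
      simp [hA]
    · simp
  mul_assoc x y z := by
    refine ext_coeff fun C => ?_
    simp only [coeff_mul, Finset.mul_sum, Finset.sum_mul, Finset.smul_sum]
    rw [Finset.sum_comm]
    refine Finset.sum_congr rfl fun A _ => ?_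
    have hinv : Function.Involutive (fun B => symmDiff A B) := symmDiff_symmDiff_cancel_left A
    refine Fintype.sum_equiv hinv.toPerm _ _ fun B => ?_
    have h1 : symmDiff (symmDiff A B) (symmDiff A C) = symmDiff B C := by
      rw [symmDiff_comm A B, symmDiff_assoc, symmDiff_symmDiff_cancel_left]
    have h2 : sign B (symmDiff B C) * sign A (symmDiff A B)
        = sign A (symmDiff A C) * sign (symmDiff A B) (symmDiff B C) := by
      simp only [sign_symmDiff_left, sign_symmDiff_right]
      have hsq : sign A C * sign A C = 1 := by
        rw [← sign_symmDiff_right]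
        simp [sign]
      linear_combination
        (-(sign B B * sign B C * sign A A * sign A B)) * hsq
    simp only [Function.Involutive.coe_toPerm, h1]
    simp only [smul_mul_assoc, mul_smul_comm, smul_smul, h2, mul_assoc]

/-- The unit `e_i`. -/
def e [Ring 𝒜] (i : Fin 5) : Cl 𝒜 := single {i} 1

theorem single_mul_single [Ring 𝒜] (A B : Finset (Fin 5)) (a b : 𝒜) :
    single A a * single B b = single (symmDiff A B) (sign A B • (a * b)) := by
  refine ext_coeff fun C => ?_
  rw [coeff_mul, Finset.sum_eq_single A]
  · by_cases h : C = symmDiff A B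
    · subst h
      simp
    · have h' : symmDiff A C ≠ B := fun hB => h (by rw [← hB, symmDiff_symmDiff_cancel_left])
      simp [h, h']
  · intro D _ hD
    simp [hD]
  · simp

theorem e_mul_self [Ring 𝒜] (i : Fin 5) : (e i * e i : Cl 𝒜) = -1 := by
  rw [e, single_mul_single]
  refine ext_coeff fun C => ?_
  by_cases h : C = ∅ <;> simp [sign, h]

theorem e_mul_e [Ring 𝒜] {i j : Fin 5} (h : i ≠ j) : (e i * e j : Cl 𝒜) = -(e j * e i) := by
  rw [e, e, single_mul_single, single_mul_single, symmDiff_comm]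
  refine ext_coeff fun C => ?_
  rcases lt_or_gt_of_ne h with hij | hij
  · by_cases hC : C = symmDiff {j} {i} <;> simp [sign, hC, hij.le, not_le.mpr hij]
  · by_cases hC : C = symmDiff {j} {i} <;> simp [sign, hC, hij.le, not_le.mpr hij]

end algebra

/-- The norm `∑_A ‖a_A‖`. -/
noncomputable def addGroupNorm (𝒜 : Type*) [NormedRing 𝒜] : AddGroupNorm (Cl 𝒜) where
  toFun x := ∑ A, ‖x.coeff A‖
  map_zero' := by simp
  add_le' x y := by
    rw [← Finset.sum_add_distrib]
    exact Finset.sum_le_sum fun A _ => norm_add_le _ _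
  neg' x := by simp
  eq_zero_of_map_eq_zero' x hx := by
    rw [Finset.sum_eq_zero_iff_of_nonneg fun A _ => norm_nonneg _] at hx
    exact ext_coeff fun A => norm_eq_zero.mp (hx A (Finset.mem_univ A))

noncomputable instance instNormedAddCommGroup {𝒜 : Type*} [NormedRing 𝒜] :
    NormedAddCommGroup (Cl 𝒜) :=
  (addGroupNorm 𝒜).toNormedAddCommGroup

theorem norm_def {𝒜 : Type*} [NormedRing 𝒜] (x : Cl 𝒜) : ‖x‖ = ∑ A, ‖x.coeff A‖ := rfl

noncomputable instance instNormedSpace {𝒜 : Type*} [NormedRing 𝒜] [NormedAlgebra ℝ 𝒜] :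
    NormedSpace ℝ (Cl 𝒜) where
  norm_smul_le r x := by
    simp only [norm_def, coeff_smul, norm_smul, Finset.mul_sum, le_refl]

instance instCompleteSpace {𝒜 : Type*} [NormedRing 𝒜] [CompleteSpace 𝒜] :
    CompleteSpace (Cl 𝒜) := by
  let φ : Cl 𝒜 → PiLp 1 (fun _ : Finset (Fin 5) => 𝒜) := fun x => WithLp.toLp 1 x.coeff
  have hφ : Isometry φ := by
    refine Isometry.of_dist_eq fun x y => ?_
    rw [dist_eq_norm, dist_eq_norm, PiLp.norm_eq_of_nat 1 (by norm_num)]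
    simp [norm_def, φ, sub_eq_add_neg]
  have hs : Function.Surjective φ := fun y => ⟨⟨fun A => y A⟩, rfl⟩
  exact (completeSpace_congr (e := Equiv.ofBijective φ ⟨hφ.injective, hs⟩)
    hφ.isUniformEmbedding).mpr inferInstance

/-- The inclusion `ℝ₅ ⊆ Cl 𝒜`, `∑_A a_A e_A ↦ ∑_A (a_A 1) e_A`. -/
def ofReal (𝒜 : Type*) [Ring 𝒜] [Algebra ℝ 𝒜] (a : Cl ℝ) : Cl 𝒜 :=
  ⟨fun A => algebraMap ℝ 𝒜 (a.coeff A)⟩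

/-- The paravector `a_0 + ∑_i a_i e_i` with components `a_0, …, a_5`. -/
def paravec {𝒜 : Type*} [Ring 𝒜] (a : Fin 6 → 𝒜) : Cl 𝒜 :=
  single ∅ (a 0) + ∑ i : Fin 5, single {i} (a i.succ)

/-- The conjugate `a_0 - ∑_i a_i e_i` of a paravector, on the level of components. -/
def conj {𝒜 : Type*} [Ring 𝒜] (a : Fin 6 → 𝒜) : Fin 6 → 𝒜 := fun i => if i = 0 then a 0 else -a i

end Cl

/-! ### Slices of `ℝ⁶` -/

/-- The space `ℝ⁶` of the points `(x_0, …, x_5)`. -/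
abbrev R6 : Type := EuclideanSpace ℝ (Fin 6)

/-- The paravector `x_0 + x_1 e_1 + … + x_5 e_5` of a point of `ℝ⁶`. -/
def R6.toCl (x : R6) : Cl ℝ := Cl.paravec fun i => x i

/-- The sphere `𝕊` of the imaginary units. -/
def imagSphere : Set R6 := {J | J 0 = 0 ∧ ‖J‖ = 1}

/-- The point `u + J v` of `ℂ_J`, where `z = u + i v`. -/
noncomputable def slicePt (J : R6) (z : ℂ) : R6 := EuclideanSpace.single 0 z.re + z.im • J

/-- Axially symmetric sets. -/
def IsAxiallySymmetric (U : Set R6) : Prop :=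
  ∀ z : ℂ, ∀ I ∈ imagSphere, slicePt I z ∈ U → ∀ J ∈ imagSphere, slicePt J z ∈ U

/-- The set `𝒰` of all `(u, v)` such that `u + J v ∈ U` for all `J ∈ 𝕊` (with `ℝ² = ℂ`). -/
def sliceSet (U : Set R6) : Set ℂ := {z | ∀ J ∈ imagSphere, slicePt J z ∈ U}

/-- Piecewise continuously differentiable Jordan curves, parametrised over `[0, 1]`. -/
structure IsJordanCurve (γ : ℝ → ℂ) : Prop where
  continuousOn : ContinuousOn γ (Icc 0 1)
  closed : γ 0 = γ 1
  injOn : InjOn γ (Ico 0 1)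
  piecewise : ∃ (m : ℕ) (t : Fin (m + 1) → ℝ), StrictMono t ∧ t 0 = 0 ∧ t (Fin.last m) = 1 ∧
    ∀ k : Fin m, ContDiffOn ℝ 1 γ (Icc (t k.castSucc) (t k.succ))

/-- The boundary of `D` is the union of the pairwise disjoint Jordan curves `Γ_1, …, Γ_n`. -/
structure IsCauchyBoundary {n : ℕ} (Γ : Fin n → ℝ → ℂ) (D : Set ℂ) : Prop where
  jordan : ∀ i, IsJordanCurve (Γ i)
  disjoint : Pairwise fun i j => Disjoint (Γ i '' Icc 0 1) (Γ j '' Icc 0 1)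
  frontier_eq : frontier D = ⋃ i, Γ i '' Icc 0 1

/-- Slice Cauchy domains: axially symmetric open sets `U` such that, for every `J ∈ 𝕊`, the
boundary of `U ∩ ℂ_J` in `ℂ_J` is a finite union of disjoint piecewise `C¹` Jordan curves. -/
structure IsSliceCauchyDomain (U : Set R6) : Prop where
  isOpen : IsOpen U
  axiallySymmetric : IsAxiallySymmetric U
  cauchy : ∀ J ∈ imagSphere, ∃ (n : ℕ) (Γ : Fin n → ℝ → ℂ), IsCauchyBoundary Γ (slicePt J ⁻¹' U)

/-! ### Slice hyperholomorphic functions -/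

/-- The conditions on the pair `(α, β)`: differentiability on `𝒰`, the even-odd conditions and the
Cauchy-Riemann system. -/
structure IsSlicePair (U : Set R6) (α β : ℂ → Cl ℝ) : Prop where
  differentiable_fst : ∀ z ∈ sliceSet U, DifferentiableAt ℝ α z
  differentiable_snd : ∀ z ∈ sliceSet U, DifferentiableAt ℝ β z
  even : ∀ z ∈ sliceSet U, α (starRingEnd ℂ z) = α z
  odd : ∀ z ∈ sliceSet U, β (starRingEnd ℂ z) = -β z
  cauchyRiemann_fst : ∀ z ∈ sliceSet U, fderiv ℝ α z 1 - fderiv ℝ β z Complex.I = 0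
  cauchyRiemann_snd : ∀ z ∈ sliceSet U, fderiv ℝ α z Complex.I + fderiv ℝ β z 1 = 0

/-- Left slice hyperholomorphic functions on `U`: `f (u + J v) = α (u, v) + J β (u, v)`. -/
def SHL (U : Set R6) : Set (R6 → Cl ℝ) :=
  {f | ∃ α β : ℂ → Cl ℝ, IsSlicePair U α β ∧
    ∀ z ∈ sliceSet U, ∀ J ∈ imagSphere, f (slicePt J z) = α z + J.toCl * β z}

/-- Right slice hyperholomorphic functions on `U`: `f (u + J v) = α (u, v) + β (u, v) J`. -/
def SHR (U : Set R6) : Set (R6 → Cl ℝ) :=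
  {f | ∃ α β : ℂ → Cl ℝ, IsSlicePair U α β ∧
    ∀ z ∈ sliceSet U, ∀ J ∈ imagSphere, f (slicePt J z) = α z + β z * J.toCl}

/-! ### Differential operators -/

/-- The partial derivative `∂f/∂x_i`. -/
noncomputable def pderiv6 (i : Fin 6) (f : R6 → Cl ℝ) (x : R6) : Cl ℝ :=
  lineDeriv ℝ f x (EuclideanSpace.single i 1)

/-- `𝒟 f = ∂_0 f + ∑_i e_i ∂_i f`. -/
noncomputable def diracL (f : R6 → Cl ℝ) (x : R6) : Cl ℝ :=
  pderiv6 0 f x + ∑ i : Fin 5, Cl.e i * pderiv6 i.succ f x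

/-- `f 𝒟 = ∂_0 f + ∑_i (∂_i f) e_i`. -/
noncomputable def diracR (f : R6 → Cl ℝ) (x : R6) : Cl ℝ :=
  pderiv6 0 f x + ∑ i : Fin 5, pderiv6 i.succ f x * Cl.e i

/-- The conjugate operator `∂_0 f - ∑_i e_i ∂_i f`. -/
noncomputable def diracBarL (f : R6 → Cl ℝ) (x : R6) : Cl ℝ :=
  pderiv6 0 f x - ∑ i : Fin 5, Cl.e i * pderiv6 i.succ f x

/-- The conjugate operator `∂_0 f - ∑_i (∂_i f) e_i`. -/
noncomputable def diracBarR (f : R6 → Cl ℝ) (x : R6) : Cl ℝ :=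
  pderiv6 0 f x - ∑ i : Fin 5, pderiv6 i.succ f x * Cl.e i

/-- The operators `Δ 𝒟`, `𝒟`, `Δ`, `𝒟bar`, `𝒟bar²`, `Δ 𝒟bar`, `𝒟²` of the fine structure. -/
inductive FineOp where
  | lapDirac
  | dirac
  | lap
  | diracBar
  | diracBarSq
  | lapDiracBar
  | diracSq

namespace FineOp

/-- The degree (order) of the differential operator. -/
def degree : FineOp → ℕ
  | lapDirac => 3
  | dirac => 1
  | lap => 2
  | diracBar => 1
  | diracBarSq => 2
  | lapDiracBar => 3
  | diracSq => 2

/-- The function `𝖯 f`. -/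
noncomputable def applyL : FineOp → (R6 → Cl ℝ) → R6 → Cl ℝ
  | lapDirac, f => Laplacian.laplacian (diracL f)
  | dirac, f => diracL f
  | lap, f => Laplacian.laplacian f
  | diracBar, f => diracBarL f
  | diracBarSq, f => diracBarL (diracBarL f)
  | lapDiracBar, f => Laplacian.laplacian (diracBarL f)
  | diracSq, f => diracL (diracL f)

/-- The function `f 𝖯`. -/
noncomputable def applyR : FineOp → (R6 → Cl ℝ) → R6 → Cl ℝ
  | lapDirac, f => Laplacian.laplacian (diracR f)
  | dirac, f => diracR f
  | lap, f => Laplacian.laplacian f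
  | diracBar, f => diracBarR f
  | diracBarSq, f => diracBarR (diracBarR f)
  | lapDiracBar, f => Laplacian.laplacian (diracBarR f)
  | diracSq, f => diracR (diracR f)

/-- The kernel of `𝖯` in the left slice hyperholomorphic functions on `Ω`. -/
def kerL (P : FineOp) (Ω : Set R6) : Set (R6 → Cl ℝ) := {f ∈ SHL Ω | ∀ x ∈ Ω, P.applyL f x = 0}

/-- The kernel of `𝖯` in the right slice hyperholomorphic functions on `Ω`. -/
def kerR (P : FineOp) (Ω : Set R6) : Set (R6 → Cl ℝ) := {f ∈ SHR Ω | ∀ x ∈ Ω, P.applyR f x = 0}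

end FineOp

/-! ### The `S`-spectrum and the resolvent operators

A paravector operator `T = T_0 + ∑_i T_i e_i` is given by its components `T_0, …, T_5`, elements
of an algebra `𝒜` (the algebra of the bounded operators on a real Banach space). -/

section resolvents
variable {𝒜 : Type*} [Ring 𝒜] [Algebra ℝ 𝒜]

/-- The operator `s ℐ` for a paravector `s`. -/
def scalarOp (𝒜 : Type*) [Ring 𝒜] [Algebra ℝ 𝒜] (s : R6) : Cl 𝒜 := Cl.ofReal 𝒜 s.toCl

/-- `𝒬_{c,s}(T) = s² ℐ - s (T + Tbar) + T Tbar`. -/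
def Qc (s : R6) (T : Fin 6 → 𝒜) : Cl 𝒜 :=
  scalarOp 𝒜 s ^ 2 - scalarOp 𝒜 s * (Cl.paravec T + Cl.paravec (Cl.conj T))
    + Cl.paravec T * Cl.paravec (Cl.conj T)

/-- The `S`-spectrum of `T`. -/
def sSpectrum (T : Fin 6 → 𝒜) : Set R6 := {s | ¬ IsUnit (Qc s T)}

/-- `𝒬_{c,s}(T)⁻¹`. -/
noncomputable def QcInv (s : R6) (T : Fin 6 → 𝒜) : Cl 𝒜 := Ring.inverse (Qc s T)

/-- The left `SC`-resolvent operator `S_L⁻¹(s, T)`. -/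
noncomputable def resolventSL (s : R6) (T : Fin 6 → 𝒜) : Cl 𝒜 :=
  (scalarOp 𝒜 s - Cl.paravec (Cl.conj T)) * QcInv s T

/-- The right `SC`-resolvent operator `S_R⁻¹(s, T)`. -/
noncomputable def resolventSR (s : R6) (T : Fin 6 → 𝒜) : Cl 𝒜 :=
  QcInv s T * (scalarOp 𝒜 s - Cl.paravec (Cl.conj T))

/-- The left resolvent operator `S_{𝖯,L}⁻¹(s, T)`. -/
noncomputable def FineOp.resolventL (s : R6) (T : Fin 6 → 𝒜) : FineOp → Cl 𝒜
  | lapDirac => (16 : ℝ) • QcInv s T ^ 2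
  | dirac => (-4 : ℝ) • QcInv s T
  | lap => (-8 : ℝ) • (resolventSL s T * QcInv s T)
  | diracBar => (4 : ℝ) • ((scalarOp 𝒜 s - Cl.paravec (Cl.conj T)) * QcInv s T ^ 2 *
      (scalarOp 𝒜 s - Cl.single ∅ (T 0))) + (2 : ℝ) • QcInv s T
  | diracBarSq => (32 : ℝ) • ((scalarOp 𝒜 s - Cl.paravec (Cl.conj T)) * QcInv s T ^ 3 *
      (scalarOp 𝒜 s - Cl.single ∅ (T 0)) ^ 2)
  | lapDiracBar => (-64 : ℝ) • ((scalarOp 𝒜 s - Cl.paravec (Cl.conj T)) * QcInv s T ^ 3 *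
      (scalarOp 𝒜 s - Cl.single ∅ (T 0)))
  | diracSq => (-8 : ℝ) • (resolventSL s (Cl.conj T) * QcInv s T)

/-- The right resolvent operator `S_{𝖯,R}⁻¹(s, T)`. -/
noncomputable def FineOp.resolventR (s : R6) (T : Fin 6 → 𝒜) : FineOp → Cl 𝒜
  | lapDirac => (16 : ℝ) • QcInv s T ^ 2
  | dirac => (-4 : ℝ) • QcInv s T
  | lap => (-8 : ℝ) • (QcInv s T * resolventSR s T)
  | diracBar => (4 : ℝ) • ((scalarOp 𝒜 s - Cl.single ∅ (T 0)) * QcInv s T ^ 2 *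
      (scalarOp 𝒜 s - Cl.paravec (Cl.conj T))) + (2 : ℝ) • QcInv s T
  | diracBarSq => (32 : ℝ) • ((scalarOp 𝒜 s - Cl.single ∅ (T 0)) ^ 2 * QcInv s T ^ 3 *
      (scalarOp 𝒜 s - Cl.paravec (Cl.conj T)))
  | lapDiracBar => (-64 : ℝ) • ((scalarOp 𝒜 s - Cl.single ∅ (T 0)) * QcInv s T ^ 3 *
      (scalarOp 𝒜 s - Cl.paravec (Cl.conj T)))
  | diracSq => (-8 : ℝ) • (QcInv s T * resolventSR s (Cl.conj T))

end resolvents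

/-! ### The functional calculi -/

/-- The winding number of the closed curve `γ` about `z`. -/
noncomputable def windingNum (γ : ℝ → ℂ) (z : ℂ) : ℂ :=
  (2 * Real.pi * Complex.I)⁻¹ * ∫ t in (0 : ℝ)..1, deriv γ t / (γ t - z)

/-- `Γ_1, …, Γ_n` is the positively oriented boundary of the bounded open set `D`: the curves
together wind once around the points of `D` and do not wind around the points off the closure. -/
structure IsPositiveBoundary {n : ℕ} (Γ : Fin n → ℝ → ℂ) (D : Set ℂ) : Prop
    extends IsCauchyBoundary Γ D where
  winding_inside : ∀ z ∈ D, ∑ i, windingNum (Γ i) z = 1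
  winding_outside : ∀ z ∉ closure D, ∑ i, windingNum (Γ i) z = 0

/-- The choices in the integrals for `(𝖯 f)(T)` and `(f 𝖯)(T)` when `f` is defined on `U`: a
bounded slice Cauchy domain `W` with `σ_S(T) ⊆ W` and `closure W ⊆ U`, an imaginary unit `J`, and a
parametrisation `Γ` of the positively oriented boundary of `W ∩ ℂ_J` in `ℂ_J`. -/
structure CalculusContour {𝒜 : Type*} [Ring 𝒜] [Algebra ℝ 𝒜] (T : Fin 6 → 𝒜) (U : Set R6) where
  W : Set R6
  J : R6
  n : ℕ
  Γ : Fin n → ℝ → ℂ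
  isSliceCauchyDomain : IsSliceCauchyDomain W
  isBounded : Bornology.IsBounded W
  spectrum_subset : sSpectrum T ⊆ W
  closure_subset : closure W ⊆ U
  mem_imagSphere : J ∈ imagSphere
  isPositiveBoundary : IsPositiveBoundary Γ (slicePt J ⁻¹' W)

section calculus
variable {𝒜 : Type*} [NormedRing 𝒜] [NormedAlgebra ℝ 𝒜] {T : Fin 6 → 𝒜} {U : Set R6}

/-- `(𝖯 f)(T) = (1 / 2π) ∫ S_{𝖯,L}⁻¹(s, T) ds_J f(s)` over the boundary of `W ∩ ℂ_J`, with
`ds_J = ds (-J)`. -/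
noncomputable def fineCalculusL (P : FineOp) (f : R6 → Cl ℝ) (c : CalculusContour T U) : Cl 𝒜 :=
  (1 / (2 * Real.pi)) • ∑ i, ∫ t in (0 : ℝ)..1,
    P.resolventL (slicePt c.J (c.Γ i t)) T *
      Cl.ofReal 𝒜 ((slicePt c.J (deriv (c.Γ i) t)).toCl * -c.J.toCl * f (slicePt c.J (c.Γ i t)))

/-- `(f 𝖯)(T) = (1 / 2π) ∫ f(s) ds_J S_{𝖯,R}⁻¹(s, T)` over the boundary of `W ∩ ℂ_J`. -/
noncomputable def fineCalculusR (P : FineOp) (f : R6 → Cl ℝ) (c : CalculusContour T U) : Cl 𝒜 :=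
  (1 / (2 * Real.pi)) • ∑ i, ∫ t in (0 : ℝ)..1,
    Cl.ofReal 𝒜 (f (slicePt c.J (c.Γ i t)) *
      ((slicePt c.J (deriv (c.Γ i) t)).toCl * -c.J.toCl)) *
        P.resolventR (slicePt c.J (c.Γ i t)) T

end calculus

open Filter Topology MeasureTheory Metric

/-! ### The homology form of Cauchy's theorem -/

/-! Everything is reduced to scalar holomorphic functions. A slice function with components α, β is
encoded, coefficient by coefficient, by its stem function F_A = α_A + i β_A: the Cauchy-Riemann
system says that F_A is holomorphic, the even-odd conditions say that it commutes with conjugation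
(`IsSlicePair.exists_isStem`, `IsStem.isSlicePair`).

Kernels. Where v > 0, f is α + x⃗ (β / v), and the Dirac operators and the Laplacian preserve the
form a(x₀, r) + x⃗ b(x₀, r). Hence 𝖯 f is an explicit combination of the real and imaginary parts of
F, F', F'', F''' with powers of 1/v as coefficients (`AxialOn.applyL`). Comparing the values along J
and -J separates a from b. Their vanishing, differentiated once or twice where necessary, yields one
of three conditions according to the degree 1, 2, 3: Im F = 0; or Im F' = 0 and v Re F' = Im F; or
only v Re F' = Im F (`FineOp.relations_of_parts_eq_zero`). These force F to be a polynomial with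
real coefficients of degree below deg 𝖯 on a small disc (`exists_polynomial_of_relations`), and the
identity theorem spreads this over the whole domain (`exists_polynomial_eq_sub`). Conversely, such
polynomials are annihilated because each order of differentiation lowers the degree
(`FineOp.applyL_poly`). The right-sided statements follow by reversion, an anti-automorphism that
fixes the paravectors.

Functional calculi. The resolvent of 𝖯 has the form g₀ + M g₁ (on the right g₀ + g₁ M) with a
constant M and slice functions g₀, g₁ of s that are O(|s|^(-(deg 𝖯 + 1)))
(`FineOp.exists_isOpSlice`). If 𝖯 f = 𝖯 g, the stem functions differ by polynomials of degree at
most deg 𝖯 - 1, so the difference of the integrands is holomorphic off the spectrum and O(|z|⁻²);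
pushing the contour to infinity shows that its integral vanishes. Independence of W is Cauchy's
theorem. Independence of J holds because the integrals are invariant under conjugation and so have
no component along the imaginary unit. The three facts are combined in
`IsOpStem.subst_stemIntegral_eq`, where real functionals on the coefficients reduce operator-valued
integrals to complex ones.

Cauchy's theorem is proved in homology form by Dixon's argument
(`sum_intervalIntegral_eq_zero_of_cauchyTransform`), for curves carrying arbitrary integrable
densities. Reversed, conjugated and circular contours are then covered by one statement. -/

theorem aestronglyMeasurable_restrict_uIoc {k : ℝ → ℂ} (h : ContinuousOn k (Icc 0 1)) :
    AEStronglyMeasurable k (volume.restrict (uIoc (0 : ℝ) 1)) := by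
  rw [uIoc_of_le zero_le_one]
  exact (h.mono Ioc_subset_Icc_self).aestronglyMeasurable measurableSet_Ioc

theorem intervalIntegrable_continuousOn_mul {k ω : ℝ → ℂ} (h : ContinuousOn k (Icc 0 1))
    (hω : IntervalIntegrable ω volume 0 1) :
    IntervalIntegrable (fun t => k t * ω t) volume 0 1 :=
  hω.continuousOn_mul (by rwa [uIcc_of_le zero_le_one])

/-- Cauchy's estimate on discs of radius r/4 turns the uniform bound M on the kernel into the bound
M / (r/4) on its z-derivative. This dominates the differentiated integrand, so no separate
hypothesis on the derivative is needed. -/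
theorem differentiableAt_intervalIntegral_mul {k : ℂ → ℝ → ℂ} {ω : ℝ → ℂ} {z₀ : ℂ} {r M : ℝ}
    (hr : 0 < r) (hω : IntervalIntegrable ω volume 0 1)
    (hcont : ∀ z ∈ ball z₀ r, ContinuousOn (k z) (Icc 0 1))
    (hdiff : ∀ t ∈ Icc (0 : ℝ) 1, DifferentiableOn ℂ (fun z => k z t) (ball z₀ r))
    (hM : ∀ z ∈ ball z₀ r, ∀ t ∈ Icc (0 : ℝ) 1, ‖k z t‖ ≤ M) :
    DifferentiableAt ℂ (fun z => ∫ t in (0 : ℝ)..1, k z t * ω t) z₀ := by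
  have hsub : uIoc (0 : ℝ) 1 ⊆ Icc 0 1 := by
    rw [uIoc_of_le zero_le_one]; exact Ioc_subset_Icc_self
  have hz₀ : z₀ ∈ ball z₀ r := mem_ball_self hr
  have hωm : AEStronglyMeasurable ω (volume.restrict (uIoc (0 : ℝ) 1)) :=
    hω.def'.aestronglyMeasurable
  have hd : ∀ z ∈ ball z₀ r, ∀ t ∈ Icc (0 : ℝ) 1,
      HasDerivAt (fun z => k z t) (deriv (fun z => k z t) z) z := fun z hz t ht =>
    ((hdiff t ht).differentiableAt (isOpen_ball.mem_nhds hz)).hasDerivAt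
  refine (intervalIntegral.hasDerivAt_integral_of_dominated_loc_of_deriv_le (𝕜 := ℂ)
    (F' := fun z t => deriv (fun z => k z t) z * ω t) (s := ball z₀ (r / 2))
    (bound := fun t => M / (r / 4) * ‖ω t‖) (ball_mem_nhds z₀ (by positivity)) ?_ ?_ ?_ ?_ ?_
    ?_).2.differentiableAt
  · filter_upwards [ball_mem_nhds z₀ hr] with z hz
    exact (aestronglyMeasurable_restrict_uIoc (hcont z hz)).mul hωm
  · exact intervalIntegrable_continuousOn_mul (hcont z₀ hz₀) hω
  · refine AEStronglyMeasurable.mul ?_ hωm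
    -- Measurability in t of the z-derivative: it is a pointwise limit of difference quotients that
    -- are continuous in t. The shift n + 2 keeps the sample points strictly inside the ball already
    -- for n = 0.
    have hseq : ∀ n : ℕ, z₀ + (r / (n + 2) : ℝ) ∈ ball z₀ r := fun n => by
      rw [mem_ball, dist_eq_norm, add_sub_cancel_left, Complex.norm_real, Real.norm_eq_abs,
        abs_of_pos (by positivity), div_lt_iff₀ (by positivity)]
      nlinarith [(Nat.cast_nonneg n : (0 : ℝ) ≤ n)]
    have hlim : Tendsto (fun n : ℕ => z₀ + ((r / (n + 2) : ℝ) : ℂ)) atTop (𝓝[≠] z₀) := by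
      refine tendsto_nhdsWithin_iff.mpr ⟨?_, Eventually.of_forall fun n => ?_⟩
      · have h1 : Tendsto (fun n : ℕ => r / ((n : ℝ) + 2)) atTop (𝓝 0) :=
          tendsto_const_nhds.div_atTop
            (tendsto_atTop_add_const_right _ _ tendsto_natCast_atTop_atTop)
        have h2 := (Complex.continuous_ofReal.tendsto 0).comp h1
        simpa [Function.comp_def] using tendsto_const_nhds (x := z₀) |>.add h2
      · have : (r / ((n : ℝ) + 2) : ℝ) ≠ 0 := by positivity
        simpa only [mem_compl_iff, mem_singleton_iff, add_eq_left, Complex.ofReal_eq_zero]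
          using this
    refine aestronglyMeasurable_of_tendsto_ae atTop
      (f := fun (n : ℕ) t => slope (fun z => k z t) z₀ (z₀ + ((r / (n + 2) : ℝ) : ℂ)))
      (fun n => aestronglyMeasurable_restrict_uIoc ?_) ?_
    · simp only [slope_def_field]
      exact ((hcont _ (hseq n)).sub (hcont _ hz₀)).div_const _
    · refine (ae_restrict_iff' measurableSet_uIoc).mpr (Eventually.of_forall fun t ht => ?_)
      exact (hasDerivAt_iff_tendsto_slope.mp (hd z₀ hz₀ t (hsub ht))).comp hlim
  · refine Eventually.of_forall fun t ht z hz => ?_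
    have hcb : closedBall z (r / 4) ⊆ ball z₀ r := fun w hw => by
      have h1 := mem_closedBall.mp hw
      have h2 := mem_ball.mp hz
      rw [mem_ball]
      linarith [dist_triangle w z z₀]
    rw [norm_mul]
    refine mul_le_mul_of_nonneg_right ?_ (norm_nonneg _)
    refine Complex.norm_deriv_le_of_forall_mem_sphere_norm_le (by positivity) ?_
      fun w hw => hM w (hcb (sphere_subset_closedBall hw)) t (hsub ht)
    refine DifferentiableOn.diffContOnCl ?_
    exact (hdiff t (hsub ht)).mono (closure_ball_subset_closedBall.trans hcb)
  · exact hω.norm.const_mul _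
  · refine Eventually.of_forall fun t ht z hz => ?_
    exact (hd z (ball_subset_ball (by linarith) hz) t (hsub ht)).mul_const _

/-- By this symmetry the difference quotient is holomorphic in the parameter as soon as it is so in
the other argument. -/
theorem dslope_comm {G : ℂ → ℂ} (z w : ℂ) : dslope G z w = dslope G w z := by
  rcases eq_or_ne z w with rfl | h
  · rfl
  · rw [dslope_of_ne _ h.symm, dslope_of_ne _ h, slope_comm]

/-- For w close to z₀ the mean value inequality on a convex closed ball bounds the quotient by sup
|G'|; for the remaining w the denominator is at least ε/4. This gives the bound needed to
differentiate Dixon's function under the integral. -/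
theorem exists_bound_dslope {G : ℂ → ℂ} {U C : Set ℂ} (hU : IsOpen U) (hC : IsCompact C)
    (hCU : C ⊆ U) (hG : DifferentiableOn ℂ G U) {z₀ : ℂ} (hz₀ : z₀ ∈ U) :
    ∃ r > 0, ball z₀ r ⊆ U ∧ ∃ M, ∀ z ∈ ball z₀ r, ∀ w ∈ C, ‖dslope G z w‖ ≤ M := by
  obtain ⟨ε, hε, hεU⟩ := Metric.isOpen_iff.mp hU z₀ hz₀
  have hK : closedBall z₀ (ε / 2) ⊆ U := (closedBall_subset_ball (by linarith)).trans hεU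
  obtain ⟨L, hL⟩ := (isCompact_closedBall z₀ (ε / 2)).exists_bound_of_continuousOn
    ((hG.deriv hU).continuousOn.mono hK)
  obtain ⟨N, hN⟩ := ((isCompact_closedBall z₀ (ε / 2)).union hC).exists_bound_of_continuousOn
    (hG.continuousOn.mono (union_subset hK hCU))
  refine ⟨ε / 4, by positivity, (ball_subset_ball (by linarith)).trans hεU,
    max L ((N + N) / (ε / 4)), fun z hz w hw => ?_⟩
  have hz' : z ∈ closedBall z₀ (ε / 2) :=
    ball_subset_closedBall (ball_subset_ball (by linarith) hz)
  have hN0 : 0 ≤ N := (norm_nonneg _).trans (hN z (Or.inl hz'))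
  by_cases hwz : w ∈ closedBall z₀ (ε / 2)
  · refine le_max_of_le_left ?_
    rcases eq_or_ne w z with rfl | hne
    · rw [dslope_same]; exact hL w hwz
    · rw [dslope_of_ne _ hne, slope_def_field, norm_div,
        div_le_iff₀ (norm_pos_iff.mpr (sub_ne_zero.mpr hne))]
      exact (convex_closedBall z₀ (ε / 2)).norm_image_sub_le_of_norm_deriv_le
        (fun x hx => hG.differentiableAt (hU.mem_nhds (hK hx))) hL hz' hwz
  · refine le_max_of_le_right ?_
    have h1 : ε / 2 < dist w z₀ := not_le.mp hwz
    have h2 : dist z z₀ < ε / 4 := hz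
    have h3 : ε / 4 ≤ ‖w - z‖ := by
      rw [← dist_eq_norm]
      linarith [dist_triangle w z z₀]
    have hne : w ≠ z := by
      rintro rfl
      simp at h3; linarith
    rw [dslope_of_ne _ hne, slope_def_field, norm_div]
    exact div_le_div₀ (by positivity)
      ((norm_sub_le _ _).trans (add_le_add (hN w (Or.inr hw)) (hN z (Or.inl hz'))))
      (by positivity) h3

theorem differentiableOn_dslope_of_isOpen {G : ℂ → ℂ} {U : Set ℂ} (hU : IsOpen U)
    (hG : DifferentiableOn ℂ G U) {z : ℂ} (hz : z ∈ U) : DifferentiableOn ℂ (dslope G z) U :=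
  (Complex.differentiableOn_dslope (hU.mem_nhds hz)).mpr hG

/-- The curve lies in a disc of radius R, so the Cauchy kernel is at most M / (|z| - R) for large z.
This is the decay at infinity that Liouville's theorem requires. -/
theorem tendsto_intervalIntegral_cauchy_cobounded {g γ ω : ℝ → ℂ}
    (hγ : ContinuousOn γ (Icc 0 1)) (hg : ContinuousOn g (Icc 0 1))
    (hω : IntervalIntegrable ω volume 0 1) :
    Tendsto (fun z => ∫ t in (0 : ℝ)..1, g t / (γ t - z) * ω t) (Bornology.cobounded ℂ) (𝓝 0) := by
  obtain ⟨R, hR⟩ := isCompact_Icc.exists_bound_of_continuousOn hγ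
  obtain ⟨M, hM⟩ := isCompact_Icc.exists_bound_of_continuousOn hg
  have hM0 : 0 ≤ M := (norm_nonneg _).trans (hM 0 ⟨le_rfl, zero_le_one⟩)
  have hlim : Tendsto (fun z : ℂ => M / (‖z‖ - R) * ∫ t in (0 : ℝ)..1, ‖ω t‖)
      (Bornology.cobounded ℂ) (𝓝 0) := by
    have h1 : Tendsto (fun z : ℂ => ‖z‖ - R) (Bornology.cobounded ℂ) atTop :=
      tendsto_atTop_add_const_right _ _ tendsto_norm_cobounded_atTop
    simpa using (tendsto_const_nhds.div_atTop h1).mul_const (∫ t in (0 : ℝ)..1, ‖ω t‖)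
  refine squeeze_zero_norm' ?_ hlim
  filter_upwards [tendsto_norm_cobounded_atTop.eventually_gt_atTop R] with z hz
  have hpos : 0 < ‖z‖ - R := sub_pos.mpr hz
  calc ‖∫ t in (0 : ℝ)..1, g t / (γ t - z) * ω t‖
      ≤ ∫ t in (0 : ℝ)..1, M / (‖z‖ - R) * ‖ω t‖ := by
        refine intervalIntegral.norm_integral_le_of_norm_le zero_le_one
          (Eventually.of_forall fun t ht => ?_) (hω.norm.const_mul _)
        have ht' := Ioc_subset_Icc_self ht
        rw [norm_mul, norm_div]
        refine mul_le_mul_of_nonneg_right (div_le_div₀ hM0 (hM t ht') hpos ?_) (norm_nonneg _)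
        have := norm_sub_norm_le z (γ t)
        rw [norm_sub_rev] at this
        linarith [hR t ht']
    _ = _ := by rw [intervalIntegral.integral_const_mul]

/-- Curves `γ_i` with densities `ω_i` whose Cauchy transform vanishes on an open neighbourhood `U'`
of the complement of `U` and of infinity integrate holomorphic functions on `U` to `0`. -/
theorem sum_intervalIntegral_eq_zero_of_cauchyTransform {ι : Type*} [Fintype ι] {γ ω : ι → ℝ → ℂ}
    {U U' : Set ℂ} {G : ℂ → ℂ} (hγ : ∀ i, ContinuousOn (γ i) (Icc 0 1))
    (hω : ∀ i, IntervalIntegrable (ω i) volume 0 1) (hU : IsOpen U) (hU' : IsOpen U')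
    (hcov : ∀ z, z ∉ U → z ∈ U') (hγU : ∀ i, ∀ t ∈ Icc (0 : ℝ) 1, γ i t ∈ U)
    (hγU' : ∀ i, ∀ t ∈ Icc (0 : ℝ) 1, γ i t ∉ U') (hinf : U' ∈ Bornology.cobounded ℂ)
    (hzero : ∀ z ∈ U', ∑ i, ∫ t in (0 : ℝ)..1, ω i t / (γ i t - z) = 0)
    (hG : DifferentiableOn ℂ G U) :
    ∑ i, ∫ t in (0 : ℝ)..1, G (γ i t) * ω i t = 0 := by
  classical
  rcases U.eq_empty_or_nonempty with hUe | ⟨z₁, hz₁⟩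
  · refine Finset.sum_eq_zero fun i _ => ?_
    have := hγU i 0 ⟨le_rfl, zero_le_one⟩
    simp [hUe] at this
  -- The factor w - z₁ makes the difference quotient of H at z₁ equal to G, so that h₁ z₁ is the
  -- integral that has to vanish.
  set H : ℂ → ℂ := fun w => (w - z₁) • G w with hH
  have hHd : DifferentiableOn ℂ H U := (differentiableOn_id.sub_const z₁).smul hG
  have hHγ : ∀ i, ContinuousOn (fun t => H (γ i t)) (Icc 0 1) := fun i =>
    hHd.continuousOn.comp (hγ i) (hγU i)
  set h₁ : ℂ → ℂ := fun z => ∑ i, ∫ t in (0 : ℝ)..1, dslope H z (γ i t) * ω i t with hh₁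
  set h₂ : ℂ → ℂ := fun z => ∑ i, ∫ t in (0 : ℝ)..1, H (γ i t) / (γ i t - z) * ω i t with hh₂
  have hγne : ∀ i, ∀ t ∈ Icc (0 : ℝ) 1, ∀ z ∈ U', γ i t - z ≠ 0 := fun i t ht z hz h =>
    hγU' i t ht (by rwa [sub_eq_zero.mp h])
  have hd₁ : ∀ z ∈ U, DifferentiableAt ℂ h₁ z := by
    intro z hz
    refine DifferentiableAt.fun_sum fun i _ => ?_
    obtain ⟨r, hr, hrU, M, hM⟩ := exists_bound_dslope hU (isCompact_Icc.image_of_continuousOn (hγ i))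
      (image_subset_iff.mpr (hγU i)) hHd hz
    refine differentiableAt_intervalIntegral_mul hr (hω i) (fun w hw => ?_) (fun t ht => ?_)
      fun w hw t ht => hM w hw _ (mem_image_of_mem _ ht)
    · exact (differentiableOn_dslope_of_isOpen hU hHd (hrU hw)).continuousOn.comp (hγ i)
        (hγU i)
    · simp only [dslope_comm _ (γ i t)]
      exact (differentiableOn_dslope_of_isOpen hU hHd (hγU i t ht)).mono hrU
  have hd₂ : ∀ z ∈ U', DifferentiableAt ℂ h₂ z := by
    intro z hz
    refine DifferentiableAt.fun_sum fun i _ => ?_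
    obtain ⟨ε, hε, hεU⟩ := Metric.isOpen_iff.mp hU' z hz
    obtain ⟨N, hN⟩ := isCompact_Icc.exists_bound_of_continuousOn (hHγ i)
    have hN0 : 0 ≤ N := (norm_nonneg _).trans (hN 0 ⟨le_rfl, zero_le_one⟩)
    have hsub : ball z (ε / 2) ⊆ U' := (ball_subset_ball (by linarith)).trans hεU
    refine differentiableAt_intervalIntegral_mul (M := N / (ε / 2)) (half_pos hε) (hω i)
      (fun w hw => (hHγ i).div ((hγ i).sub continuousOn_const)
        fun t ht => hγne i t ht w (hsub hw)) (fun t ht => ?_) fun w hw t ht => ?_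
    · exact (differentiableOn_const _).div ((differentiableOn_const _).sub differentiableOn_id)
        fun w hw => hγne i t ht w (hsub hw)
    · rw [norm_div]
      refine div_le_div₀ hN0 (hN t ht) (half_pos hε) ?_
      rw [← dist_eq_norm]
      by_contra hlt
      refine hγU' i t ht (hεU ?_)
      have hw' := mem_ball.mp hw
      rw [mem_ball]
      linarith [dist_triangle (γ i t) w z]
  -- On U' the two integrals differ by H z times the Cauchy transform of the densities, which is
  -- zero there.
  have heq : ∀ z ∈ U', h₁ z = h₂ z := by
    intro z hz
    have hsum : ∀ i, ∫ t in (0 : ℝ)..1, dslope H z (γ i t) * ω i t =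
        (∫ t in (0 : ℝ)..1, H (γ i t) / (γ i t - z) * ω i t) -
          H z * ∫ t in (0 : ℝ)..1, ω i t / (γ i t - z) := by
      intro i
      have hinv : ContinuousOn (fun t => (γ i t - z)⁻¹) (Icc 0 1) :=
        ((hγ i).sub continuousOn_const).inv₀ fun t ht => hγne i t ht z hz
      rw [← intervalIntegral.integral_const_mul, ← intervalIntegral.integral_sub]
      · refine intervalIntegral.integral_congr fun t ht => ?_
        rw [uIcc_of_le zero_le_one] at ht
        have hne := hγne i t ht z hz
        rw [dslope_of_ne _ (sub_ne_zero.mp hne), slope_def_field]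
        field_simp
      · refine intervalIntegrable_continuousOn_mul ?_ (hω i)
        exact (hHγ i).div ((hγ i).sub continuousOn_const) fun t ht => hγne i t ht z hz
      · refine IntervalIntegrable.const_mul ?_ _
        simpa only [div_eq_mul_inv, mul_comm] using intervalIntegrable_continuousOn_mul hinv (hω i)
    simp only [hh₁, hh₂, hsum, Finset.sum_sub_distrib, ← Finset.mul_sum, hzero z hz, mul_zero,
      sub_zero]
  -- U and U' cover the plane, so the two formulas glue to an entire function. It tends to 0 at
  -- infinity, hence is identically 0.
  set h : ℂ → ℂ := fun z => if z ∈ U then h₁ z else h₂ z with hh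
  have hhU : ∀ z ∈ U, h z = h₁ z := fun z hz => if_pos hz
  have hhU' : ∀ z ∈ U', h z = h₂ z := fun z hz => by
    by_cases hzU : z ∈ U
    · rw [hhU z hzU, heq z hz]
    · exact if_neg hzU
  have hent : Differentiable ℂ h := by
    intro z
    by_cases hz : z ∈ U
    · exact (hd₁ z hz).congr_of_eventuallyEq (eventually_of_mem (hU.mem_nhds hz) hhU)
    · exact (hd₂ z (hcov z hz)).congr_of_eventuallyEq
        (eventually_of_mem (hU'.mem_nhds (hcov z hz)) hhU')
  have hlim : Tendsto h (cocompact ℂ) (𝓝 0) := by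
    rw [← Metric.cobounded_eq_cocompact]
    have : Tendsto h₂ (Bornology.cobounded ℂ) (𝓝 0) := by
      have := tendsto_finsetSum (Finset.univ : Finset ι) fun i _ =>
        tendsto_intervalIntegral_cauchy_cobounded (hγ i) (hHγ i) (hω i)
      simpa using this
    exact this.congr' (eventually_of_mem hinf fun z hz => (hhU' z hz).symm)
  have hval := hent.apply_eq_of_tendsto_cocompact z₁ hlim
  rw [hhU z₁ hz₁] at hval
  rw [← hval]
  refine Finset.sum_congr rfl fun i _ => intervalIntegral.integral_congr fun t ht => ?_
  rw [uIcc_of_le zero_le_one] at ht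
  congr 1
  rw [hH, dslope_sub_smul, Function.update_apply]
  split_ifs with hw
  · rw [hw]
    have h1 : HasDerivAt G (deriv G z₁) z₁ :=
      (hG.differentiableAt (hU.mem_nhds hz₁)).hasDerivAt
    have h2 := ((hasDerivAt_id z₁).sub_const z₁).smul h1
    have h3 : deriv (fun x => (x - z₁) • G x) z₁ = _ := h2.deriv
    simpa using h3.symm
  · rfl

/-! ### Contours -/

/-- On each open piece `deriv γ` agrees with a function continuous on the closed piece. The finitely
many break points, where `deriv` may be a default value, form a null set. -/
theorem IsJordanCurve.intervalIntegrable_deriv {γ : ℝ → ℂ} (h : IsJordanCurve γ) :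
    IntervalIntegrable (deriv γ) volume 0 1 := by
  obtain ⟨m, t, ht, h0, h1, hd⟩ := h.piecewise
  have hpiece : ∀ k : Fin m, IntervalIntegrable (deriv γ) volume (t k.castSucc) (t k.succ) := by
    intro k
    have hlt : t k.castSucc < t k.succ := ht Fin.castSucc_lt_succ
    have hc : ContinuousOn (derivWithin γ (Icc (t k.castSucc) (t k.succ)))
        (Icc (t k.castSucc) (t k.succ)) :=
      (hd k).continuousOn_derivWithin (uniqueDiffOn_Icc hlt) le_rfl
    have hi := hc.intervalIntegrable_of_Icc (μ := volume) hlt.le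
    rw [intervalIntegrable_iff_integrableOn_Ioo_of_le hlt.le] at hi ⊢
    refine hi.congr_fun (fun x hx => ?_) measurableSet_Ioo
    exact derivWithin_of_mem_nhds (Icc_mem_nhds hx.1 hx.2)
  have hall : ∀ j : Fin (m + 1), IntervalIntegrable (deriv γ) volume (t 0) (t j) := by
    intro j
    induction j using Fin.induction with
    | zero => exact IntervalIntegrable.refl
    | succ k ih => exact ih.trans (hpiece k)
  have := hall (Fin.last m)
  rwa [h0, h1] at this

namespace IsPositiveBoundary

variable {n n' : ℕ} {Γ : Fin n → ℝ → ℂ} {Γ' : Fin n' → ℝ → ℂ} {D D' U K : Set ℂ} {G : ℂ → ℂ}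

theorem mem_frontier (h : IsPositiveBoundary Γ D) (i : Fin n) {t : ℝ} (ht : t ∈ Icc (0 : ℝ) 1) :
    Γ i t ∈ frontier D := by
  rw [h.frontier_eq]
  exact mem_iUnion.mpr ⟨i, mem_image_of_mem _ ht⟩

theorem mem_closure (h : IsPositiveBoundary Γ D) (i : Fin n) {t : ℝ} (ht : t ∈ Icc (0 : ℝ) 1) :
    Γ i t ∈ closure D := frontier_subset_closure (h.mem_frontier i ht)

theorem notMem (h : IsPositiveBoundary Γ D) (hD : IsOpen D) (i : Fin n) {t : ℝ}
    (ht : t ∈ Icc (0 : ℝ) 1) : Γ i t ∉ D := by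
  have := h.mem_frontier i ht
  rw [hD.frontier_eq] at this
  exact this.2

theorem sum_integral_eq (z : ℂ) :
    ∑ i, ∫ t in (0 : ℝ)..1, deriv (Γ i) t / (Γ i t - z) =
      2 * Real.pi * Complex.I * ∑ i, windingNum (Γ i) z := by
  rw [Finset.mul_sum]
  refine Finset.sum_congr rfl fun i _ => ?_
  rw [windingNum, mul_inv_cancel_left₀ Complex.two_pi_I_ne_zero]

theorem sum_integral_inside (h : IsPositiveBoundary Γ D) {z : ℂ} (hz : z ∈ D) :
    ∑ i, ∫ t in (0 : ℝ)..1, deriv (Γ i) t / (Γ i t - z) = 2 * Real.pi * Complex.I := by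
  rw [sum_integral_eq, h.winding_inside z hz, mul_one]

theorem sum_integral_outside (h : IsPositiveBoundary Γ D) {z : ℂ} (hz : z ∉ closure D) :
    ∑ i, ∫ t in (0 : ℝ)..1, deriv (Γ i) t / (Γ i t - z) = 0 := by
  rw [sum_integral_eq, h.winding_outside z hz, mul_zero]

theorem compl_closure_mem_cobounded (hD : Bornology.IsBounded D) :
    (closure D)ᶜ ∈ Bornology.cobounded ℂ := hD.closure

/-- The integral of a holomorphic function on `U \ K` over the boundary of `D ⊇ K` does not depend
on `D`. -/
theorem integral_eq_integral (h : IsPositiveBoundary Γ D) (h' : IsPositiveBoundary Γ' D')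
    (hD : IsOpen D) (hD' : IsOpen D') (hb : Bornology.IsBounded D) (hb' : Bornology.IsBounded D')
    (hU : IsOpen U) (hK : IsClosed K) (hKD : K ⊆ D) (hKD' : K ⊆ D') (hDU : closure D ⊆ U)
    (hDU' : closure D' ⊆ U) (hG : DifferentiableOn ℂ G (U \ K)) :
    ∑ i, ∫ t in (0 : ℝ)..1, G (Γ i t) * deriv (Γ i) t =
      ∑ i, ∫ t in (0 : ℝ)..1, G (Γ' i t) * deriv (Γ' i) t := by
  -- Cauchy's theorem for the cycle Γ - Γ'. Its winding number is 0 - 0 off both closures, a region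
  -- containing the complement of U, and 1 - 1 on D ∩ D', which contains K.
  have key := sum_intervalIntegral_eq_zero_of_cauchyTransform (ι := Fin n ⊕ Fin n')
    (γ := Sum.elim Γ Γ') (ω := Sum.elim (fun i => deriv (Γ i)) (fun i t => -deriv (Γ' i) t))
    (U := U \ K) (U' := ((closure D)ᶜ ∩ (closure D')ᶜ) ∪ (D ∩ D')) (G := G) ?_ ?_
    (hU.sdiff hK) ?_ ?_ ?_ ?_ ?_ ?_ hG
  · simpa [Fintype.sum_sum_type, sub_eq_zero, ← sub_eq_add_neg] using key
  · rintro (i | i)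
    · exact (h.jordan i).continuousOn
    · exact (h'.jordan i).continuousOn
  · rintro (i | i)
    · exact (h.jordan i).intervalIntegrable_deriv
    · exact (h'.jordan i).intervalIntegrable_deriv.neg
  · exact ((isClosed_closure.isOpen_compl).inter (isClosed_closure.isOpen_compl)).union
      (hD.inter hD')
  · intro z hz
    by_cases hzU : z ∈ U
    · have hzK : z ∈ K := by_contra fun hc => hz ⟨hzU, hc⟩
      exact Or.inr ⟨hKD hzK, hKD' hzK⟩
    · exact Or.inl ⟨fun hc => hzU (hDU hc), fun hc => hzU (hDU' hc)⟩
  · rintro (i | i) t ht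
    · exact ⟨hDU (h.mem_closure i ht), fun hc => h.notMem hD i ht (hKD hc)⟩
    · exact ⟨hDU' (h'.mem_closure i ht), fun hc => h'.notMem hD' i ht (hKD' hc)⟩
  · rintro (i | i) t ht (hc | hc)
    · exact hc.1 (h.mem_closure i ht)
    · exact h.notMem hD i ht hc.1
    · exact hc.2 (h'.mem_closure i ht)
    · exact h'.notMem hD' i ht hc.2
  · exact mem_of_superset (inter_mem (compl_closure_mem_cobounded hb)
      (compl_closure_mem_cobounded hb')) subset_union_left
  · intro z hz
    rw [Fintype.sum_sum_type]
    simp only [Sum.elim_inl, Sum.elim_inr, neg_div, intervalIntegral.integral_neg,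
      Finset.sum_neg_distrib]
    rcases hz with hz | hz
    · rw [h.sum_integral_outside hz.1, h'.sum_integral_outside hz.2, neg_zero, add_zero]
    · rw [h.sum_integral_inside hz.1, h'.sum_integral_inside hz.2, add_neg_cancel]

theorem intervalIntegral_star (g : ℝ → ℂ) :
    ∫ t in (0 : ℝ)..1, (starRingEnd ℂ) (g t) = (starRingEnd ℂ) (∫ t in (0 : ℝ)..1, g t) := by
  simp only [intervalIntegral.integral_of_le zero_le_one, integral_conj]

/-- The integral over the boundary of a set symmetric about the real axis of a holomorphic function
that commutes with the conjugation is imaginary. -/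
theorem star_integral (h : IsPositiveBoundary Γ D) (hD : IsOpen D) (hb : Bornology.IsBounded D)
    (hDs : ∀ z, (starRingEnd ℂ) z ∈ D ↔ z ∈ D) (hU : IsOpen U) (hK : IsClosed K) (hKD : K ⊆ D)
    (hDU : closure D ⊆ U) (hUs : ∀ z ∈ U, (starRingEnd ℂ) z ∈ U)
    (hKs : ∀ z ∈ K, (starRingEnd ℂ) z ∈ K) (hG : DifferentiableOn ℂ G (U \ K))
    (hGs : ∀ z ∈ U \ K, G ((starRingEnd ℂ) z) = (starRingEnd ℂ) (G z)) :
    (starRingEnd ℂ) (∑ i, ∫ t in (0 : ℝ)..1, G (Γ i t) * deriv (Γ i) t) =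
      -∑ i, ∫ t in (0 : ℝ)..1, G (Γ i t) * deriv (Γ i) t := by
  have hcl : ∀ z, (starRingEnd ℂ) z ∈ closure D ↔ z ∈ closure D := by
    intro z
    have hpre : (starRingEnd ℂ) ⁻¹' D = D := ext hDs
    have := Complex.conjCLE.toHomeomorph.preimage_closure D
    have h2 : Complex.conjCLE.toHomeomorph ⁻¹' D = D := hpre
    rw [h2] at this
    exact Set.ext_iff.mp this z
  have hint : ∀ i, ∀ z, ∫ t in (0 : ℝ)..1, (starRingEnd ℂ) (deriv (Γ i) t) /
      ((starRingEnd ℂ) (Γ i t) - z) = (starRingEnd ℂ) (∫ t in (0 : ℝ)..1,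
        deriv (Γ i) t / (Γ i t - (starRingEnd ℂ) z)) := by
    intro i z
    rw [← intervalIntegral_star]
    simp
  have hmem : ∀ i, ∀ t ∈ Icc (0 : ℝ) 1, Γ i t ∈ U \ K := fun i t ht =>
    ⟨hDU (h.mem_closure i ht), fun hc => h.notMem hD i ht (hKD hc)⟩
  -- Cauchy's theorem for Γ plus its mirror image. Conjugation reverses the orientation, since
  -- conj(2πi) = -2πi, so about the points of D the winding numbers 1 and -1 cancel. The density
  -- conj(γ') is used directly, without identifying it as the derivative of the reflected curve.
  have key := sum_intervalIntegral_eq_zero_of_cauchyTransform (ι := Fin n ⊕ Fin n)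
    (γ := Sum.elim Γ fun i t => (starRingEnd ℂ) (Γ i t))
    (ω := Sum.elim (fun i => deriv (Γ i)) fun i t => (starRingEnd ℂ) (deriv (Γ i) t))
    (U := U \ K) (U' := (closure D)ᶜ ∪ D) (G := G) ?_ ?_
    (hU.sdiff hK) ?_ ?_ ?_ ?_ ?_ ?_ hG
  · rw [Fintype.sum_sum_type] at key
    simp only [Sum.elim_inl, Sum.elim_inr] at key
    rw [map_sum, ← add_eq_zero_iff_eq_neg, add_comm, ← key]
    congr 1
    refine Finset.sum_congr rfl fun i _ => ?_
    rw [← intervalIntegral_star]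
    refine intervalIntegral.integral_congr fun t ht => ?_
    rw [uIcc_of_le zero_le_one] at ht
    simp only [map_mul, hGs _ (hmem i t ht)]
  · rintro (i | i)
    · exact (h.jordan i).continuousOn
    · exact Complex.continuous_conj.comp_continuousOn (h.jordan i).continuousOn
  · rintro (i | i)
    · exact (h.jordan i).intervalIntegrable_deriv
    · have := (h.jordan i).intervalIntegrable_deriv
      rw [intervalIntegrable_iff] at this ⊢
      exact Complex.conjCLE.toContinuousLinearMap.integrable_comp this
  · exact isClosed_closure.isOpen_compl.union hD
  · intro z hz
    by_cases hzU : z ∈ U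
    · exact Or.inr (hKD (by_contra fun hc => hz ⟨hzU, hc⟩))
    · exact Or.inl fun hc => hzU (hDU hc)
  · rintro (i | i) t ht
    · exact hmem i t ht
    · refine ⟨hUs _ (hmem i t ht).1, fun hc => (hmem i t ht).2 ?_⟩
      simpa using hKs _ hc
  · rintro (i | i) t ht (hc | hc)
    · exact hc (h.mem_closure i ht)
    · exact h.notMem hD i ht hc
    · exact hc ((hcl _).mpr (h.mem_closure i ht))
    · exact h.notMem hD i ht ((hDs _).mp hc)
  · exact mem_of_superset (compl_closure_mem_cobounded hb) subset_union_left
  · intro z hz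
    rw [Fintype.sum_sum_type]
    simp only [Sum.elim_inl, Sum.elim_inr, hint, ← map_sum]
    rcases hz with hz | hz
    · rw [h.sum_integral_outside hz, h.sum_integral_outside (fun hc => hz ((hcl z).mp hc))]
      simp
    · rw [h.sum_integral_inside hz, h.sum_integral_inside ((hDs z).mpr hz)]
      rw [map_mul, map_mul, Complex.conj_I, Complex.conj_ofReal, Complex.conj_ofNat]
      ring

theorem integral_circle_unit (g : ℂ → ℂ) (R : ℝ) :
    ∫ t in (0 : ℝ)..1, g (circleMap 0 R (2 * Real.pi * t)) *
      (2 * Real.pi * deriv (circleMap 0 R) (2 * Real.pi * t)) = ∮ z in C(0, R), g z := by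
  have h := intervalIntegral.integral_comp_mul_left (a := (0 : ℝ)) (b := 1)
    (fun θ => deriv (circleMap 0 R) θ • g (circleMap 0 R θ)) Real.two_pi_pos.ne'
  rw [eq_inv_smul_iff₀ Real.two_pi_pos.ne', mul_zero, mul_one] at h
  rw [circleIntegral]
  rw [← h, ← intervalIntegral.integral_smul]
  refine intervalIntegral.integral_congr fun t _ => ?_
  simp only [smul_eq_mul, Complex.real_smul, Complex.ofReal_mul, Complex.ofReal_ofNat]
  ring

/-- The integral of `O(|z|⁻²)` holomorphic functions on the complement of `K ⊆ D` over the boundary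
of `D` vanishes. -/
theorem integral_eq_zero (h : IsPositiveBoundary Γ D) (hD : IsOpen D)
    (hb : Bornology.IsBounded D) (hK : IsClosed K) (hKD : K ⊆ D)
    (hG : DifferentiableOn ℂ G Kᶜ)
    (hO : G =O[Bornology.cobounded ℂ] fun z => ‖z‖ ^ (-2 : ℤ)) :
    ∑ i, ∫ t in (0 : ℝ)..1, G (Γ i t) * deriv (Γ i) t = 0 := by
  -- The contour may be replaced by any circle around the closure of D: the difference of the two
  -- has Cauchy transform 0 outside the closed disc and on D. Length 2πR against C R⁻² then gives
  -- the limit 0.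
  have hcirc : ∀ R : ℝ, 0 < R → closure D ⊆ ball 0 R →
      ∑ i, ∫ t in (0 : ℝ)..1, G (Γ i t) * deriv (Γ i) t = ∮ z in C(0, R), G z := by
    intro R hR hDR
    have hsph : ∀ t, circleMap 0 R t ∈ sphere (0 : ℂ) R := circleMap_mem_sphere 0 hR.le
    have hnb : ∀ t, circleMap 0 R t ∉ ball (0 : ℂ) R := fun t hc =>
      (ne_of_lt (mem_ball.mp hc)) (mem_sphere.mp (hsph t))
    have key := sum_intervalIntegral_eq_zero_of_cauchyTransform (ι := Fin n ⊕ Unit)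
      (γ := Sum.elim Γ fun _ t => circleMap 0 R (2 * Real.pi * t))
      (ω := Sum.elim (fun i => deriv (Γ i))
        fun _ t => -(2 * Real.pi * deriv (circleMap 0 R) (2 * Real.pi * t)))
      (U := Kᶜ) (U' := (closedBall 0 R)ᶜ ∪ D) (G := G) ?_ ?_
      hK.isOpen_compl ?_ ?_ ?_ ?_ ?_ ?_ hG
    · rw [Fintype.sum_sum_type] at key
      simpa only [Sum.elim_inl, Sum.elim_inr, Finset.univ_unique, Finset.sum_singleton, mul_neg,
        intervalIntegral.integral_neg, integral_circle_unit, add_neg_eq_zero] using key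
    · rintro (i | i)
      · exact (h.jordan i).continuousOn
      · exact ((continuous_circleMap 0 R).comp (by fun_prop)).continuousOn
    · rintro (i | i)
      · exact (h.jordan i).intervalIntegrable_deriv
      · refine Continuous.intervalIntegrable ?_ _ _
        simp only [deriv_circleMap, Sum.elim_inr]
        fun_prop
    · exact isClosed_closedBall.isOpen_compl.union hD
    · exact fun z hz => Or.inr (hKD (not_not.mp hz))
    · rintro (i | i) t ht
      · exact fun hc => h.notMem hD i ht (hKD hc)
      · exact fun hc => hnb _ (hDR (subset_closure (hKD hc)))
    · rintro (i | i) t ht (hc | hc)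
      · exact hc (ball_subset_closedBall (hDR (h.mem_closure i ht)))
      · exact h.notMem hD i ht hc
      · exact hc (sphere_subset_closedBall (hsph _))
      · exact hnb _ (hDR (subset_closure hc))
    · exact mem_of_superset (show (closedBall (0 : ℂ) R)ᶜ ∈ Bornology.cobounded ℂ from
        isBounded_closedBall) subset_union_left
    · intro z hz
      have hcw := integral_circle_unit (fun w => (w - z)⁻¹) R
      have hcw' : ∫ t in (0 : ℝ)..1, -(2 * Real.pi * deriv (circleMap 0 R) (2 * Real.pi * t)) /
          (circleMap 0 R (2 * Real.pi * t) - z) = -∮ w in C(0, R), (w - z)⁻¹ := by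
        rw [← hcw, ← intervalIntegral.integral_neg]
        refine intervalIntegral.integral_congr fun t _ => ?_
        simp only [div_eq_mul_inv]
        ring
      rw [Fintype.sum_sum_type]
      simp only [Sum.elim_inl, Sum.elim_inr, Finset.univ_unique, Finset.sum_singleton, hcw']
      rcases hz with hz | hz
      · rw [h.sum_integral_outside fun hc => hz (ball_subset_closedBall (hDR hc)), zero_add,
          neg_eq_zero]
        refine Complex.circleIntegral_eq_zero_of_differentiable_on_off_countable hR.le
          countable_empty ?_ ?_
        · exact ContinuousOn.inv₀ (by fun_prop) fun w hw hc => hz (by rwa [← sub_eq_zero.mp hc])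
        · intro w hw
          refine DifferentiableAt.inv (by fun_prop) fun hc => hz ?_
          rw [← sub_eq_zero.mp hc]
          exact ball_subset_closedBall hw.1
      · rw [h.sum_integral_inside hz,
          circleIntegral.integral_sub_inv_of_mem_ball (hDR (subset_closure hz)), add_neg_cancel]
  obtain ⟨R₀, hR₀⟩ := hb.closure.subset_ball (0 : ℂ)
  obtain ⟨C, hC⟩ := hO.bound
  obtain ⟨R₁, hR₁⟩ : ∃ R₁ : ℝ, ∀ z : ℂ, R₁ ≤ ‖z‖ → ‖G z‖ ≤ C * ‖‖z‖ ^ (-2 : ℤ)‖ := by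
    rw [← comap_norm_atTop] at hC
    obtain ⟨s, hs, hsub⟩ := mem_comap.mp hC
    obtain ⟨R₁, hR₁⟩ := mem_atTop_sets.mp hs
    exact ⟨R₁, fun z hz => hsub (hR₁ _ hz)⟩
  have hlim : Tendsto (fun R : ℝ => 2 * Real.pi * R * (C * R ^ (-2 : ℤ))) atTop (𝓝 0) := by
    have h1 : Tendsto (fun R : ℝ => 2 * Real.pi * C * R⁻¹) atTop (𝓝 (2 * Real.pi * C * 0)) :=
      tendsto_inv_atTop_zero.const_mul _
    rw [mul_zero] at h1
    refine h1.congr' ?_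
    filter_upwards [eventually_gt_atTop 0] with R hR
    rw [zpow_neg, zpow_ofNat]
    field_simp
  refine norm_le_zero_iff.mp (ge_of_tendsto hlim ?_)
  filter_upwards [eventually_gt_atTop 0, eventually_ge_atTop R₀, eventually_ge_atTop R₁]
    with R hR hRR₀ hRR₁
  rw [hcirc R hR (hR₀.trans (ball_subset_ball hRR₀))]
  refine circleIntegral.norm_integral_le_of_norm_le_const hR.le fun z hz => ?_
  have hz' : ‖z‖ = R := by simpa using hz
  have := hR₁ z (by rw [hz']; exact hRR₁)
  rwa [hz', Real.norm_of_nonneg (by positivity)] at this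

end IsPositiveBoundary

/-! ### The Clifford algebra as a Banach algebra -/

namespace Cl

noncomputable instance instNormedRing {𝒜 : Type*} [NormedRing 𝒜] : NormedRing (Cl 𝒜) where
  __ := instNormedAddCommGroup (𝒜 := 𝒜)
  __ := instRing (𝒜 := 𝒜)
  norm_mul_le x y := by
    have hsign : ∀ A B : Finset (Fin 5), ∀ a : 𝒜, ‖sign A B • a‖ = ‖a‖ := by
      intro A B a
      have h : sign A B = 1 ∨ sign A B = -1 := by
        unfold sign
        refine Int.isUnit_iff.mp (Finset.prod_induction _ IsUnit (fun _ _ => IsUnit.mul)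
          isUnit_one fun a _ => Finset.prod_induction _ IsUnit (fun _ _ => IsUnit.mul)
          isUnit_one fun b _ => ?_)
        split_ifs <;> simp
      rcases h with h | h <;> simp [h]
    simp only [norm_def, coeff_mul]
    calc ∑ C, ‖∑ A, sign A (symmDiff A C) • (x.coeff A * y.coeff (symmDiff A C))‖
        ≤ ∑ C, ∑ A, ‖x.coeff A‖ * ‖y.coeff (symmDiff A C)‖ := by
          refine Finset.sum_le_sum fun C _ => (norm_sum_le _ _).trans
            (Finset.sum_le_sum fun A _ => ?_)
          rw [hsign]
          exact norm_mul_le _ _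
      _ = (∑ A, ‖x.coeff A‖) * ∑ A, ‖y.coeff A‖ := by
          rw [Finset.sum_comm, Finset.sum_mul]
          refine Finset.sum_congr rfl fun A _ => ?_
          rw [← Finset.mul_sum]
          congr 1
          exact Fintype.sum_equiv
            (Function.Involutive.toPerm _ (symmDiff_symmDiff_cancel_left A)) _ _ fun B => rfl

section algebra
variable {𝒜 : Type*} [Ring 𝒜]

noncomputable instance instAlgebra [Algebra ℝ 𝒜] : Algebra ℝ (Cl 𝒜) :=
  Algebra.ofModule
    (fun r x y => by
      refine ext_coeff fun C => ?_
      simp only [coeff_mul, coeff_smul, Finset.smul_sum, smul_mul_assoc, smul_comm r])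
    (fun r x y => by
      refine ext_coeff fun C => ?_
      simp only [coeff_mul, coeff_smul, Finset.smul_sum, mul_smul_comm, smul_comm r])

noncomputable instance instNormedAlgebra {𝒜 : Type*} [NormedRing 𝒜] [NormedAlgebra ℝ 𝒜] :
    NormedAlgebra ℝ (Cl 𝒜) where
  __ := instAlgebra (𝒜 := 𝒜)
  norm_smul_le := norm_smul_le

theorem coeff_sum {R ι : Type*} [AddCommGroup R] (s : Finset ι) (f : ι → Cl R)
    (C : Finset (Fin 5)) : (∑ i ∈ s, f i).coeff C = ∑ i ∈ s, (f i).coeff C :=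
  map_sum (⟨⟨fun x : Cl R => x.coeff C, rfl⟩, fun _ _ => rfl⟩ : Cl R →+ R) f s

theorem coeff_sub {R : Type*} [AddCommGroup R] (x y : Cl R) (C : Finset (Fin 5)) :
    (x - y).coeff C = x.coeff C - y.coeff C := by
  rw [sub_eq_add_neg, sub_eq_add_neg]; rfl

theorem single_add {R : Type*} [AddCommGroup R] (A : Finset (Fin 5)) (a b : R) :
    single A (a + b) = single A a + single A b := by
  refine ext_coeff fun C => ?_
  by_cases h : C = A <;> simp [h]

theorem single_neg {R : Type*} [AddCommGroup R] (A : Finset (Fin 5)) (a : R) :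
    single A (-a) = -single A a := by
  refine ext_coeff fun C => ?_
  by_cases h : C = A <;> simp [h]

theorem single_zero {R : Type*} [AddCommGroup R] (A : Finset (Fin 5)) :
    single A (0 : R) = 0 := by
  refine ext_coeff fun C => ?_
  simp

theorem single_smul [Algebra ℝ 𝒜] (A : Finset (Fin 5)) (r : ℝ) (a : 𝒜) :
    single A (r • a) = r • single A a := by
  refine ext_coeff fun C => ?_
  by_cases h : C = A <;> simp [h]

theorem sum_single (x : Cl 𝒜) : ∑ A, single A (x.coeff A) = x := by
  refine ext_coeff fun C => ?_
  simp [coeff_sum]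

theorem coeff_single_mul (A C : Finset (Fin 5)) (a : 𝒜) (x : Cl 𝒜) :
    (single A a * x).coeff C = sign A (symmDiff A C) • (a * x.coeff (symmDiff A C)) := by
  rw [coeff_mul, Finset.sum_eq_single A]
  · simp
  · intro D _ hD
    simp [hD]
  · simp

theorem sign_empty_left (A : Finset (Fin 5)) : sign ∅ A = 1 := by simp [sign]

theorem sign_empty_right (A : Finset (Fin 5)) : sign A ∅ = 1 := by simp [sign]

theorem single_empty_mul_single (A : Finset (Fin 5)) (a b : 𝒜) :
    single ∅ a * single A b = single A (a * b) := by
  rw [single_mul_single, sign_empty_left, one_smul]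
  congr 1
  exact bot_symmDiff A

theorem single_mul_single_empty (A : Finset (Fin 5)) (a b : 𝒜) :
    single A a * single ∅ b = single A (a * b) := by
  rw [single_mul_single, sign_empty_right, one_smul]
  congr 1
  exact symmDiff_bot A

theorem single_empty_one : (single ∅ 1 : Cl 𝒜) = 1 := rfl

/-- The inclusion `ℝ₅ ⊆ Cl 𝒜` as a ring homomorphism. -/
noncomputable def ofRealHom (𝒜 : Type*) [Ring 𝒜] [Algebra ℝ 𝒜] : Cl ℝ →+* Cl 𝒜 where
  toFun := ofReal 𝒜
  map_one' := by
    refine ext_coeff fun C => ?_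
    by_cases h : C = ∅ <;> simp [ofReal, h]
  map_mul' x y := by
    refine ext_coeff fun C => ?_
    simp [ofReal]
  map_zero' := by
    refine ext_coeff fun C => ?_
    simp [ofReal]
  map_add' x y := by
    refine ext_coeff fun C => ?_
    simp [ofReal]

theorem ofReal_eq [Algebra ℝ 𝒜] (a : Cl ℝ) : ofReal 𝒜 a = ofRealHom 𝒜 a := rfl

theorem ofRealHom_single [Algebra ℝ 𝒜] (A : Finset (Fin 5)) (r : ℝ) :
    ofRealHom 𝒜 (single A r) = single A (algebraMap ℝ 𝒜 r) := by
  refine ext_coeff fun C => ?_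
  by_cases h : C = A <;> simp [ofRealHom, ofReal, h]

theorem ofRealHom_smul [Algebra ℝ 𝒜] (r : ℝ) (x : Cl ℝ) :
    ofRealHom 𝒜 (r • x) = r • ofRealHom 𝒜 x := by
  refine ext_coeff fun C => ?_
  have : algebraMap ℝ 𝒜 (r * x.coeff C) = r • algebraMap ℝ 𝒜 (x.coeff C) := by
    rw [map_mul, Algebra.smul_def]
  exact this

theorem commute_single_empty_ofRealHom [Algebra ℝ 𝒜] (a : 𝒜) (x : Cl ℝ) :
    Commute (single ∅ a) (ofRealHom 𝒜 x) := by
  rw [← sum_single x, map_sum]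
  refine Commute.sum_right _ _ _ fun A _ => ?_
  rw [ofRealHom_single, commute_iff_eq, single_empty_mul_single, single_mul_single_empty,
    Algebra.commutes]

/-- Vectors `∑_i a_i e_i`. -/
def vec {𝒜 : Type*} [Ring 𝒜] (a : Fin 5 → 𝒜) : Cl 𝒜 := ∑ i, single {i} (a i)

/-- Adding the double sum to itself with the indices exchanged cancels the off-diagonal terms,
because the units anticommute and the coefficients commute. This yields twice the identity, and 2 is
divided out at the end. -/
theorem vec_mul_self [Algebra ℝ 𝒜] {a : Fin 5 → 𝒜} (ha : ∀ i j, Commute (a i) (a j)) :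
    vec a * vec a = -single ∅ (∑ i, a i ^ 2) := by
  have h : ∀ i j, single {i} (a i) * single {j} (a j) + single {j} (a j) * single {i} (a i) =
      if i = j then -(single ∅ (a i ^ 2) + single ∅ (a i ^ 2)) else 0 := by
    intro i j
    have he : ∀ k, single {k} (a k) = single ∅ (a k) * e k := fun k => by
      rw [e, single_empty_mul_single, mul_one]
    have hc : ∀ k l, e k * single ∅ (a l) = single ∅ (a l) * e k := fun k l => by
      rw [e, single_empty_mul_single, single_mul_single_empty, mul_one, one_mul]
    have hm : ∀ k l, single {k} (a k) * single {l} (a l) = single ∅ (a k * a l) * (e k * e l) := by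
      intro k l
      rw [he, he, mul_assoc, ← mul_assoc (e k), hc, ← single_empty_mul_single]
      simp only [mul_assoc]
    rw [hm, hm]
    split_ifs with hij
    · subst hij
      rw [e_mul_self, sq]
      noncomm_ring
    · rw [e_mul_e hij, (ha i j).eq]
      noncomm_ring
  have h2 : vec a * vec a + vec a * vec a =
      -single ∅ (∑ i, a i ^ 2) + -single ∅ (∑ i, a i ^ 2) := by
    have hs : single ∅ (∑ i, a i ^ 2) = ∑ i, single ∅ (a i ^ 2) :=
      map_sum (⟨⟨single ∅, single_zero _⟩, single_add _⟩ : 𝒜 →+ Cl 𝒜) _ _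
    calc vec a * vec a + vec a * vec a
        = ∑ i, ∑ j, (single {i} (a i) * single {j} (a j) +
            single {j} (a j) * single {i} (a i)) := by
          simp only [vec, Finset.sum_mul_sum, Finset.sum_add_distrib]
          congr 1
          exact Finset.sum_comm
      _ = _ := by
          simp only [h, Finset.sum_ite_eq, Finset.mem_univ, if_true, hs, Finset.sum_neg_distrib,
            Finset.sum_add_distrib, neg_add]
  have h3 : (2 : ℝ) • (vec a * vec a) = (2 : ℝ) • (-single ∅ (∑ i, a i ^ 2)) := by
    rw [two_smul, two_smul, h2]
  have h4 := congrArg (fun x => (2⁻¹ : ℝ) • x) h3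
  simpa only [smul_smul, inv_mul_cancel₀ (two_ne_zero : (2 : ℝ) ≠ 0), one_smul] using h4

theorem paravec_eq (a : Fin 6 → 𝒜) : paravec a = single ∅ (a 0) + vec fun i => a i.succ := rfl

theorem paravec_conj_eq (a : Fin 6 → 𝒜) :
    paravec (conj a) = single ∅ (a 0) - vec fun i => a i.succ := by
  rw [paravec_eq, sub_eq_add_neg, vec, vec, ← Finset.sum_neg_distrib]
  simp [conj, Fin.succ_ne_zero, single_neg]

theorem paravec_add_conj (a : Fin 6 → 𝒜) :
    paravec a + paravec (conj a) = single ∅ (a 0 + a 0) := by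
  rw [paravec_conj_eq, paravec_eq, single_add]
  abel

theorem paravec_mul_conj [Algebra ℝ 𝒜] {a : Fin 6 → 𝒜} (ha : ∀ i j, Commute (a i) (a j)) :
    paravec a * paravec (conj a) = single ∅ (∑ i, a i ^ 2) := by
  have hc : single ∅ (a 0) * vec (fun i => a i.succ) = vec (fun i => a i.succ) * single ∅ (a 0) := by
    simp only [vec, Finset.mul_sum, Finset.sum_mul, single_empty_mul_single,
      single_mul_single_empty, (ha _ _).eq]
  rw [paravec_conj_eq, paravec_eq, add_mul, mul_sub, mul_sub, vec_mul_self fun i j => ha _ _, hc,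
    single_empty_mul_single, Fin.sum_univ_succ (fun i => a i ^ 2), single_add, ← sq]
  abel

/-! ### The commutative slice spanned by `1` and the first unit -/

/-- The element `a + b e` for the first unit `e`. -/
def cx (a b : 𝒜) : Cl 𝒜 := single ∅ a + single {0} b

/-- The image of `x = a + b e`, `e` the first unit, under `e ↦ J`. -/
noncomputable def subst [Algebra ℝ 𝒜] (J : R6) (x : Cl 𝒜) : Cl 𝒜 :=
  single ∅ (x.coeff ∅) + single ∅ (x.coeff {0}) * ofRealHom 𝒜 J.toCl

/-- The elements `a + b e`. -/
def IsCx (x : Cl 𝒜) : Prop := x = cx (x.coeff ∅) (x.coeff {0})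

theorem coeff_cx_empty (a b : 𝒜) : (cx a b).coeff ∅ = a := by
  have : (∅ : Finset (Fin 5)) ≠ {0} := (Finset.singleton_ne_empty 0).symm
  simp [cx, this]

theorem coeff_cx_singleton (a b : 𝒜) : (cx a b).coeff {0} = b := by
  simp [cx]

theorem isCx_cx (a b : 𝒜) : IsCx (cx a b) := by
  rw [IsCx, coeff_cx_empty, coeff_cx_singleton]

theorem cx_mul (a b c d : 𝒜) : cx a b * cx c d = cx (a * c - b * d) (a * d + b * c) := by
  have h : single {0} b * single {0} d = single ∅ (-(b * d)) := by
    rw [single_mul_single]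
    simp [sign]
  simp only [cx, add_mul, mul_add, single_empty_mul_single, single_mul_single_empty, h, single_add,
    sub_eq_add_neg]
  abel

theorem cx_add (a b c d : 𝒜) : cx a b + cx c d = cx (a + c) (b + d) := by
  simp only [cx, single_add]
  abel

theorem cx_smul [Algebra ℝ 𝒜] (r : ℝ) (a b : 𝒜) : r • cx a b = cx (r • a) (r • b) := by
  simp only [cx, single_smul, smul_add]

theorem cx_one : cx 1 0 = (1 : Cl 𝒜) := by
  rw [cx, single_zero, add_zero, single_empty_one]

namespace IsCx
variable {x y : Cl 𝒜}

theorem exists_cx (h : IsCx x) : ∃ a b, x = cx a b := ⟨_, _, h⟩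

theorem mul (hx : IsCx x) (hy : IsCx y) : IsCx (x * y) := by
  rw [hx, hy, cx_mul]; exact isCx_cx _ _

theorem add (hx : IsCx x) (hy : IsCx y) : IsCx (x + y) := by
  rw [hx, hy, cx_add]; exact isCx_cx _ _

theorem smul [Algebra ℝ 𝒜] (r : ℝ) (hx : IsCx x) : IsCx (r • x) := by
  rw [hx, cx_smul]; exact isCx_cx _ _

end IsCx

theorem coeff_cx_mul_empty (a b : 𝒜) (x : Cl 𝒜) :
    (cx a b * x).coeff ∅ = a * x.coeff ∅ - b * x.coeff {0} := by
  have h1 : symmDiff (∅ : Finset (Fin 5)) ∅ = ∅ := bot_symmDiff _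
  have h2 : symmDiff ({0} : Finset (Fin 5)) ∅ = {0} := symmDiff_bot _
  rw [cx, add_mul, coeff_add, coeff_single_mul, coeff_single_mul, h1, h2]
  simp [sign, sub_eq_add_neg]

theorem coeff_cx_mul_singleton (a b : 𝒜) (x : Cl 𝒜) :
    (cx a b * x).coeff {0} = a * x.coeff {0} + b * x.coeff ∅ := by
  have h1 : symmDiff (∅ : Finset (Fin 5)) {0} = {0} := bot_symmDiff _
  have h2 : symmDiff ({0} : Finset (Fin 5)) {0} = ∅ := symmDiff_self _
  rw [cx, add_mul, coeff_add, coeff_single_mul, coeff_single_mul, h1, h2]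
  simp [sign]

/-- The coefficients of x * y at ∅ and {0} depend only on those of y when x = a + b e. Hence y
truncated to these two coefficients is still a right inverse of x, and uniqueness of the inverse
identifies it with y. -/
theorem IsCx.of_mul_eq_one {x y : Cl 𝒜} (hx : IsCx x) (h : x * y = 1) (h' : y * x = 1) :
    IsCx y := by
  have h1 : x * cx (y.coeff ∅) (y.coeff {0}) = 1 := by
    have he := congrArg (fun z => z.coeff ∅) h
    have hs := congrArg (fun z => z.coeff {0}) h
    rw [hx, coeff_cx_mul_empty] at he
    rw [hx, coeff_cx_mul_singleton] at hs
    conv_lhs => rw [hx]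
    rw [cx_mul, he, hs, coeff_one, coeff_one, if_pos rfl, if_neg (Finset.singleton_ne_empty 0),
      cx_one]
  calc y = y * (x * cx (y.coeff ∅) (y.coeff {0})) := by rw [h1, mul_one]
    _ = cx (y.coeff ∅) (y.coeff {0}) := by rw [← mul_assoc, h', one_mul]

theorem subst_cx [Algebra ℝ 𝒜] (J : R6) (a b : 𝒜) :
    subst J (cx a b) = single ∅ a + single ∅ b * ofRealHom 𝒜 J.toCl := by
  rw [subst, coeff_cx_empty, coeff_cx_singleton]

theorem subst_add [Algebra ℝ 𝒜] (J : R6) (x y : Cl 𝒜) : subst J (x + y) = subst J x + subst J y := by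
  simp only [subst, coeff_add, single_add, add_mul]
  abel

theorem subst_smul [Algebra ℝ 𝒜] (J : R6) (r : ℝ) (x : Cl 𝒜) : subst J (r • x) = r • subst J x := by
  simp only [subst, coeff_smul, single_smul, smul_mul_assoc, smul_add]

theorem subst_one [Algebra ℝ 𝒜] (J : R6) : subst J (1 : Cl 𝒜) = 1 := by
  rw [← cx_one, subst_cx, single_zero, zero_mul, add_zero, single_empty_one, cx_one]

theorem toCl_mul_self {J : R6} (hJ : J ∈ imagSphere) : J.toCl * J.toCl = -1 := by
  have h : ∑ i : Fin 5, J i.succ ^ 2 = 1 := by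
    have h1 := EuclideanSpace.norm_sq_eq J
    rw [hJ.2, Fin.sum_univ_succ, hJ.1] at h1
    simpa using h1.symm
  have hv : J.toCl = vec fun i => J i.succ := by
    rw [R6.toCl, paravec_eq, hJ.1, single_zero, zero_add]
  rw [hv, vec_mul_self fun i j => Commute.all _ _, h, single_empty_one]

/-- J squares to -1 and commutes with every coefficient a e_∅, exactly as the first unit does, so
the multiplication tables agree. All computations on the slice ℂ_J can thus be carried out on one
model slice. -/
theorem subst_mul [Algebra ℝ 𝒜] {J : R6} (hJ : J ∈ imagSphere) {x y : Cl 𝒜} (hx : IsCx x)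
    (hy : IsCx y) : subst J (x * y) = subst J x * subst J y := by
  obtain ⟨a, b, rfl⟩ := hx.exists_cx
  obtain ⟨c, d, rfl⟩ := hy.exists_cx
  have hJ2 : ofRealHom 𝒜 J.toCl * ofRealHom 𝒜 J.toCl = -1 := by
    rw [← map_mul, toCl_mul_self hJ, map_neg, map_one]
  set j := ofRealHom 𝒜 J.toCl
  have hc : ∀ a : 𝒜, j * single ∅ a = single ∅ a * j := fun a =>
    (commute_single_empty_ofRealHom a _).eq.symm
  have hs : ∀ a b : 𝒜, single ∅ (a * b) = single ∅ a * single ∅ b := fun a b =>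
    (single_empty_mul_single _ _ _).symm
  have h1 : single ∅ b * j * single ∅ c = single ∅ b * single ∅ c * j := by
    rw [mul_assoc, hc, mul_assoc]
  have h2 : single ∅ b * j * (single ∅ d * j) = -(single ∅ b * single ∅ d) := by
    rw [mul_assoc, ← mul_assoc j, hc, mul_assoc, hJ2, mul_neg, mul_one, mul_neg]
  rw [cx_mul, subst_cx, subst_cx, subst_cx, add_mul, mul_add, mul_add, h1, h2, sub_eq_add_neg,
    single_add, single_add, single_neg, hs, hs, hs, hs, add_mul, mul_assoc (single ∅ a)]
  abel

/-- The inclusion of `ℂ` that maps the imaginary unit to the first unit `e`. -/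
noncomputable def hat (𝒜 : Type*) [Ring 𝒜] [Algebra ℝ 𝒜] (z : ℂ) : Cl 𝒜 :=
  cx (algebraMap ℝ 𝒜 z.re) (algebraMap ℝ 𝒜 z.im)

theorem isCx_hat [Algebra ℝ 𝒜] (z : ℂ) : IsCx (hat 𝒜 z) := isCx_cx _ _

theorem hat_mul [Algebra ℝ 𝒜] (z w : ℂ) : hat 𝒜 (z * w) = hat 𝒜 z * hat 𝒜 w := by
  simp only [hat, cx_mul, Complex.mul_re, Complex.mul_im, map_sub, map_add, map_mul]

theorem hat_one [Algebra ℝ 𝒜] : hat 𝒜 1 = 1 := by simp [hat, cx_one]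

theorem IsCx.hat_mul_comm [Algebra ℝ 𝒜] {x : Cl 𝒜} (hx : IsCx x) (z : ℂ) :
    hat 𝒜 z * x = x * hat 𝒜 z := by
  obtain ⟨a, b, rfl⟩ := hx.exists_cx
  simp only [hat, cx_mul, Algebra.commutes]
  rw [add_comm]

theorem toCl_slicePt {J : R6} (hJ : J ∈ imagSphere) (z : ℂ) :
    (slicePt J z).toCl = single ∅ z.re + z.im • J.toCl := by
  have h : ∀ i : Fin 5, (slicePt J z) i.succ = z.im * J i.succ := fun i => by
    simp [slicePt]
  have h0 : (slicePt J z) 0 = z.re := by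
    simp [slicePt, hJ.1]
  simp only [R6.toCl, paravec, h, h0, hJ.1, single_zero, zero_add, Finset.smul_sum,
    ← single_smul, smul_eq_mul]

theorem ofRealHom_slicePt [Algebra ℝ 𝒜] {J : R6} (hJ : J ∈ imagSphere) (z : ℂ) :
    ofRealHom 𝒜 (slicePt J z).toCl = subst J (hat 𝒜 z) := by
  rw [toCl_slicePt hJ, hat, subst_cx, map_add, ofRealHom_single, ofRealHom_smul,
    Algebra.algebraMap_eq_smul_one z.im, single_smul, single_empty_one, smul_mul_assoc, one_mul]

end algebra

end Cl

/-! ### Functions of `u + iv` and their partial derivatives -/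

section HasPartials
variable {E : Type*} [NormedAddCommGroup E] [NormedSpace ℝ E]

/-- `g` is differentiable at `z` with partial derivatives `p` and `q` in the directions `1`, `i`. -/
def HasPartials (g : ℂ → E) (p q : E) (z : ℂ) : Prop :=
  HasFDerivAt g (Complex.reCLM.smulRight p + Complex.imCLM.smulRight q) z

namespace HasPartials
variable {g h : ℂ → E} {p q p' q' : E} {z : ℂ}

theorem congr_partials (hg : HasPartials g p q z) (hp : p = p') (hq : q = q') :
    HasPartials g p' q' z := hp ▸ hq ▸ hg

theorem add (hg : HasPartials g p q z) (hh : HasPartials h p' q' z) :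
    HasPartials (fun z => g z + h z) (p + p') (q + q') z := by
  refine (HasFDerivAt.fun_add hg hh).congr_fderiv ?_
  ext w
  simp
  abel

theorem const_smul (c : ℝ) (hg : HasPartials g p q z) :
    HasPartials (fun z => c • g z) (c • p) (c • q) z := by
  refine (HasFDerivAt.fun_const_smul hg c).congr_fderiv ?_
  ext w
  simp [smul_comm c]

theorem smul {c : ℂ → ℝ} {r s : ℝ} (hc : HasPartials c r s z) (hg : HasPartials g p q z) :
    HasPartials (fun z => c z • g z) (c z • p + r • g z) (c z • q + s • g z) z := by
  refine (HasFDerivAt.fun_smul hc hg).congr_fderiv ?_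
  ext w
  simp only [add_apply, smul_apply, ContinuousLinearMap.smulRight_apply, Complex.reCLM_apply,
    Complex.imCLM_apply, smul_eq_mul]
  module

theorem im (z : ℂ) : HasPartials Complex.im 0 1 z := by
  refine (Complex.imCLM.hasFDerivAt (x := z)).congr_fderiv ?_
  ext; simp

theorem im_inv_pow (n : ℕ) (hz : z.im ≠ 0) :
    HasPartials (fun z => z.im⁻¹ ^ n) 0 (-(n * z.im⁻¹ ^ (n + 1))) z := by
  have h1 := ((hasDerivAt_inv hz).pow n).comp_hasFDerivAt z (Complex.imCLM.hasFDerivAt (x := z))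
  refine h1.congr_fderiv ?_
  rcases n with _ | n
  · ext; simp
  · ext; simp
    field_simp
    ring

theorem im_inv_pow_smul (n : ℕ) (hz : z.im ≠ 0) (hg : HasPartials g p q z) :
    HasPartials (fun z => z.im⁻¹ ^ n • g z) (z.im⁻¹ ^ n • p)
      (z.im⁻¹ ^ n • q - (n * z.im⁻¹ ^ (n + 1)) • g z) z := by
  refine ((im_inv_pow n hz).smul hg).congr_partials (by simp) ?_
  rw [neg_smul, sub_eq_add_neg]

theorem im_smul (hg : HasPartials g p q z) :
    HasPartials (fun z => z.im • g z) (z.im • p) (z.im • q + g z) z :=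
  ((im z).smul hg).congr_partials (by simp) (by simp)

theorem congr_of_eventuallyEq (hg : HasPartials g p q z) (he : h =ᶠ[𝓝 z] g) :
    HasPartials h p q z := HasFDerivAt.congr_of_eventuallyEq hg he

theorem unique (hg : HasPartials g p q z) (hg' : HasPartials g p' q' z) : p = p' ∧ q = q' := by
  have h := HasFDerivAt.unique hg hg'
  exact ⟨by simpa using congrArg (fun L => L 1) h, by simpa using congrArg (fun L => L Complex.I) h⟩

/-- The partial derivatives of a function that vanishes on an open set vanish. -/
theorem eq_zero_of_isOpen {O : Set ℂ} (hO : IsOpen O) (hz : z ∈ O) (hg : HasPartials g p q z)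
    (h0 : ∀ w ∈ O, g w = 0) : p = 0 ∧ q = 0 := by
  have h : HasPartials g 0 0 z := by
    have h1 : HasPartials (fun _ => (0 : E)) 0 0 z := by
      refine (hasFDerivAt_const (0 : E) z).congr_fderiv ?_
      ext; simp
    exact h1.congr_of_eventuallyEq (eventually_of_mem (hO.mem_nhds hz) h0)
  exact hg.unique h

theorem comp_hasDerivAt {w : ℝ → ℂ} {t a b : ℝ} (hg : HasPartials g p q (w t))
    (hw : HasDerivAt w ⟨a, b⟩ t) : HasDerivAt (fun t => g (w t)) (a • p + b • q) t := by
  have := HasFDerivAt.comp_hasDerivAt t hg hw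
  simpa using! this

theorem clm_comp {E' : Type*} [NormedAddCommGroup E'] [NormedSpace ℝ E'] (L : E →L[ℝ] E')
    (hg : HasPartials g p q z) : HasPartials (fun z => L (g z)) (L p) (L q) z := by
  refine (L.hasFDerivAt.comp z hg).congr_fderiv ?_
  ext; simp

theorem re_of_hasDerivAt {F : ℂ → ℂ} {F' : ℂ} (h : HasDerivAt F F' z) :
    HasPartials (fun z => (F z).re) F'.re (-F'.im) z := by
  refine (Complex.reCLM.hasFDerivAt.comp z (h.hasFDerivAt.restrictScalars ℝ)).congr_fderiv ?_
  ext w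
  simp [sub_eq_add_neg]

theorem im_of_hasDerivAt {F : ℂ → ℂ} {F' : ℂ} (h : HasDerivAt F F' z) :
    HasPartials (fun z => (F z).im) F'.im F'.re z := by
  refine (Complex.imCLM.hasFDerivAt.comp z (h.hasFDerivAt.restrictScalars ℝ)).congr_fderiv ?_
  ext; simp

end HasPartials

end HasPartials

namespace Cl

/-- The coefficient of `e_A` as a continuous linear map. -/
noncomputable def coeffCLM {𝒜 : Type*} [NormedRing 𝒜] [NormedAlgebra ℝ 𝒜] (A : Finset (Fin 5)) :
    Cl 𝒜 →L[ℝ] 𝒜 :=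
  LinearMap.mkContinuous ⟨⟨fun x => x.coeff A, fun _ _ => rfl⟩, fun _ _ => rfl⟩ 1 fun x => by
    rw [one_mul, norm_def]
    exact Finset.single_le_sum (f := fun A => ‖x.coeff A‖) (fun _ _ => norm_nonneg _)
      (Finset.mem_univ A)

theorem coeffCLM_apply {𝒜 : Type*} [NormedRing 𝒜] [NormedAlgebra ℝ 𝒜] (A : Finset (Fin 5))
    (x : Cl 𝒜) : coeffCLM A x = x.coeff A := rfl

/-- The element with given coefficients, as a continuous linear map. -/
noncomputable def mkCLM : (Finset (Fin 5) → ℝ) →L[ℝ] Cl ℝ :=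
  LinearMap.toContinuousLinearMap ⟨⟨fun a => ⟨a⟩, fun _ _ => rfl⟩, fun _ _ => rfl⟩

theorem coeff_mkCLM (a : Finset (Fin 5) → ℝ) (A : Finset (Fin 5)) : (mkCLM a).coeff A = a A := rfl

theorem hasPartials_mkCLM {a : Finset (Fin 5) → ℂ → ℝ} {p q : Finset (Fin 5) → ℝ} {z : ℂ}
    (h : ∀ A, HasPartials (a A) (p A) (q A) z) :
    HasPartials (fun z => mkCLM fun A => a A z) (mkCLM p) (mkCLM q) z := by
  have : HasPartials (fun z A => a A z) p q z := by
    refine (hasFDerivAt_pi.mpr h).congr_fderiv ?_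
    ext; simp
  exact this.clm_comp mkCLM

end Cl

/-! ### Functions `a(x₀, r) + x⃗ b(x₀, r)` -/

/-- The norm of the vector part. -/
noncomputable def R6.rad (x : R6) : ℝ := Real.sqrt (∑ i : Fin 5, x i.succ ^ 2)

/-- The point `x₀ + i r`, `r` the norm of the vector part. -/
noncomputable def R6.halfPt (x : R6) : ℂ := ⟨x 0, x.rad⟩

/-- The vector part. -/
noncomputable def R6.vecPart (x : R6) : Cl ℝ := Cl.vec fun i => x i.succ

namespace R6

theorem vecPart_mul_self (x : R6) : x.vecPart * x.vecPart = -(x.rad ^ 2 • (1 : Cl ℝ)) := by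
  rw [vecPart, Cl.vec_mul_self fun _ _ => Commute.all _ _, rad,
    Real.sq_sqrt (Finset.sum_nonneg fun _ _ => sq_nonneg _), ← Cl.single_empty_one,
    ← Cl.single_smul, smul_eq_mul, mul_one]

theorem vecPart_eq (x : R6) : x.vecPart = ∑ i : Fin 5, x i.succ • Cl.e i := by
  simp only [vecPart, Cl.vec, Cl.e, ← Cl.single_smul, smul_eq_mul, mul_one]

/-- The line through `x` in the direction of a basis vector. -/
theorem add_smul_single_same (x : R6) (t : ℝ) (i : Fin 6) :
    (x + t • EuclideanSpace.single i (1 : ℝ)) i = x i + t := by simp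

theorem add_smul_single_of_ne (x : R6) (t : ℝ) {i j : Fin 6} (h : j ≠ i) :
    (x + t • EuclideanSpace.single i (1 : ℝ)) j = x j := by simp [h]

theorem hasDerivAt_coord (x : R6) (i j : Fin 6) :
    HasDerivAt (fun t : ℝ => (x + t • EuclideanSpace.single i (1 : ℝ)) j)
      (if j = i then 1 else 0) 0 := by
  by_cases h : j = i
  · subst h
    simp only [add_smul_single_same, if_true]
    exact (hasDerivAt_id (0 : ℝ)).const_add _
  · simp only [add_smul_single_of_ne x _ h, if_neg h]
    exact hasDerivAt_const _ _

theorem hasDerivAt_rad (x : R6) (hx : 0 < x.rad) (i : Fin 6) :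
    HasDerivAt (fun t : ℝ => (x + t • EuclideanSpace.single i (1 : ℝ)).rad)
      (if i = 0 then 0 else x i / x.rad) 0 := by
  have hpos : 0 < ∑ j : Fin 5, x j.succ ^ 2 := Real.sqrt_pos.mp hx
  have h1 : HasDerivAt
      (fun t : ℝ => ∑ j : Fin 5, (x + t • EuclideanSpace.single i (1 : ℝ)) j.succ ^ 2)
      (∑ j : Fin 5, 2 * x j.succ * if j.succ = i then 1 else 0) 0 := by
    refine HasDerivAt.fun_sum fun j _ => ?_
    simpa using! (hasDerivAt_coord x i j.succ).pow 2
  have h2 := h1.sqrt (by simpa using hpos.ne')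
  refine h2.congr_deriv ?_
  simp only [zero_smul, add_zero]
  change _ / (2 * x.rad) = _
  refine Fin.cases ?_ (fun k => ?_) i
  · simp [Fin.succ_ne_zero]
  · simp only [Fin.succ_inj, mul_ite, mul_one, mul_zero, Finset.sum_ite_eq', Finset.mem_univ,
      if_true, Fin.succ_ne_zero, if_false]
    field_simp

theorem hasDerivAt_halfPt (x : R6) (hx : 0 < x.rad) (i : Fin 6) :
    HasDerivAt (fun t : ℝ => (x + t • EuclideanSpace.single i (1 : ℝ)).halfPt)
      ⟨if i = 0 then 1 else 0, if i = 0 then 0 else x i / x.rad⟩ 0 := by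
  have h1 := (hasDerivAt_coord x i 0).ofReal_comp
  have h2 := (hasDerivAt_rad x hx i).ofReal_comp
  have h3 := h1.add (h2.mul_const Complex.I)
  have hc : ∀ a b : ℝ, (⟨a, b⟩ : ℂ) = a + b * Complex.I := fun a b => Complex.mk_eq_add_mul_I a b
  simp only [halfPt, hc]
  refine h3.congr_deriv ?_
  simp only [eq_comm (a := (0 : Fin 6))]

theorem hasDerivAt_vecPart (x : R6) (i : Fin 6) :
    HasDerivAt (fun t : ℝ => (x + t • EuclideanSpace.single i (1 : ℝ)).vecPart)
      (∑ j : Fin 5, (if j.succ = i then (1 : ℝ) else 0) • Cl.e j) 0 := by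
  simp only [vecPart_eq]
  exact HasDerivAt.fun_sum fun j _ => (hasDerivAt_coord x i j.succ).smul_const _

end R6

/-- The function `a(x₀, r) + x⃗ b(x₀, r)`. -/
noncomputable def axial (a b : ℂ → Cl ℝ) (x : R6) : Cl ℝ :=
  a x.halfPt + x.vecPart * b x.halfPt

section axial
variable {a b : ℂ → Cl ℝ} {p q p' q' : Cl ℝ} {x : R6}

theorem hasLineDerivAt_comp_halfPt (hx : 0 < x.rad) (ha : HasPartials a p q x.halfPt) (i : Fin 6) :
    HasLineDerivAt ℝ (fun x : R6 => a x.halfPt)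
      ((if i = 0 then (1 : ℝ) else 0) • p + (if i = 0 then 0 else x i / x.rad) • q) x
      (EuclideanSpace.single i 1) := by
  have h := R6.hasDerivAt_halfPt x hx i
  refine HasPartials.comp_hasDerivAt (g := a) ?_ h
  simpa using ha

theorem hasLineDerivAt_axial (hx : 0 < x.rad) (ha : HasPartials a p q x.halfPt)
    (hb : HasPartials b p' q' x.halfPt) (i : Fin 6) :
    HasLineDerivAt ℝ (axial a b)
      ((if i = 0 then (1 : ℝ) else 0) • p + (if i = 0 then 0 else x i / x.rad) • q +
        ((∑ j : Fin 5, (if j.succ = i then (1 : ℝ) else 0) • Cl.e j) * b x.halfPt +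
        x.vecPart * ((if i = 0 then (1 : ℝ) else 0) • p' +
          (if i = 0 then 0 else x i / x.rad) • q'))) x (EuclideanSpace.single i 1) := by
  have h1 := hasLineDerivAt_comp_halfPt hx ha i
  have h2 := hasLineDerivAt_comp_halfPt hx hb i
  have h3 := HasDerivAt.mul (R6.hasDerivAt_vecPart x i) h2
  have h4 := HasDerivAt.add h1 h3
  simpa using! h4

theorem pderiv6_axial_zero (hx : 0 < x.rad) (ha : HasPartials a p q x.halfPt)
    (hb : HasPartials b p' q' x.halfPt) : pderiv6 0 (axial a b) x = p + x.vecPart * p' := by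
  rw [pderiv6, (hasLineDerivAt_axial hx ha hb 0).lineDeriv]
  simp [Fin.succ_ne_zero]

theorem pderiv6_axial_succ (hx : 0 < x.rad) (ha : HasPartials a p q x.halfPt)
    (hb : HasPartials b p' q' x.halfPt) (i : Fin 5) :
    pderiv6 i.succ (axial a b) x = (x i.succ * x.rad⁻¹) • q + Cl.e i * b x.halfPt +
      (x i.succ * x.rad⁻¹) • (x.vecPart * q') := by
  rw [pderiv6, (hasLineDerivAt_axial hx ha hb i.succ).lineDeriv]
  simp [Fin.succ_ne_zero, div_eq_mul_inv, add_assoc]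

/-- The constant 5 comes from ∑ e_i e_i = -5. The radial derivatives enter through ∑ x_i e_i = x⃗,
and x⃗ x⃗ = -r² turns that of b into a term without vector factor. -/
theorem sum_e_mul_pderiv6_axial (hx : 0 < x.rad) (ha : HasPartials a p q x.halfPt)
    (hb : HasPartials b p' q' x.halfPt) :
    ∑ i : Fin 5, Cl.e i * pderiv6 i.succ (axial a b) x =
      -((5 : ℝ) • b x.halfPt) - x.rad • q' + x.vecPart * (x.rad⁻¹ • q) := by
  have h1 : ∀ c : Cl ℝ, ∑ i : Fin 5, Cl.e i * ((x i.succ * x.rad⁻¹) • c) =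
      x.rad⁻¹ • (x.vecPart * c) := by
    intro c
    rw [R6.vecPart_eq, Finset.sum_mul, Finset.smul_sum]
    refine Finset.sum_congr rfl fun i _ => ?_
    rw [mul_smul_comm, smul_mul_assoc, smul_smul, mul_comm]
  have h2 : ∀ c : Cl ℝ, ∑ i : Fin 5, Cl.e i * (Cl.e i * c) = -((5 : ℝ) • c) := by
    intro c
    simp only [← mul_assoc, Cl.e_mul_self, neg_mul, one_mul, Finset.sum_const, Finset.card_univ,
      Fintype.card_fin, smul_neg]
    rw [← Nat.cast_smul_eq_nsmul ℝ]
    norm_num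
  simp only [pderiv6_axial_succ hx ha hb, mul_add, Finset.sum_add_distrib, h1, h2]
  rw [← mul_assoc, R6.vecPart_mul_self, neg_mul, smul_mul_assoc, one_mul, smul_neg, smul_smul,
    mul_smul_comm]
  have : x.rad⁻¹ * x.rad ^ 2 = x.rad := by field_simp
  rw [this]
  abel

theorem diracL_axial (hx : 0 < x.rad) (ha : HasPartials a p q x.halfPt)
    (hb : HasPartials b p' q' x.halfPt) :
    diracL (axial a b) x = (p - (5 : ℝ) • b x.halfPt - x.rad • q') +
      x.vecPart * (p' + x.rad⁻¹ • q) := by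
  rw [diracL, pderiv6_axial_zero hx ha hb, sum_e_mul_pderiv6_axial hx ha hb, mul_add]
  abel

theorem diracBarL_axial (hx : 0 < x.rad) (ha : HasPartials a p q x.halfPt)
    (hb : HasPartials b p' q' x.halfPt) :
    diracBarL (axial a b) x = (p + (5 : ℝ) • b x.halfPt + x.rad • q') +
      x.vecPart * (p' - x.rad⁻¹ • q) := by
  rw [diracBarL, pderiv6_axial_zero hx ha hb, sum_e_mul_pderiv6_axial hx ha hb, mul_sub]
  abel

end axial

/-! ### The Laplacian in coordinates -/

theorem pderiv6_congr {f g : R6 → Cl ℝ} {x : R6} (h : f =ᶠ[𝓝 x] g) (i : Fin 6) :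
    pderiv6 i f x = pderiv6 i g x := h.lineDeriv_eq

/-- C² regularity near the point lets the line derivatives be read off the Fréchet derivative in a
whole neighbourhood, as is needed to differentiate a second time. -/
theorem laplacian_eq_sum_pderiv6 {f : R6 → Cl ℝ} {x : R6} (hf : ContDiffAt ℝ 2 f x) :
    Laplacian.laplacian f x = ∑ i, pderiv6 i (pderiv6 i f) x := by
  have h1 := congrFun (InnerProductSpace.laplacian_eq_iteratedFDeriv_orthonormalBasis f
    (EuclideanSpace.basisFun (Fin 6) ℝ)) x
  rw [h1]
  refine Finset.sum_congr rfl fun i _ => ?_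
  have hev : pderiv6 i f =ᶠ[𝓝 x] fun y => fderiv ℝ f y (EuclideanSpace.single i 1) := by
    filter_upwards [hf.eventually (by simp)] with y hy
    exact (hy.differentiableAt (by norm_num)).lineDeriv_eq_fderiv
  have hd : DifferentiableAt ℝ (fderiv ℝ f) x :=
    (hf.fderiv_right (m := 1) (by norm_num)).differentiableAt (by norm_num)
  rw [pderiv6_congr hev, pderiv6, iteratedFDeriv_two_apply]
  have h2 := (hd.clm_apply
    (differentiableAt_const (EuclideanSpace.single i (1 : ℝ)))).lineDeriv_eq_fderiv
    (v := EuclideanSpace.single i (1 : ℝ))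
  rw [h2, fderiv_clm_apply hd (differentiableAt_const _)]
  simp

theorem R6.continuous_halfPt : Continuous R6.halfPt := by
  have h : R6.halfPt = fun x => ((x 0 : ℝ) : ℂ) + (x.rad : ℂ) * Complex.I := by
    funext x
    exact Complex.mk_eq_add_mul_I _ _
  rw [h]
  unfold R6.rad
  fun_prop

theorem R6.contDiffAt_halfPt {x : R6} (hx : 0 < x.rad) : ContDiffAt ℝ 2 R6.halfPt x := by
  have h : R6.halfPt = fun x => Complex.ofRealCLM (x 0) + Complex.I * Complex.ofRealCLM x.rad := by
    funext x
    rw [mul_comm]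
    exact Complex.mk_eq_add_mul_I _ _
  have hr : ContDiffAt ℝ 2 R6.rad x := by
    refine ContDiffAt.sqrt ?_ (Real.sqrt_pos.mp hx).ne'
    fun_prop
  rw [h]
  refine ContDiffAt.add (Complex.ofRealCLM.contDiff.contDiffAt.comp x (by fun_prop)) ?_
  exact contDiffAt_const.mul (Complex.ofRealCLM.contDiff.contDiffAt.comp x hr)

theorem R6.contDiff_vecPart : ContDiff ℝ 2 R6.vecPart := by
  have h : R6.vecPart = fun x => ∑ i : Fin 5, x i.succ • Cl.e i := funext R6.vecPart_eq
  rw [h]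
  fun_prop

theorem contDiffAt_axial {a b : ℂ → Cl ℝ} {x : R6} (hx : 0 < x.rad)
    (ha : ContDiffAt ℝ 2 a x.halfPt) (hb : ContDiffAt ℝ 2 b x.halfPt) :
    ContDiffAt ℝ 2 (axial a b) x :=
  (ha.comp x (R6.contDiffAt_halfPt hx)).add
    (R6.contDiff_vecPart.contDiffAt.mul (hb.comp x (R6.contDiffAt_halfPt hx)))

/-- `f = a(x₀, r) + x⃗ b(x₀, r)` at the points `x` with `x₀ + i r ∈ O`. -/
def AxialOn (f : R6 → Cl ℝ) (a b : ℂ → Cl ℝ) (O : Set ℂ) : Prop :=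
  ∀ x : R6, x.halfPt ∈ O → f x = axial a b x

namespace AxialOn
variable {f : R6 → Cl ℝ} {a b a' b' au av bu bv : ℂ → Cl ℝ} {O : Set ℂ}

theorem eventuallyEq (h : AxialOn f a b O) (hO : IsOpen O) {x : R6} (hx : x.halfPt ∈ O) :
    f =ᶠ[𝓝 x] axial a b :=
  eventually_of_mem ((hO.preimage R6.continuous_halfPt).mem_nhds hx) h

theorem diracL (h : AxialOn f a b O) (hO : IsOpen O) (hpos : ∀ z ∈ O, 0 < z.im)
    (ha : ∀ z ∈ O, HasPartials a (au z) (av z) z) (hb : ∀ z ∈ O, HasPartials b (bu z) (bv z) z)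
    (ha' : ∀ z ∈ O, a' z = au z - (5 : ℝ) • b z - z.im • bv z)
    (hb' : ∀ z ∈ O, b' z = bu z + z.im⁻¹ • av z) : AxialOn (diracL f) a' b' O := by
  intro x hx
  have he := h.eventuallyEq hO hx
  have := diracL_axial (hpos _ hx) (ha _ hx) (hb _ hx)
  rw [axial, ha' _ hx, hb' _ hx]
  refine Eq.trans ?_ this
  simp only [_root_.diracL, pderiv6_congr he]

theorem diracBarL (h : AxialOn f a b O) (hO : IsOpen O) (hpos : ∀ z ∈ O, 0 < z.im)
    (ha : ∀ z ∈ O, HasPartials a (au z) (av z) z) (hb : ∀ z ∈ O, HasPartials b (bu z) (bv z) z)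
    (ha' : ∀ z ∈ O, a' z = au z + (5 : ℝ) • b z + z.im • bv z)
    (hb' : ∀ z ∈ O, b' z = bu z - z.im⁻¹ • av z) : AxialOn (diracBarL f) a' b' O := by
  intro x hx
  have he := h.eventuallyEq hO hx
  have := diracBarL_axial (hpos _ hx) (ha _ hx) (hb _ hx)
  rw [axial, ha' _ hx, hb' _ hx]
  refine Eq.trans ?_ this
  simp only [_root_.diracBarL, pderiv6_congr he]

/-- The operators obtained are a_uu + a_vv + (4/v) a_v and b_uu + b_vv + (6/v) b_v. They appear with
5 and 7 because the function differentiated again is v⁻¹ a_v, respectively v⁻¹ b_v, whose derivative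
contributes -v⁻² a_v, respectively -v⁻² b_v. -/
theorem laplacian {auu auv buu buv Au Av Bu Bv : ℂ → Cl ℝ} (h : AxialOn f a b O) (hO : IsOpen O)
    (hpos : ∀ z ∈ O, 0 < z.im) (hca : ContDiffOn ℝ 2 a O) (hcb : ContDiffOn ℝ 2 b O)
    (ha : ∀ z ∈ O, HasPartials a (au z) (av z) z) (hb : ∀ z ∈ O, HasPartials b (bu z) (bv z) z)
    (hau : ∀ z ∈ O, HasPartials au (auu z) (auv z) z)
    (hbu : ∀ z ∈ O, HasPartials bu (buu z) (buv z) z)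
    (hA : ∀ z ∈ O, HasPartials (fun z => z.im⁻¹ • av z) (Au z) (Av z) z)
    (hB : ∀ z ∈ O, HasPartials (fun z => z.im⁻¹ • bv z) (Bu z) (Bv z) z)
    (ha' : ∀ z ∈ O, a' z = auu z + (5 : ℝ) • z.im⁻¹ • av z + z.im • Av z)
    (hb' : ∀ z ∈ O, b' z = buu z + (7 : ℝ) • z.im⁻¹ • bv z + z.im • Bv z) :
    AxialOn (Laplacian.laplacian f) a' b' O := by
  intro x hx
  have hr : 0 < x.rad := hpos _ hx
  have hnhds : R6.halfPt ⁻¹' O ∈ 𝓝 x := (hO.preimage R6.continuous_halfPt).mem_nhds hx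
  have he := h.eventuallyEq hO hx
  have hc : ContDiffAt ℝ 2 f x :=
    (contDiffAt_axial hr (hca.contDiffAt (hO.mem_nhds hx))
      (hcb.contDiffAt (hO.mem_nhds hx))).congr_of_eventuallyEq he
  rw [laplacian_eq_sum_pderiv6 hc, Fin.sum_univ_succ]
  have hfe : ∀ y : R6, y.halfPt ∈ O → ∀ i, pderiv6 i f y = pderiv6 i (axial a b) y :=
    fun y hy i => pderiv6_congr (h.eventuallyEq hO hy) i
  have h0 : pderiv6 0 (pderiv6 0 f) x = axial auu buu x := by
    have he0 : pderiv6 0 f =ᶠ[𝓝 x] axial au bu := eventually_of_mem hnhds fun y hy => by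
      rw [hfe y hy, pderiv6_axial_zero (hpos _ hy) (ha _ hy) (hb _ hy), axial]
    rw [pderiv6_congr he0, pderiv6_axial_zero hr (hau _ hx) (hbu _ hx), axial]
  -- With A = a_v / v and B = b_v / v one has ∂_i f = x_i (A + x⃗ B) + e_i b. The bracket is again
  -- axial, so the formula for first derivatives applies once more.
  set A : ℂ → Cl ℝ := fun z => z.im⁻¹ • av z with hAdef
  set B : ℂ → Cl ℝ := fun z => z.im⁻¹ • bv z with hBdef
  have hi : ∀ i : Fin 5, pderiv6 i.succ (pderiv6 i.succ f) x =
      axial A B x + x i.succ • pderiv6 i.succ (axial A B) x +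
        (x i.succ) • (Cl.e i * B x.halfPt) := by
    intro i
    have hei : pderiv6 i.succ f =ᶠ[𝓝 x] fun y =>
        y i.succ • axial A B y + Cl.e i * b y.halfPt := eventually_of_mem hnhds fun y hy => by
      rw [hfe y hy, pderiv6_axial_succ (hpos _ hy) (ha _ hy) (hb _ hy)]
      change _ = y i.succ • (y.rad⁻¹ • _ + y.vecPart * (y.rad⁻¹ • _)) + _
      rw [mul_smul_comm, smul_add, smul_smul, smul_smul]
      abel
    rw [pderiv6_congr hei]
    have h1 := hasLineDerivAt_axial hr (hA _ hx) (hB _ hx) i.succ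
    have h2 := hasLineDerivAt_comp_halfPt hr (hb _ hx) i.succ
    have h3 : HasDerivAt (fun t : ℝ => (x + t • EuclideanSpace.single i.succ (1 : ℝ)) i.succ)
        1 0 := by simpa using R6.hasDerivAt_coord x i.succ i.succ
    have h4 := (HasDerivAt.fun_smul h3 h1).add (HasDerivAt.const_mul (Cl.e i) h2)
    have h5 : HasLineDerivAt ℝ (fun y : R6 => y i.succ • axial A B y + Cl.e i * b y.halfPt) _ x
      (EuclideanSpace.single i.succ 1) := h4
    rw [pderiv6, h5.lineDeriv, pderiv6, h1.lineDeriv]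
    simp only [zero_smul, add_zero, one_smul, if_neg (Fin.succ_ne_zero i), zero_add, div_eq_mul_inv]
    rw [mul_smul_comm (x i.succ * x.rad⁻¹) (Cl.e i), mul_smul (x i.succ) x.rad⁻¹ (Cl.e i * _),
      ← mul_smul_comm x.rad⁻¹ (Cl.e i)]
    change _ = _ + x i.succ • (Cl.e i * (x.rad⁻¹ • bv x.halfPt))
    abel
  have hsum1 : ∑ i : Fin 5, x i.succ • pderiv6 i.succ (axial A B) x =
      x.rad • Av x.halfPt + x.vecPart * (B x.halfPt) + x.vecPart * (x.rad • Bv x.halfPt) := by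
    have hsq : ∑ i : Fin 5, x i.succ * (x i.succ * x.rad⁻¹) = x.rad := by
      simp only [← mul_assoc, ← Finset.sum_mul, ← sq]
      have : x.rad ^ 2 = ∑ i : Fin 5, x i.succ ^ 2 :=
        Real.sq_sqrt (Finset.sum_nonneg fun _ _ => sq_nonneg _)
      rw [← this]
      field_simp
    simp only [pderiv6_axial_succ hr (hA _ hx) (hB _ hx), smul_add, Finset.sum_add_distrib,
      smul_smul, ← Finset.sum_smul, hsq]
    rw [R6.vecPart_eq, Finset.sum_mul _ _ (B x.halfPt), ← R6.vecPart_eq, mul_smul_comm]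
    simp only [smul_mul_assoc]
  have hsum2 : ∑ i : Fin 5, x i.succ • (Cl.e i * B x.halfPt) = x.vecPart * B x.halfPt := by
    rw [R6.vecPart_eq, Finset.sum_mul]
    simp only [smul_mul_assoc]
  simp only [hi, h0, Finset.sum_add_distrib, hsum1, hsum2, Finset.sum_const, Finset.card_univ,
    Fintype.card_fin]
  rw [axial, axial, axial, ha' _ hx, hb' _ hx]
  change _ + (5 • (A x.halfPt + x.vecPart * B x.halfPt) + _ + _) =
    auu x.halfPt + (5 : ℝ) • A x.halfPt + x.rad • Av x.halfPt +
      x.vecPart * (buu x.halfPt + (7 : ℝ) • B x.halfPt + x.rad • Bv x.halfPt)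
  rw [mul_add, mul_add, mul_smul_comm (7 : ℝ)]
  module

end AxialOn

/-! ### The fine structure on slice hyperholomorphic functions -/

namespace FineOp
variable {E : Type*} [AddCommGroup E] [Module ℝ E]

/-- The function `a` in `𝖯 f = a + x⃗ b`, in terms of `v` and of the real parts `α_k` and the
imaginary parts `β_k` of the derivatives of the stem function of `f`. -/
noncomputable def radialPart (v : ℝ) (α β : ℕ → E) : FineOp → E
  | lapDirac => (-8 : ℝ) • (v⁻¹ ^ 2 • α 1 - v⁻¹ ^ 3 • β 0)
  | dirac => (-4 : ℝ) • v⁻¹ ^ 1 • β 0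
  | lap => (-4 : ℝ) • v⁻¹ ^ 1 • β 1
  | diracBar => (4 : ℝ) • v⁻¹ ^ 1 • β 0 + (2 : ℝ) • α 1
  | diracBarSq => (12 : ℝ) • v⁻¹ ^ 1 • β 1 + (4 : ℝ) • α 2
  | lapDiracBar => (-8 : ℝ) • (v⁻¹ ^ 1 • β 2 - v⁻¹ ^ 2 • α 1 + v⁻¹ ^ 3 • β 0)
  | diracSq => (-4 : ℝ) • v⁻¹ ^ 1 • β 1

/-- The function `b` in `𝖯 f = a + x⃗ b`. -/
noncomputable def vectorPart (v : ℝ) (α β : ℕ → E) : FineOp → E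
  | lapDirac => 0
  | dirac => 0
  | lap => (4 : ℝ) • (v⁻¹ ^ 2 • α 1 - v⁻¹ ^ 3 • β 0)
  | diracBar => (2 : ℝ) • v⁻¹ ^ 1 • β 1
  | diracBarSq => (4 : ℝ) • (v⁻¹ ^ 1 • β 2 - v⁻¹ ^ 2 • α 1 + v⁻¹ ^ 3 • β 0)
  | lapDiracBar => (8 : ℝ) • (v⁻¹ ^ 2 • α 2 - v⁻¹ ^ 3 • β 1)
  | diracSq => (-4 : ℝ) • (v⁻¹ ^ 2 • α 1 - v⁻¹ ^ 3 • β 0)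

end FineOp

/-- `α_k`, `β_k` satisfy the relations between the real and the imaginary parts of the derivatives
of a holomorphic function. -/
structure IsDerivTower (α β : ℕ → ℂ → Cl ℝ) (O : Set ℂ) : Prop where
  fst : ∀ k, ∀ z ∈ O, HasPartials (α k) (α (k + 1) z) (-β (k + 1) z) z
  snd : ∀ k, ∀ z ∈ O, HasPartials (β k) (β (k + 1) z) (α (k + 1) z) z
  contDiffOn_fst : ∀ k, ContDiffOn ℝ 2 (α k) O
  contDiffOn_snd : ∀ k, ContDiffOn ℝ 2 (β k) O

theorem contDiffOn_im_inv_pow_smul {g : ℂ → Cl ℝ} {O : Set ℂ} (hpos : ∀ z ∈ O, 0 < z.im)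
    (hg : ContDiffOn ℝ 2 g O) (n : ℕ) : ContDiffOn ℝ 2 (fun z => z.im⁻¹ ^ n • g z) O :=
  ((Complex.imCLM.contDiff.contDiffOn.inv fun z hz => (hpos z hz).ne').pow n).smul hg

theorem hasPartials_zero {E : Type*} [NormedAddCommGroup E] [NormedSpace ℝ E] (z : ℂ) :
    HasPartials (fun _ => (0 : E)) 0 0 z := by
  refine (hasFDerivAt_const (0 : E) z).congr_fderiv ?_
  ext; simp

theorem AxialOn.applyL {f : R6 → Cl ℝ} {α β : ℕ → ℂ → Cl ℝ} {O : Set ℂ} (P : FineOp)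
    (hf : AxialOn f (α 0) (fun z => z.im⁻¹ ^ 1 • β 0 z) O) (h : IsDerivTower α β O)
    (hO : IsOpen O) (hpos : ∀ z ∈ O, 0 < z.im) :
    AxialOn (P.applyL f) (fun z => P.radialPart z.im (α · z) (β · z))
      (fun z => P.vectorPart z.im (α · z) (β · z)) O := by
  have hb : ∀ k n, ∀ z ∈ O, HasPartials (fun z => z.im⁻¹ ^ n • β k z) _ _ z := fun k n z hz =>
    (h.snd k z hz).im_inv_pow_smul n (hpos z hz).ne'
  have ha : ∀ k n, ∀ z ∈ O, HasPartials (fun z => z.im⁻¹ ^ n • α k z) _ _ z := fun k n z hz =>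
    (h.fst k z hz).im_inv_pow_smul n (hpos z hz).ne'
  have hD : AxialOn (_root_.diracL f) (fun z => (-4 : ℝ) • z.im⁻¹ ^ 1 • β 0 z) (fun _ => 0) O := by
    refine hf.diracL hO hpos (h.fst 0) (hb 0 1) (fun z hz => ?_) fun z hz => ?_ <;>
    · have := (hpos z hz).ne'
      match_scalars <;> norm_num <;> field_simp <;> norm_num
  have hDb : AxialOn (_root_.diracBarL f) (fun z => (4 : ℝ) • z.im⁻¹ ^ 1 • β 0 z + (2 : ℝ) • α 1 z)
      (fun z => (2 : ℝ) • z.im⁻¹ ^ 1 • β 1 z) O := by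
    refine hf.diracBarL hO hpos (h.fst 0) (hb 0 1) (fun z hz => ?_) fun z hz => ?_ <;>
    · have := (hpos z hz).ne'
      match_scalars <;> norm_num <;> field_simp <;> norm_num
  have h0 : ∀ z ∈ O, HasPartials (fun _ => (0 : Cl ℝ)) 0 0 z := fun z _ => hasPartials_zero z
  have hc : ∀ n k (c : ℝ), ContDiffOn ℝ 2 (fun z => c • z.im⁻¹ ^ n • β k z) O := fun n k c =>
    (contDiffOn_im_inv_pow_smul hpos (h.contDiffOn_snd k) n).const_smul c
  cases P with
  | dirac => exact hD
  | diracBar => exact hDb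
  | diracSq =>
    refine hD.diracL hO hpos (fun z hz => (hb 0 1 z hz).const_smul _) h0 (fun z hz => ?_)
      fun z hz => ?_ <;>
    · have := (hpos z hz).ne'
      simp only [FineOp.radialPart, FineOp.vectorPart]
      match_scalars <;> norm_num <;> field_simp
  | diracBarSq =>
    refine hDb.diracBarL hO hpos
      (fun z hz => ((hb 0 1 z hz).const_smul _).add ((h.fst 1 z hz).const_smul _))
      (fun z hz => (hb 1 1 z hz).const_smul _) (fun z hz => ?_) fun z hz => ?_ <;>
    · have := (hpos z hz).ne'
      simp only [FineOp.radialPart, FineOp.vectorPart]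
      match_scalars <;> norm_num <;> field_simp <;> norm_num
  | lap =>
    refine hf.laplacian hO hpos (h.contDiffOn_fst 0)
      (contDiffOn_im_inv_pow_smul hpos (h.contDiffOn_snd 0) 1) (h.fst 0) (hb 0 1) (h.fst 1)
      (hb 1 1)
      (fun z hz => ((hb 1 1 z hz).const_smul (-1)).congr_of_eventuallyEq
        (Eventually.of_forall fun w => ?_))
      (fun z hz => ((ha 1 2 z hz).add ((hb 0 3 z hz).const_smul (-1))).congr_of_eventuallyEq
        (Eventually.of_forall fun w => ?_)) (fun z hz => ?_) fun z hz => ?_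
    · simp only
      module
    · simp only
      module
    all_goals
      have := (hpos z hz).ne'
      simp only [FineOp.radialPart, FineOp.vectorPart]
      match_scalars <;> norm_num <;> field_simp <;> norm_num
  | lapDirac =>
    refine hD.laplacian hO hpos (hc 1 0 _) contDiffOn_const
      (fun z hz => (hb 0 1 z hz).const_smul _) h0 (fun z hz => (hb 1 1 z hz).const_smul _) h0
      (fun z hz => (((ha 1 2 z hz).const_smul (-4)).add
        ((hb 0 3 z hz).const_smul 4)).congr_of_eventuallyEq (Eventually.of_forall fun w => ?_))
      (fun z hz => (h0 z hz).congr_of_eventuallyEq (Eventually.of_forall fun w => ?_))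
      (fun z hz => ?_) fun z hz => ?_
    · simp only
      module
    · exact smul_zero _
    all_goals
      have := (hpos z hz).ne'
      simp only [FineOp.radialPart, FineOp.vectorPart]
      match_scalars <;> norm_num <;> field_simp <;> norm_num
  | lapDiracBar =>
    refine hDb.laplacian hO hpos ((hc 1 0 4).add ((h.contDiffOn_fst 1).const_smul 2))
      (hc 1 1 2)
      (fun z hz => ((hb 0 1 z hz).const_smul _).add ((h.fst 1 z hz).const_smul _))
      (fun z hz => (hb 1 1 z hz).const_smul _)
      (fun z hz => ((hb 1 1 z hz).const_smul _).add ((h.fst 2 z hz).const_smul _))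
      (fun z hz => (hb 2 1 z hz).const_smul _)
      (fun z hz => ((((ha 1 2 z hz).const_smul 4).add
        ((hb 0 3 z hz).const_smul (-4))).add ((hb 2 1 z hz).const_smul (-2))).congr_of_eventuallyEq
          (Eventually.of_forall fun w => ?_))
      (fun z hz => (((ha 2 2 z hz).const_smul 2).add
        ((hb 1 3 z hz).const_smul (-2))).congr_of_eventuallyEq
          (Eventually.of_forall fun w => ?_))
      (fun z hz => ?_) fun z hz => ?_
    · simp only
      module
    · simp only
      module
    all_goals
      have := (hpos z hz).ne'
      simp only [FineOp.radialPart, FineOp.vectorPart]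
      match_scalars <;> norm_num <;> field_simp <;> norm_num

/-! ### Stem functions annihilated by the fine structure -/

/-- Compatibility with linear maps lets an identity in the Clifford algebra be read coefficient by
coefficient, so that only scalar holomorphic functions remain. -/
theorem FineOp.radialPart_map {E E' : Type*} [AddCommGroup E] [Module ℝ E] [AddCommGroup E']
    [Module ℝ E'] (L : E →ₗ[ℝ] E') (P : FineOp) (v : ℝ) (α β : ℕ → E) :
    L (P.radialPart v α β) = P.radialPart v (fun k => L (α k)) fun k => L (β k) := by
  cases P <;> simp [radialPart]

theorem FineOp.vectorPart_map {E E' : Type*} [AddCommGroup E] [Module ℝ E] [AddCommGroup E']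
    [Module ℝ E'] (L : E →ₗ[ℝ] E') (P : FineOp) (v : ℝ) (α β : ℕ → E) :
    L (P.vectorPart v α β) = P.vectorPart v (fun k => L (α k)) fun k => L (β k) := by
  cases P <;> simp [vectorPart]

theorem FineOp.radialPart_sub {E : Type*} [AddCommGroup E] [Module ℝ E] (P : FineOp) (v : ℝ)
    (α β α' β' : ℕ → E) :
    P.radialPart v (fun k => α k - α' k) (fun k => β k - β' k) =
      P.radialPart v α β - P.radialPart v α' β' := by
  cases P <;> simp only [radialPart] <;> module

theorem FineOp.vectorPart_sub {E : Type*} [AddCommGroup E] [Module ℝ E] (P : FineOp) (v : ℝ)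
    (α β α' β' : ℕ → E) :
    P.vectorPart v (fun k => α k - α' k) (fun k => β k - β' k) =
      P.vectorPart v α β - P.vectorPart v α' β' := by
  cases P <;> simp only [vectorPart] <;> module

/-! ### Scalar relations between a holomorphic function and its derivatives. -/

section local_analysis
variable {D : ℕ → ℂ → ℂ} {O : Set ℂ}

theorem exists_real_eq_of_im_eq_zero {f f' : ℂ → ℂ} (hO : IsOpen O) (hc : IsPreconnected O)
    (hd : ∀ z ∈ O, HasDerivAt f (f' z) z) (him : ∀ z ∈ O, (f z).im = 0) :
    ∃ c : ℝ, ∀ z ∈ O, f z = c := by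
  obtain ⟨a, ha⟩ := hO.exists_is_const_of_deriv_eq_zero hc
    (fun z hz => (hd z hz).differentiableAt.differentiableWithinAt) fun z hz => by
      obtain ⟨h1, h2⟩ := (HasPartials.im_of_hasDerivAt (hd z hz)).eq_zero_of_isOpen hO hz him
      rw [(hd z hz).deriv]
      exact Complex.ext h2 h1
  refine ⟨a.re, fun z hz => ?_⟩
  rw [ha z hz]
  have := him z hz
  rw [ha z hz] at this
  exact Complex.ext (by simp) (by simpa using this)

/-- A real-valued holomorphic derivative is a constant c, and the second relation says precisely
that D_k - c z has imaginary part zero. -/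
theorem exists_affine_of_im_deriv_eq_zero (hO : IsOpen O) (hc : IsPreconnected O)
    (hD : ∀ k, ∀ z ∈ O, HasDerivAt (D k) (D (k + 1) z) z) (k : ℕ)
    (h1 : ∀ z ∈ O, (D (k + 1) z).im = 0) (h2 : ∀ z ∈ O, z.im * (D (k + 1) z).re = (D k z).im) :
    ∃ c d : ℝ, ∀ z ∈ O, D (k + 1) z = c ∧ D k z = d + z * c := by
  obtain ⟨c, hcst⟩ := exists_real_eq_of_im_eq_zero hO hc (hD (k + 1)) h1
  obtain ⟨d, hd⟩ := exists_real_eq_of_im_eq_zero (f := fun z => D k z - z * c) hO hc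
    (fun z hz => (hD k z hz).sub ((hasDerivAt_id z).mul_const (c : ℂ))) fun z hz => by
      have := h2 z hz
      rw [hcst z hz] at this
      simp at this
      simp [← this]
  exact ⟨c, d, fun z hz => ⟨hcst z hz, by rw [← hd z hz]; ring⟩⟩

/-- A function whose first derivatives have the indicated form is a polynomial with real
coefficients of degree `< 1`, `< 2`, `< 3`. -/
theorem exists_polynomial_of_relations (hO : IsOpen O) (hc : IsPreconnected O)
    (hpos : ∀ z ∈ O, 0 < z.im)
    (hD : ∀ k, ∀ z ∈ O, HasDerivAt (D k) (D (k + 1) z) z) (d : ℕ)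
    (h : (d = 1 ∧ ∀ z ∈ O, (D 0 z).im = 0) ∨
      (d = 2 ∧ ∀ z ∈ O, (D 1 z).im = 0 ∧ z.im * (D 1 z).re = (D 0 z).im) ∨
      (d = 3 ∧ ∀ z ∈ O, z.im * (D 1 z).re = (D 0 z).im)) :
    ∃ c : ℕ → ℝ, ∀ z ∈ O, D 0 z = ∑ k ∈ Finset.range d, z ^ k * c k := by
  have hre := fun k z hz => HasPartials.re_of_hasDerivAt (hD k z hz)
  have him := fun k z hz => HasPartials.im_of_hasDerivAt (hD k z hz)
  rcases h with ⟨rfl, h⟩ | ⟨rfl, h⟩ | ⟨rfl, h⟩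
  · obtain ⟨c, hc⟩ := exists_real_eq_of_im_eq_zero hO hc (hD 0) h
    exact ⟨fun _ => c, fun z hz => by simp [hc z hz]⟩
  · obtain ⟨c, e, hce⟩ := exists_affine_of_im_deriv_eq_zero hO hc hD 0 (fun z hz => (h z hz).1)
      fun z hz => (h z hz).2
    refine ⟨fun k => if k = 0 then e else c, fun z hz => ?_⟩
    simp [Finset.sum_range_succ, (hce z hz).2]
  · have hE : ∀ z ∈ O, z.im • (D 1 z).re + (-1 : ℝ) • (D 0 z).im = 0 := fun z hz => by
      rw [smul_eq_mul, h z hz]; simp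
    -- Differentiating v Re D₁ = Im D₀ along u gives v Re D₂ = Im D₁, along v it gives v Im D₂ = 0.
    -- So D₁ is affine, and D₀ minus an antiderivative of it has vanishing imaginary part.
    have hrel : ∀ z ∈ O, (D 2 z).im = 0 ∧ z.im * (D 2 z).re = (D 1 z).im := by
      intro z hz
      obtain ⟨e1, e2⟩ := ((HasPartials.im_smul (hre 1 z hz)).add
        ((him 0 z hz).const_smul (-1))).eq_zero_of_isOpen hO hz hE
      simp only [smul_eq_mul, Nat.reduceAdd] at e1 e2
      have hv : z.im * (D 2 z).im = 0 := by linarith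
      exact ⟨(mul_eq_zero.mp hv).resolve_left (hpos z hz).ne', by linarith⟩
    obtain ⟨c, e, hce⟩ := exists_affine_of_im_deriv_eq_zero hO hc hD 1 (fun z hz => (hrel z hz).1)
      fun z hz => (hrel z hz).2
    obtain ⟨a, ha⟩ := exists_real_eq_of_im_eq_zero (f := fun z => D 0 z - (z * e + z ^ 2 * (c / 2)))
      hO hc (fun z hz => (hD 0 z hz).sub (((hasDerivAt_id z).mul_const (e : ℂ)).add
        ((hasDerivAt_pow 2 z).mul_const ((c : ℂ) / 2)))) fun z hz => by
      have h1 := h z hz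
      rw [(hce z hz).2] at h1
      have h2 : (z * e + z ^ 2 * (c / 2) : ℂ) = z * e + z ^ 2 * ((c / 2 : ℝ) : ℂ) := by
        push_cast; rfl
      rw [h2, Complex.sub_im, ← h1]
      simp [sq]
      ring
    refine ⟨fun k => if k = 0 then a else if k = 1 then e else c / 2, fun z hz => ?_⟩
    have := ha z hz
    simp only [Finset.sum_range_succ, Finset.sum_range_zero]
    norm_num
    linear_combination this

/-- The relations between the derivatives of a stem function annihilated by `𝖯`. -/
theorem FineOp.relations_of_parts_eq_zero (P : FineOp) (hO : IsOpen O) (hpos : ∀ z ∈ O, 0 < z.im)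
    (hD : ∀ k, ∀ z ∈ O, HasDerivAt (D k) (D (k + 1) z) z)
    (hr : ∀ z ∈ O, P.radialPart z.im (fun k => (D k z).re) (fun k => (D k z).im) = 0)
    (hv : ∀ z ∈ O, P.vectorPart z.im (fun k => (D k z).re) (fun k => (D k z).im) = 0) :
    (P.degree = 1 ∧ ∀ z ∈ O, (D 0 z).im = 0) ∨
      (P.degree = 2 ∧ ∀ z ∈ O, (D 1 z).im = 0 ∧ z.im * (D 1 z).re = (D 0 z).im) ∨
      (P.degree = 3 ∧ ∀ z ∈ O, z.im * (D 1 z).re = (D 0 z).im) := by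
  have hre := fun k z hz => HasPartials.re_of_hasDerivAt (hD k z hz)
  have him := fun k z hz => HasPartials.im_of_hasDerivAt (hD k z hz)
  cases P with
  | dirac =>
    refine Or.inl ⟨rfl, fun z hz => ?_⟩
    have h1 := hr z hz
    have := (hpos z hz).ne'
    simp only [radialPart, smul_eq_mul] at h1
    field_simp at h1
    linarith
  | diracBar =>
    -- The v-derivative of 2 Im D₀ + v Re D₁ = 0 is 3 Re D₁ - v Im D₂ = 0, and Im D₁ = 0 forces Im
    -- D₂ = 0. Hence Re D₁ = 0, and then Im D₀ = 0.
    have e1 : ∀ z ∈ O, (2 : ℝ) • (D 0 z).im + z.im • (D 1 z).re = 0 := fun z hz => by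
      have h1 := hr z hz
      have := (hpos z hz).ne'
      simp only [radialPart, smul_eq_mul] at h1 ⊢
      field_simp at h1
      linarith
    have e2 : ∀ z ∈ O, (D 1 z).im = 0 := fun z hz => by
      have h1 := hv z hz
      have := (hpos z hz).ne'
      simp only [vectorPart, smul_eq_mul] at h1
      field_simp at h1
      linarith
    refine Or.inl ⟨rfl, fun z hz => ?_⟩
    obtain ⟨a1, a2⟩ := (him 1 z hz).eq_zero_of_isOpen hO hz e2
    obtain ⟨b1, b2⟩ := (((him 0 z hz).const_smul 2).add
      (HasPartials.im_smul (hre 1 z hz))).eq_zero_of_isOpen hO hz e1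
    have e := e1 z hz
    simp only [smul_eq_mul, Nat.reduceAdd, zero_add] at *
    rw [a1] at b2
    have : (D 1 z).re = 0 := by linarith
    rw [this] at e
    linarith
  | diracSq =>
    refine Or.inr (Or.inl ⟨rfl, fun z hz => ?_⟩)
    have h1 := hr z hz
    have h2 := hv z hz
    have := (hpos z hz).ne'
    simp only [radialPart, vectorPart, smul_eq_mul] at h1 h2
    field_simp at h1 h2
    constructor <;> linarith
  | lap =>
    refine Or.inr (Or.inl ⟨rfl, fun z hz => ?_⟩)
    have h1 := hr z hz
    have h2 := hv z hz
    have := (hpos z hz).ne'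
    simp only [radialPart, vectorPart, smul_eq_mul] at h1 h2
    field_simp at h1 h2
    constructor <;> linarith
  | lapDirac =>
    refine Or.inr (Or.inr ⟨rfl, fun z hz => ?_⟩)
    have h1 := hr z hz
    have := (hpos z hz).ne'
    simp only [radialPart, smul_eq_mul] at h1
    field_simp at h1
    linarith
  | diracBarSq =>
    have e1 : ∀ z ∈ O, (3 : ℝ) • (D 1 z).im + z.im • (D 2 z).re = 0 := fun z hz => by
      have h1 := hr z hz
      have := (hpos z hz).ne'
      simp only [radialPart, smul_eq_mul] at h1 ⊢
      field_simp at h1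
      linarith
    have e2 : ∀ z ∈ O, z.im • z.im • (D 2 z).im + (-1 : ℝ) • z.im • (D 1 z).re + (D 0 z).im = 0 :=
      fun z hz => by
        have h1 := hv z hz
        have := (hpos z hz).ne'
        simp only [vectorPart, smul_eq_mul] at h1 ⊢
        field_simp at h1
        linarith
    have e3 : ∀ z ∈ O, (D 1 z).im = 0 := fun z hz => by
      obtain ⟨a1, a2⟩ := (((him 1 z hz).const_smul 3).add
        (HasPartials.im_smul (hre 2 z hz))).eq_zero_of_isOpen hO hz e1
      obtain ⟨b1, b2⟩ := (((HasPartials.im_smul (HasPartials.im_smul (him 2 z hz))).add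
        ((HasPartials.im_smul (hre 1 z hz)).const_smul (-1))).add (him 0 z hz)).eq_zero_of_isOpen
          hO hz e2
      have e := e1 z hz
      simp only [smul_eq_mul, Nat.reduceAdd, zero_add] at *
      -- The v-derivative of `e1` is 4 Re D₂ - v Im D₃ = 0, the u-derivative of `e2` is v² Im D₃ - v
      -- Re D₂ + Im D₁ = 0. Eliminating Im D₃, and then v Re D₂ = -3 Im D₁, leaves 8 Im D₁ = 0.
      linear_combination (3 / 8 : ℝ) * e + (-1 / 8 : ℝ) * b1 + (-1 / 8 : ℝ) * z.im * a2
    refine Or.inr (Or.inl ⟨rfl, fun z hz => ⟨e3 z hz, ?_⟩⟩)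
    obtain ⟨a1, -⟩ := (him 1 z hz).eq_zero_of_isOpen hO hz e3
    have e := e2 z hz
    simp only [smul_eq_mul, Nat.reduceAdd] at *
    rw [a1] at e
    linarith
  | lapDiracBar =>
    have e1 : ∀ z ∈ O, z.im • (D 2 z).re + (-1 : ℝ) • (D 1 z).im = 0 := fun z hz => by
      have h1 := hv z hz
      have := (hpos z hz).ne'
      simp only [vectorPart, smul_eq_mul] at h1 ⊢
      field_simp at h1
      linarith
    have e2 : ∀ z ∈ O, z.im • z.im • (D 2 z).im + (-1 : ℝ) • z.im • (D 1 z).re + (D 0 z).im = 0 :=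
      fun z hz => by
        have h1 := hr z hz
        have := (hpos z hz).ne'
        simp only [radialPart, smul_eq_mul] at h1 ⊢
        field_simp at h1
        linarith
    refine Or.inr (Or.inr ⟨rfl, fun z hz => ?_⟩)
    have hp := (hpos z hz).ne'
    obtain ⟨a1, a2⟩ := ((HasPartials.im_smul (hre 2 z hz)).add
      ((him 1 z hz).const_smul (-1))).eq_zero_of_isOpen hO hz e1
    obtain ⟨b1, b2⟩ := (((HasPartials.im_smul (HasPartials.im_smul (him 2 z hz))).add
      ((HasPartials.im_smul (hre 1 z hz)).const_smul (-1))).add (him 0 z hz)).eq_zero_of_isOpen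
        hO hz e2
    have e := e2 z hz
    simp only [smul_eq_mul, Nat.reduceAdd, zero_add] at *
    -- The u-derivative of `e1` is v Re D₃ = Im D₂, the v-derivative of `e2` is v² Re D₃ + 3 v Im D₂
    -- = 0. Together they give 4 v Im D₂ = 0, so the first term of `e2` drops out.
    have h1 : z.im * (D 2 z).im = 0 := by
      linear_combination (1 / 4 : ℝ) * b2 - (1 / 4 : ℝ) * z.im * a1
    linear_combination z.im * h1 - e

end local_analysis

/-! ### Slices -/

theorem imagSphere_nonempty : imagSphere.Nonempty :=
  ⟨EuclideanSpace.single 1 1, by simp [imagSphere]⟩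

theorem neg_mem_imagSphere {J : R6} (hJ : J ∈ imagSphere) : -J ∈ imagSphere :=
  ⟨by simp [hJ.1], by rw [norm_neg, hJ.2]⟩

theorem slicePt_conj (J : R6) (z : ℂ) : slicePt J ((starRingEnd ℂ) z) = slicePt (-J) z := by
  simp [slicePt]

theorem continuous_slicePt (J : R6) : Continuous (slicePt J) := by
  have h : slicePt J = fun z => z.re • EuclideanSpace.single 0 (1 : ℝ) + z.im • J := by
    funext z
    ext i
    by_cases hi : i = 0 <;> simp [slicePt, hi]
  rw [h]
  exact (Complex.continuous_re.smul continuous_const).add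
    (Complex.continuous_im.smul continuous_const)

theorem norm_slicePt {J : R6} (hJ : J ∈ imagSphere) (z : ℂ) : ‖slicePt J z‖ = ‖z‖ := by
  have hsum : ∑ i : Fin 5, J i.succ ^ 2 = 1 := by
    have h1 := EuclideanSpace.norm_sq_eq J
    rw [hJ.2, Fin.sum_univ_succ, hJ.1] at h1
    simpa using h1.symm
  have h1 : ‖slicePt J z‖ ^ 2 = ‖z‖ ^ 2 := by
    rw [EuclideanSpace.norm_sq_eq, Fin.sum_univ_succ, Complex.sq_norm, Complex.normSq_apply]
    simp [slicePt, hJ.1, mul_pow, ← Finset.mul_sum, hsum]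
    ring
  exact (sq_eq_sq₀ (norm_nonneg _) (norm_nonneg _)).mp h1

theorem IsAxiallySymmetric.preimage_slicePt {U : Set R6} (hs : IsAxiallySymmetric U) {J : R6}
    (hJ : J ∈ imagSphere) : slicePt J ⁻¹' U = sliceSet U :=
  Set.ext fun z => ⟨fun h I hI => hs z J hJ h I hI, fun h => h J hJ⟩

theorem isOpen_sliceSet {U : Set R6} (hU : IsOpen U) (hs : IsAxiallySymmetric U) :
    IsOpen (sliceSet U) := by
  obtain ⟨J, hJ⟩ := imagSphere_nonempty
  rw [← hs.preimage_slicePt hJ]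
  exact hU.preimage (continuous_slicePt J)

theorem conj_mem_sliceSet {U : Set R6} {z : ℂ} (hz : z ∈ sliceSet U) :
    (starRingEnd ℂ) z ∈ sliceSet U := fun J hJ => by
  rw [slicePt_conj]
  exact hz _ (neg_mem_imagSphere hJ)

theorem conj_mem_sliceSet_iff {U : Set R6} {z : ℂ} :
    (starRingEnd ℂ) z ∈ sliceSet U ↔ z ∈ sliceSet U :=
  ⟨fun h => by simpa using conj_mem_sliceSet h, conj_mem_sliceSet⟩

theorem slicePt_zero {J : R6} (hJ : J ∈ imagSphere) (z : ℂ) : (slicePt J z) 0 = z.re := by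
  simp [slicePt, hJ.1]

theorem slicePt_succ (J : R6) (z : ℂ) (i : Fin 5) : (slicePt J z) i.succ = z.im * J i.succ := by
  simp [slicePt]

theorem halfPt_slicePt {J : R6} (hJ : J ∈ imagSphere) {z : ℂ} (hz : 0 ≤ z.im) :
    (slicePt J z).halfPt = z := by
  have hsum : ∑ i : Fin 5, J i.succ ^ 2 = 1 := by
    have h1 := EuclideanSpace.norm_sq_eq J
    rw [hJ.2, Fin.sum_univ_succ, hJ.1] at h1
    simpa using h1.symm
  refine Complex.ext (slicePt_zero hJ z) ?_
  change R6.rad _ = _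
  simp only [R6.rad, slicePt_succ, mul_pow, ← Finset.mul_sum, hsum, mul_one, Real.sqrt_sq hz]

theorem vecPart_slicePt {J : R6} (hJ : J ∈ imagSphere) (z : ℂ) :
    (slicePt J z).vecPart = z.im • J.toCl := by
  have h : J.toCl = Cl.vec fun i => J i.succ := by
    rw [R6.toCl, Cl.paravec_eq, hJ.1, Cl.single_zero, zero_add]
  rw [h, R6.vecPart]
  simp only [slicePt_succ, Cl.vec, Finset.smul_sum, ← Cl.single_smul, smul_eq_mul]

theorem exists_slicePt_halfPt (x : R6) : ∃ J ∈ imagSphere, slicePt J x.halfPt = x := by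
  have hrad : x.rad ^ 2 = ∑ i : Fin 5, x i.succ ^ 2 :=
    Real.sq_sqrt (Finset.sum_nonneg fun _ _ => sq_nonneg _)
  by_cases hr : x.rad = 0
  · obtain ⟨J, hJ⟩ := imagSphere_nonempty
    refine ⟨J, hJ, ?_⟩
    have h0 : ∀ i : Fin 5, x i.succ = 0 := by
      rw [hr, zero_pow two_ne_zero, eq_comm,
        Finset.sum_eq_zero_iff_of_nonneg fun _ _ => sq_nonneg _] at hrad
      exact fun i => pow_eq_zero_iff two_ne_zero |>.mp (hrad i (Finset.mem_univ i))
    ext i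
    refine Fin.cases ?_ (fun i => ?_) i
    · exact slicePt_zero hJ _
    · rw [slicePt_succ, h0]
      change x.rad * _ = 0
      rw [hr, zero_mul]
  · set J : R6 := x.rad⁻¹ • (x - EuclideanSpace.single 0 (x 0)) with hJdef
    have hJ0 : J 0 = 0 := by simp [hJdef]
    have hJs : ∀ i : Fin 5, J i.succ = x.rad⁻¹ * x i.succ := fun i => by simp [hJdef]
    have hJ : J ∈ imagSphere := by
      refine ⟨hJ0, ?_⟩
      have : ‖J‖ ^ 2 = 1 := by
        rw [EuclideanSpace.norm_sq_eq, Fin.sum_univ_succ, hJ0]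
        simp only [hJs, Real.norm_eq_abs, sq_abs, mul_pow, ← Finset.mul_sum, ← hrad]
        field_simp
        simp
      exact (pow_eq_one_iff_of_nonneg (norm_nonneg J) two_ne_zero).mp this
    refine ⟨J, hJ, ?_⟩
    ext i
    refine Fin.cases ?_ (fun i => ?_) i
    · exact slicePt_zero hJ _
    · rw [slicePt_succ, hJs]
      change x.rad * _ = _
      field_simp

theorem halfPt_mem_sliceSet {U : Set R6} (hs : IsAxiallySymmetric U) {x : R6} (hx : x ∈ U) :
    x.halfPt ∈ sliceSet U := by
  obtain ⟨J, hJ, h⟩ := exists_slicePt_halfPt x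
  exact fun I hI => hs _ J hJ (by rwa [h]) I hI

/-! ### Stem functions -/

/-- The components of a stem function: holomorphic functions that commute with the conjugation. -/
structure IsStem (U : Set R6) (F : Finset (Fin 5) → ℂ → ℂ) : Prop where
  differentiableOn : ∀ A, DifferentiableOn ℂ (F A) (sliceSet U)
  conj : ∀ A, ∀ z ∈ sliceSet U, F A ((starRingEnd ℂ) z) = (starRingEnd ℂ) (F A z)

/-- The real part of a stem function. -/
noncomputable def stemRe (F : Finset (Fin 5) → ℂ → ℂ) (z : ℂ) : Cl ℝ :=
  Cl.mkCLM fun A => (F A z).re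

/-- The imaginary part of a stem function. -/
noncomputable def stemIm (F : Finset (Fin 5) → ℂ → ℂ) (z : ℂ) : Cl ℝ :=
  Cl.mkCLM fun A => (F A z).im

/-- For each A the real Cauchy-Riemann system for the two coefficients is complex differentiability
of their combination, and evenness and oddness together are symmetry under conjugation. -/
theorem IsSlicePair.exists_isStem {U : Set R6} {α β : ℂ → Cl ℝ} (h : IsSlicePair U α β) :
    ∃ F, IsStem U F ∧ α = stemRe F ∧ β = stemIm F := by
  refine ⟨fun A z => ⟨(α z).coeff A, (β z).coeff A⟩, ⟨fun A z hz => ?_, fun A z hz => ?_⟩, rfl, rfl⟩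
  · refine DifferentiableAt.differentiableWithinAt ?_
    have hα := (h.differentiable_fst z hz).hasFDerivAt
    have hβ := (h.differentiable_snd z hz).hasFDerivAt
    have h1 := (Complex.ofRealCLM ∘L Cl.coeffCLM A).hasFDerivAt.comp z hα
    have h2 := ((Complex.ofRealCLM ∘L Cl.coeffCLM A).hasFDerivAt.comp z hβ).mul_const Complex.I
    have h3 := h1.add h2
    have hF : (fun z => (⟨(α z).coeff A, (β z).coeff A⟩ : ℂ)) =
        (((Complex.ofRealCLM ∘L Cl.coeffCLM A) ∘ α) + fun z =>
          ((Complex.ofRealCLM ∘L Cl.coeffCLM A) ∘ β) z * Complex.I) :=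
      funext fun z => Complex.mk_eq_add_mul_I _ _
    rw [hF, differentiableAt_complex_iff_differentiableAt_real]
    refine ⟨h3.differentiableAt, ?_⟩
    rw [h3.fderiv]
    have c1 := congrArg (fun x => x.coeff A) (h.cauchyRiemann_fst z hz)
    have c2 := congrArg (fun x => x.coeff A) (h.cauchyRiemann_snd z hz)
    simp only [Cl.coeff_sub, Cl.coeff_add, Cl.coeff_zero] at c1 c2
    apply Complex.ext
    · simp [Cl.coeffCLM_apply]
      linarith
    · simp [Cl.coeffCLM_apply]
      linarith
  · apply Complex.ext
    · simp [h.even z hz]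
    · simp [h.odd z hz]

theorem IsStem.isSlicePair {U : Set R6} (hU : IsOpen U) (hs : IsAxiallySymmetric U)
    {F : Finset (Fin 5) → ℂ → ℂ} (h : IsStem U F) : IsSlicePair U (stemRe F) (stemIm F) := by
  have hd : ∀ z ∈ sliceSet U, ∀ A, HasDerivAt (F A) (deriv (F A) z) z := fun z hz A =>
    ((h.differentiableOn A).differentiableAt ((isOpen_sliceSet hU hs).mem_nhds hz)).hasDerivAt
  have h1 : ∀ z ∈ sliceSet U, HasPartials (stemRe F) (Cl.mkCLM fun A => (deriv (F A) z).re)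
      (Cl.mkCLM fun A => -(deriv (F A) z).im) z := fun z hz =>
    Cl.hasPartials_mkCLM fun A => HasPartials.re_of_hasDerivAt (hd z hz A)
  have h2 : ∀ z ∈ sliceSet U, HasPartials (stemIm F) (Cl.mkCLM fun A => (deriv (F A) z).im)
      (Cl.mkCLM fun A => (deriv (F A) z).re) z := fun z hz =>
    Cl.hasPartials_mkCLM fun A => HasPartials.im_of_hasDerivAt (hd z hz A)
  refine ⟨fun z hz => HasFDerivAt.differentiableAt (h1 z hz),
    fun z hz => HasFDerivAt.differentiableAt (h2 z hz), fun z hz => ?_, fun z hz => ?_,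
    fun z hz => ?_, fun z hz => ?_⟩
  · exact Cl.ext_coeff fun A => by simp [stemRe, Cl.coeff_mkCLM, h.conj A z hz]
  · exact Cl.ext_coeff fun A => by simp [stemIm, Cl.coeff_mkCLM, h.conj A z hz]
  · rw [HasFDerivAt.fderiv (h1 z hz), HasFDerivAt.fderiv (h2 z hz)]
    simp
  · rw [HasFDerivAt.fderiv (h1 z hz), HasFDerivAt.fderiv (h2 z hz)]
    exact Cl.ext_coeff fun A => by simp [Cl.coeff_mkCLM]

/-- The derivatives of a stem function. -/
theorem isDerivTower_stem {F : Finset (Fin 5) → ℂ → ℂ} {O : Set ℂ} (hO : IsOpen O)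
    (hF : ∀ A, DifferentiableOn ℂ (F A) O) :
    IsDerivTower (fun k => stemRe fun A => deriv^[k] (F A))
      (fun k => stemIm fun A => deriv^[k] (F A)) O := by
  have han : ∀ k A, AnalyticOnNhd ℂ (deriv^[k] (F A)) O := fun k A =>
    ((hF A).analyticOnNhd hO).iterated_deriv k
  have hd : ∀ k A, ∀ z ∈ O, HasDerivAt (deriv^[k] (F A)) (deriv^[k + 1] (F A) z) z :=
    fun k A z hz => by
      rw [Function.iterate_succ_apply']
      exact (han k A z hz).differentiableAt.hasDerivAt
  have hc : ∀ k A, ContDiffOn ℝ 2 (deriv^[k] (F A)) O := fun k A =>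
    ((han k A).contDiffOn hO.uniqueDiffOn).restrict_scalars ℝ
  refine ⟨fun k z hz => ?_, fun k z hz => ?_, fun k => ?_, fun k => ?_⟩
  · refine (Cl.hasPartials_mkCLM fun A =>
      HasPartials.re_of_hasDerivAt (hd k A z hz)).congr_partials rfl ?_
    exact Cl.ext_coeff fun A => by simp [stemIm, Cl.coeff_mkCLM]
  · exact Cl.hasPartials_mkCLM fun A => HasPartials.im_of_hasDerivAt (hd k A z hz)
  · exact Cl.mkCLM.contDiff.comp_contDiffOn
      (contDiffOn_pi.mpr fun A => Complex.reCLM.contDiff.comp_contDiffOn (hc k A))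
  · exact Cl.mkCLM.contDiff.comp_contDiffOn
      (contDiffOn_pi.mpr fun A => Complex.imCLM.contDiff.comp_contDiffOn (hc k A))

/-- `f` is the left slice function with the stem function `F`. -/
def IsLeftSlice (U : Set R6) (f : R6 → Cl ℝ) (F : Finset (Fin 5) → ℂ → ℂ) : Prop :=
  ∀ z ∈ sliceSet U, ∀ J ∈ imagSphere, f (slicePt J z) = stemRe F z + J.toCl * stemIm F z

/-- Above the real axis x⃗ = v J, so J β equals x⃗ (β / v) and f takes the axial form to which the
explicit formulas apply. -/
theorem IsLeftSlice.applyL_slicePt {U : Set R6} (hU : IsOpen U) (hs : IsAxiallySymmetric U)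
    {f : R6 → Cl ℝ} {F : Finset (Fin 5) → ℂ → ℂ} (hF : IsStem U F) (hf : IsLeftSlice U f F)
    (P : FineOp) {z : ℂ} (hz : z ∈ sliceSet U) (hpos : 0 < z.im) {J : R6} (hJ : J ∈ imagSphere) :
    P.applyL f (slicePt J z) =
      P.radialPart z.im (fun k => stemRe (fun A => deriv^[k] (F A)) z)
        (fun k => stemIm (fun A => deriv^[k] (F A)) z) +
      z.im • J.toCl * P.vectorPart z.im (fun k => stemRe (fun A => deriv^[k] (F A)) z)
        (fun k => stemIm (fun A => deriv^[k] (F A)) z) := by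
  set O : Set ℂ := sliceSet U ∩ {z | 0 < z.im} with hOdef
  have hO : IsOpen O :=
    (isOpen_sliceSet hU hs).inter (isOpen_lt continuous_const Complex.continuous_im)
  have ht := isDerivTower_stem hO fun A => (hF.differentiableOn A).mono inter_subset_left
  have hax : AxialOn f (stemRe F) (fun z => z.im⁻¹ ^ 1 • stemIm F z) O := by
    intro x hx
    obtain ⟨I, hI, hxI⟩ := exists_slicePt_halfPt x
    have hv : x.vecPart = x.halfPt.im • I.toCl := by
      rw [← vecPart_slicePt hI, hxI]
    conv_lhs => rw [← hxI, hf _ hx.1 I hI]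
    have hne : x.halfPt.im ≠ 0 := ne_of_gt hx.2
    rw [axial, hv, pow_one, smul_mul_assoc, mul_smul_comm, smul_smul, mul_inv_cancel₀ hne, one_smul]
  have key := AxialOn.applyL P hax ht hO (fun w hw => hw.2) (slicePt J z)
    (by rw [halfPt_slicePt hJ hpos.le]; exact ⟨hz, hpos⟩)
  rw [key, axial, halfPt_slicePt hJ hpos.le, vecPart_slicePt hJ]

theorem toCl_mul_left_cancel {J : R6} (hJ : J ∈ imagSphere) {x y : Cl ℝ}
    (h : J.toCl * x = J.toCl * y) : x = y := by
  have := congrArg (fun w => -(J.toCl * w)) h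
  simpa only [← mul_assoc, Cl.toCl_mul_self hJ, neg_mul, one_mul, neg_neg] using this

theorem toCl_neg (J : R6) : (-J).toCl = -J.toCl := by
  refine Cl.ext_coeff fun A => ?_
  have h : ∀ i : Fin 6, (-J) i = -J i := fun i => rfl
  simp [R6.toCl, Cl.paravec, Cl.coeff_sum, Cl.single_neg, neg_add_rev, add_comm]

/-- Two slice hyperholomorphic functions with the same image under `𝖯` have stem functions that
differ by a polynomial with real coefficients. -/
theorem exists_polynomial_eq_sub {U : Set R6} (hU : IsOpen U) (hs : IsAxiallySymmetric U)
    (hconn : IsConnected U) {f g : R6 → Cl ℝ} {F G : Finset (Fin 5) → ℂ → ℂ} (hF : IsStem U F)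
    (hG : IsStem U G) (hf : IsLeftSlice U f F) (hg : IsLeftSlice U g G) (P : FineOp)
    (hP : ∀ x ∈ U, P.applyL f x = P.applyL g x) (A : Finset (Fin 5)) :
    ∃ c : ℕ → ℝ, ∀ z ∈ sliceSet U, F A z - G A z = ∑ k ∈ Finset.range P.degree, z ^ k * c k := by
  have hSo := isOpen_sliceSet hU hs
  obtain ⟨J, hJ⟩ := imagSphere_nonempty
  set O : Set ℂ := sliceSet U ∩ {z | 0 < z.im} with hOdef
  have hO : IsOpen O := hSo.inter (isOpen_lt continuous_const Complex.continuous_im)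
  have hparts : ∀ z ∈ O,
      P.radialPart z.im (fun k => stemRe (fun A => deriv^[k] (F A)) z)
          (fun k => stemIm (fun A => deriv^[k] (F A)) z) =
        P.radialPart z.im (fun k => stemRe (fun A => deriv^[k] (G A)) z)
          (fun k => stemIm (fun A => deriv^[k] (G A)) z) ∧
      P.vectorPart z.im (fun k => stemRe (fun A => deriv^[k] (F A)) z)
          (fun k => stemIm (fun A => deriv^[k] (F A)) z) =
        P.vectorPart z.im (fun k => stemRe (fun A => deriv^[k] (G A)) z)
          (fun k => stemIm (fun A => deriv^[k] (G A)) z) := by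
    intro z hz
    -- The vector term changes sign between J and -J. Adding the two identities isolates the radial
    -- parts; then J and v are cancelled from what remains.
    have key : ∀ I ∈ imagSphere, _ := fun I hI =>
      ((hf.applyL_slicePt hU hs hF P hz.1 hz.2 hI).symm.trans (hP _ (hz.1 I hI))).trans
        (hg.applyL_slicePt hU hs hG P hz.1 hz.2 hI)
    have k1 := key J hJ
    have k2 := key (-J) (neg_mem_imagSphere hJ)
    rw [toCl_neg, smul_neg, neg_mul, neg_mul] at k2
    generalize P.radialPart z.im (fun k => stemRe (fun A => deriv^[k] (F A)) z) _ = a at *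
    generalize P.radialPart z.im (fun k => stemRe (fun A => deriv^[k] (G A)) z) _ = b at *
    generalize P.vectorPart z.im (fun k => stemRe (fun A => deriv^[k] (F A)) z) _ = c at *
    generalize P.vectorPart z.im (fun k => stemRe (fun A => deriv^[k] (G A)) z) _ = d at *
    have h1 : (2 : ℝ) • a = (2 : ℝ) • b := by
      rw [two_smul, two_smul]
      calc a + a = a + z.im • J.toCl * c + (a + -(z.im • J.toCl * c)) := by abel
        _ = b + b := by rw [k1, k2]; abel
    have hab : a = b := by
      have := congrArg (fun x => (2⁻¹ : ℝ) • x) h1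
      simpa only [smul_smul, inv_mul_cancel₀ (two_ne_zero : (2 : ℝ) ≠ 0), one_smul] using this
    refine ⟨hab, toCl_mul_left_cancel hJ ?_⟩
    rw [hab, add_right_inj, smul_mul_assoc, smul_mul_assoc] at k1
    have := congrArg (fun x => z.im⁻¹ • x) k1
    have hne : z.im ≠ 0 := ne_of_gt hz.2
    simpa only [smul_smul, inv_mul_cancel₀ hne, one_smul] using this
  have hD : ∀ k, ∀ z ∈ O, HasDerivAt (fun z => deriv^[k] (F A) z - deriv^[k] (G A) z)
      (deriv^[k + 1] (F A) z - deriv^[k + 1] (G A) z) z := fun k z hz => by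
    rw [Function.iterate_succ_apply', Function.iterate_succ_apply']
    exact ((((hF.differentiableOn A).analyticOnNhd hSo).iterated_deriv k z
      hz.1).differentiableAt.hasDerivAt).sub ((((hG.differentiableOn A).analyticOnNhd
        hSo).iterated_deriv k z hz.1).differentiableAt.hasDerivAt)
  have hr : ∀ z ∈ O, P.radialPart z.im (fun k => (deriv^[k] (F A) z - deriv^[k] (G A) z).re)
      (fun k => (deriv^[k] (F A) z - deriv^[k] (G A) z).im) = 0 := fun z hz => by
    have h := congrArg (Cl.coeffCLM A).toLinearMap (hparts z hz).1
    rw [P.radialPart_map, P.radialPart_map] at h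
    simp only [Complex.sub_re, Complex.sub_im]
    rw [P.radialPart_sub, sub_eq_zero]
    exact h
  have hv : ∀ z ∈ O, P.vectorPart z.im (fun k => (deriv^[k] (F A) z - deriv^[k] (G A) z).re)
      (fun k => (deriv^[k] (F A) z - deriv^[k] (G A) z).im) = 0 := fun z hz => by
    have h := congrArg (Cl.coeffCLM A).toLinearMap (hparts z hz).2
    rw [P.vectorPart_map, P.vectorPart_map] at h
    simp only [Complex.sub_re, Complex.sub_im]
    rw [P.vectorPart_sub, sub_eq_zero]
    exact h
  obtain ⟨z₀, hz₀⟩ : O.Nonempty := by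
    obtain ⟨x, hx⟩ := hconn.nonempty
    obtain ⟨ε, hε, hball⟩ := Metric.isOpen_iff.mp hSo _ (halfPt_mem_sliceSet hs hx)
    refine ⟨x.halfPt + ((ε / 2 : ℝ) : ℂ) * Complex.I, hball ?_, ?_⟩
    · rw [Metric.mem_ball, dist_eq_norm, add_sub_cancel_left, norm_mul, Complex.norm_I, mul_one,
        Complex.norm_real, Real.norm_eq_abs, abs_of_pos (half_pos hε)]
      linarith
    · have : 0 ≤ x.halfPt.im := Real.sqrt_nonneg _
      simp
      positivity
  obtain ⟨ε, hε, hball⟩ := Metric.isOpen_iff.mp hO z₀ hz₀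
  obtain ⟨c, hc⟩ := exists_polynomial_of_relations isOpen_ball (convex_ball z₀ ε).isPreconnected
    (fun z hz => (hball hz).2) (fun k z hz => hD k z (hball hz)) P.degree
    (P.relations_of_parts_eq_zero isOpen_ball (fun z hz => (hball hz).2)
      (fun k z hz => hD k z (hball hz)) (fun z hz => hr z (hball hz)) fun z hz => hv z (hball hz))
  have hpd : Differentiable ℂ fun z : ℂ => ∑ k ∈ Finset.range P.degree, z ^ k * (c k : ℂ) := by
    fun_prop
  -- `sliceSet U` can be disconnected: if U misses the real axis, it splits into two mirror halves.
  -- The image of U under `R6.halfPt`, its part in the closed upper half-plane, is connected, so the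
  -- identity theorem is applied there.
  have hV : R6.halfPt '' U ⊆ sliceSet U := image_subset_iff.mpr fun x hx =>
    halfPt_mem_sliceSet hs hx
  have hmem : ∀ z ∈ sliceSet U, 0 ≤ z.im → z ∈ R6.halfPt '' U := fun z hz h0 =>
    ⟨slicePt J z, hz J hJ, halfPt_slicePt hJ h0⟩
  have heq := AnalyticOnNhd.eqOn_of_preconnected_of_eventuallyEq
    (f := fun z => F A z - G A z) (g := fun z => ∑ k ∈ Finset.range P.degree, z ^ k * (c k : ℂ))
    ((((hF.differentiableOn A).sub (hG.differentiableOn A)).analyticOnNhd hSo).mono hV)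
    ((hpd.differentiableOn.analyticOnNhd isOpen_univ).mono (subset_univ _))
    (hconn.isPreconnected.image _ R6.continuous_halfPt.continuousOn)
    (hmem z₀ hz₀.1 hz₀.2.le) (eventually_of_mem (ball_mem_nhds z₀ hε) hc)
  refine ⟨c, fun z hz => ?_⟩
  rcases le_total 0 z.im with h0 | h0
  · exact heq (hmem z hz h0)
  -- The lower half follows by reflection: F and G commute with conjugation and the coefficients c
  -- are real.
  · have hz' := conj_mem_sliceSet hz
    have h1 := heq (hmem _ hz' (by simpa using h0))
    have h2 := congrArg (starRingEnd ℂ) h1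
    simp only [hF.conj A z hz, hG.conj A z hz] at h2
    simpa using h2

/-! ### Polynomials -/

theorem toCl_slicePt_mul {J : R6} (hJ : J ∈ imagSphere) (z w : ℂ) :
    (slicePt J z).toCl * (slicePt J w).toCl = (slicePt J (z * w)).toCl := by
  have h : ∀ r : ℝ, (Cl.single ∅ r : Cl ℝ) = r • 1 := fun r => by
    rw [← Cl.single_empty_one, ← Cl.single_smul, smul_eq_mul, mul_one]
  simp only [Cl.toCl_slicePt hJ, h, add_mul, mul_add, smul_mul_assoc, mul_smul_comm, one_mul, mul_one,
    Cl.toCl_mul_self hJ, Complex.mul_re, Complex.mul_im]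
  module

theorem toCl_slicePt_pow {J : R6} (hJ : J ∈ imagSphere) (z : ℂ) (k : ℕ) :
    (slicePt J z).toCl ^ k = (slicePt J (z ^ k)).toCl := by
  induction k with
  | zero =>
    rw [pow_zero, pow_zero, Cl.toCl_slicePt hJ, Complex.one_re, Complex.one_im, zero_smul, add_zero,
      Cl.single_empty_one]
  | succ k ih => rw [pow_succ, ih, toCl_slicePt_mul hJ, pow_succ]

/-- The stem function of a polynomial. -/
noncomputable def polyStem (d : ℕ) (c : ℕ → Cl ℝ) (A : Finset (Fin 5)) (z : ℂ) : ℂ :=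
  ∑ k ∈ Finset.range d, z ^ k * ((c k).coeff A : ℂ)

theorem isStem_polyStem (U : Set R6) (d : ℕ) (c : ℕ → Cl ℝ) : IsStem U (polyStem d c) := by
  refine ⟨fun A => ?_, fun A z _ => by simp [polyStem]⟩
  have : Differentiable ℂ (polyStem d c A) := by
    unfold polyStem
    fun_prop
  exact this.differentiableOn

theorem stemRe_polyStem (d : ℕ) (c : ℕ → Cl ℝ) (z : ℂ) :
    stemRe (polyStem d c) z = ∑ k ∈ Finset.range d, (z ^ k).re • c k :=
  Cl.ext_coeff fun A => by simp [stemRe, Cl.coeff_mkCLM, polyStem, Cl.coeff_sum]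

theorem stemIm_polyStem (d : ℕ) (c : ℕ → Cl ℝ) (z : ℂ) :
    stemIm (polyStem d c) z = ∑ k ∈ Finset.range d, (z ^ k).im • c k :=
  Cl.ext_coeff fun A => by simp [stemIm, Cl.coeff_mkCLM, polyStem, Cl.coeff_sum]

theorem sum_toCl_slicePt_pow_mul {J : R6} (hJ : J ∈ imagSphere) (d : ℕ) (c : ℕ → Cl ℝ) (z : ℂ) :
    ∑ k ∈ Finset.range d, (slicePt J z).toCl ^ k * c k =
      stemRe (polyStem d c) z + J.toCl * stemIm (polyStem d c) z := by
  have h : ∀ (r : ℝ) (x : Cl ℝ), Cl.single ∅ r * x = r • x := fun r x => by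
    have : (Cl.single ∅ r : Cl ℝ) = r • 1 := by
      rw [← Cl.single_empty_one, ← Cl.single_smul, smul_eq_mul, mul_one]
    rw [this, smul_mul_assoc, one_mul]
  simp only [toCl_slicePt_pow hJ]
  simp only [Cl.toCl_slicePt hJ, add_mul, h, Finset.sum_add_distrib,
    stemRe_polyStem, stemIm_polyStem, Finset.mul_sum, mul_smul_comm, smul_mul_assoc]

theorem isLeftSlice_poly {U : Set R6} {f : R6 → Cl ℝ} {d : ℕ} {c : ℕ → Cl ℝ}
    (h : ∀ x ∈ U, f x = ∑ k ∈ Finset.range d, x.toCl ^ k * c k) :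
    IsLeftSlice U f (polyStem d c) := fun z hz J hJ => by
  rw [h _ (hz J hJ), sum_toCl_slicePt_pow_mul hJ]

/-- The inclusion of the paravectors as a continuous linear map. -/
noncomputable def R6.toClCLM : R6 →L[ℝ] Cl ℝ :=
  LinearMap.toContinuousLinearMap
    { toFun := R6.toCl
      map_add' := fun x y => Cl.ext_coeff fun A => by
        have h : ∀ i : Fin 6, (x + y) i = x i + y i := fun i => rfl
        simp only [R6.toCl, Cl.paravec, h, Cl.single_add, Finset.sum_add_distrib, Cl.coeff_add]
        ring
      map_smul' := fun r x => Cl.ext_coeff fun A => by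
        have h : ∀ i : Fin 6, (r • x) i = r • x i := fun i => rfl
        simp only [R6.toCl, Cl.paravec, h, Cl.single_smul, ← Finset.smul_sum, ← smul_add,
          RingHom.id_apply] }

theorem R6.toClCLM_apply (x : R6) : R6.toClCLM x = x.toCl := rfl

/-! ### Polynomials of low degree are annihilated. -/

/-- Affine functions. -/
def IsAffine (f : R6 → Cl ℝ) : Prop := ∃ (d : Cl ℝ) (L : R6 →L[ℝ] Cl ℝ), ∀ x, f x = d + L x

theorem pderiv6_affine (d : Cl ℝ) (L : R6 →L[ℝ] Cl ℝ) (i : Fin 6) :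
    pderiv6 i (fun x => d + L x) = fun _ => L (EuclideanSpace.single i 1) := by
  funext x
  have h : HasFDerivAt (fun x => d + L x) L x := L.hasFDerivAt.const_add d
  exact (h.hasLineDerivAt _).lineDeriv

theorem pderiv6_const (d : Cl ℝ) (i : Fin 6) : pderiv6 i (fun _ => d) = fun _ => 0 := by
  funext x
  exact ((hasFDerivAt_const d x).hasLineDerivAt _).lineDeriv

theorem diracL_const (d : Cl ℝ) : diracL (fun _ => d) = fun _ => 0 := by
  funext x
  simp [diracL, pderiv6_const]

theorem diracBarL_const (d : Cl ℝ) : diracBarL (fun _ => d) = fun _ => 0 := by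
  funext x
  simp [diracBarL, pderiv6_const]

namespace IsAffine
variable {f : R6 → Cl ℝ}

theorem diracL_diracL (h : IsAffine f) (x : R6) : diracL (diracL f) x = 0 := by
  obtain ⟨d, L, hL⟩ := h
  have : diracL f = fun _ => L (EuclideanSpace.single 0 1) +
      ∑ i : Fin 5, Cl.e i * L (EuclideanSpace.single i.succ 1) := by
    funext x
    rw [funext hL, diracL]
    simp only [pderiv6_affine]
  rw [this, diracL_const]

theorem diracBarL_diracBarL (h : IsAffine f) (x : R6) : diracBarL (diracBarL f) x = 0 := by
  obtain ⟨d, L, hL⟩ := h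
  have : diracBarL f = fun _ => L (EuclideanSpace.single 0 1) -
      ∑ i : Fin 5, Cl.e i * L (EuclideanSpace.single i.succ 1) := by
    funext x
    rw [funext hL, diracBarL]
    simp only [pderiv6_affine]
  rw [this, diracBarL_const]

theorem laplacian (h : IsAffine f) (x : R6) : Laplacian.laplacian f x = 0 := by
  obtain ⟨d, L, hL⟩ := h
  rw [funext hL, laplacian_eq_sum_pderiv6 (contDiffAt_const.add L.contDiff.contDiffAt)]
  simp only [pderiv6_affine, pderiv6_const, Finset.sum_const_zero]

theorem poly_two (c₀ c₁ : Cl ℝ) : IsAffine fun x => c₀ + x.toCl * c₁ :=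
  ⟨c₀, (ContinuousLinearMap.mul ℝ (Cl ℝ)).flip c₁ ∘L R6.toClCLM, fun _ => rfl⟩

end IsAffine

/-- The derivative of x² in the direction s is s x + x s. The factors need not commute, but this is
still linear in x. -/
theorem pderiv6_poly_three (c₀ c₁ c₂ : Cl ℝ) (i : Fin 6) :
    IsAffine (pderiv6 i fun x => c₀ + x.toCl * c₁ + x.toCl * x.toCl * c₂) := by
  set M := ContinuousLinearMap.mul ℝ (Cl ℝ)
  set s : Cl ℝ := R6.toCl (EuclideanSpace.single i (1 : ℝ))
  refine ⟨s * c₁, M.flip c₂ ∘L (M s + M.flip s) ∘L R6.toClCLM, fun x => ?_⟩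
  have h1 : HasFDerivAt R6.toCl R6.toClCLM x := R6.toClCLM.hasFDerivAt
  have h2 := ((h1.mul_const' c₁).const_add c₀).add ((h1.mul' h1).mul_const' c₂)
  have h3 : HasFDerivAt (fun x : R6 => c₀ + x.toCl * c₁ + x.toCl * x.toCl * c₂) _ x := h2
  refine (h3.hasLineDerivAt _).lineDeriv.trans ?_
  simp [M, R6.toClCLM_apply, s, add_comm]

theorem isAffine_diracL_poly_three (c₀ c₁ c₂ : Cl ℝ) :
    IsAffine (diracL fun x => c₀ + x.toCl * c₁ + x.toCl * x.toCl * c₂) := by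
  choose d L hL using pderiv6_poly_three c₀ c₁ c₂
  refine ⟨d 0 + ∑ i : Fin 5, Cl.e i * d i.succ,
    L 0 + ∑ i : Fin 5, ContinuousLinearMap.mul ℝ (Cl ℝ) (Cl.e i) ∘L L i.succ, fun x => ?_⟩
  simp only [diracL, hL, mul_add, Finset.sum_add_distrib, add_apply,
    _root_.sum_apply, ContinuousLinearMap.comp_apply, ContinuousLinearMap.mul_apply']
  abel

theorem isAffine_diracBarL_poly_three (c₀ c₁ c₂ : Cl ℝ) :
    IsAffine (diracBarL fun x => c₀ + x.toCl * c₁ + x.toCl * x.toCl * c₂) := by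
  choose d L hL using pderiv6_poly_three c₀ c₁ c₂
  refine ⟨d 0 - ∑ i : Fin 5, Cl.e i * d i.succ,
    L 0 - ∑ i : Fin 5, ContinuousLinearMap.mul ℝ (Cl ℝ) (Cl.e i) ∘L L i.succ, fun x => ?_⟩
  simp only [diracBarL, hL, mul_add, Finset.sum_add_distrib, sub_apply,
    _root_.sum_apply, ContinuousLinearMap.comp_apply, ContinuousLinearMap.mul_apply']
  abel

/-- Only constants, affine functions and quadratic polynomials occur. A first-order operator kills
the constants and sends quadratic polynomials to affine functions, and the operators of order two
kill affine functions. -/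
theorem FineOp.applyL_poly (P : FineOp) (c : ℕ → Cl ℝ) (x : R6) :
    P.applyL (fun x => ∑ k ∈ Finset.range P.degree, x.toCl ^ k * c k) x = 0 := by
  have h1 : (fun x : R6 => ∑ k ∈ Finset.range 1, x.toCl ^ k * c k) = fun _ => c 0 := by
    funext x; simp
  have h2 : (fun x : R6 => ∑ k ∈ Finset.range 2, x.toCl ^ k * c k) =
      fun x => c 0 + x.toCl * c 1 := by
    funext x; simp [Finset.sum_range_succ]
  have h3 : (fun x : R6 => ∑ k ∈ Finset.range 3, x.toCl ^ k * c k) =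
      fun x => c 0 + x.toCl * c 1 + x.toCl * x.toCl * c 2 := by
    funext x; simp [Finset.sum_range_succ, sq]
  cases P with
  | dirac => simp only [degree, h1, applyL, diracL_const]
  | diracBar => simp only [degree, h1, applyL, diracBarL_const]
  | diracSq => simp only [degree, h2, applyL, (IsAffine.poly_two _ _).diracL_diracL]
  | diracBarSq => simp only [degree, h2, applyL, (IsAffine.poly_two _ _).diracBarL_diracBarL]
  | lap => simp only [degree, h2, applyL, (IsAffine.poly_two _ _).laplacian]
  | lapDirac => simp only [degree, h3, applyL, (isAffine_diracL_poly_three _ _ _).laplacian]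
  | lapDiracBar => simp only [degree, h3, applyL, (isAffine_diracBarL_poly_three _ _ _).laplacian]

theorem diracL_congr {f g : R6 → Cl ℝ} {x : R6} (h : f =ᶠ[𝓝 x] g) : diracL f =ᶠ[𝓝 x] diracL g := by
  filter_upwards [eventually_eventually_nhds.mpr h] with y hy
  simp only [diracL, pderiv6_congr hy]

theorem diracBarL_congr {f g : R6 → Cl ℝ} {x : R6} (h : f =ᶠ[𝓝 x] g) :
    diracBarL f =ᶠ[𝓝 x] diracBarL g := by
  filter_upwards [eventually_eventually_nhds.mpr h] with y hy
  simp only [diracBarL, pderiv6_congr hy]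

theorem FineOp.applyL_congr (P : FineOp) {f g : R6 → Cl ℝ} {x : R6} (h : f =ᶠ[𝓝 x] g) :
    P.applyL f x = P.applyL g x := by
  cases P with
  | dirac => exact (diracL_congr h).eq_of_nhds
  | diracBar => exact (diracBarL_congr h).eq_of_nhds
  | diracSq => exact (diracL_congr (diracL_congr h)).eq_of_nhds
  | diracBarSq => exact (diracBarL_congr (diracBarL_congr h)).eq_of_nhds
  | lap => exact (InnerProductSpace.laplacian_congr_nhds h).eq_of_nhds
  | lapDirac => exact (InnerProductSpace.laplacian_congr_nhds (diracL_congr h)).eq_of_nhds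
  | lapDiracBar => exact (InnerProductSpace.laplacian_congr_nhds (diracBarL_congr h)).eq_of_nhds

theorem SHL.exists_stem {U : Set R6} {f : R6 → Cl ℝ} (h : f ∈ SHL U) :
    ∃ F, IsStem U F ∧ IsLeftSlice U f F := by
  obtain ⟨α, β, hp, hf⟩ := h
  obtain ⟨F, hF, rfl, rfl⟩ := hp.exists_isStem
  exact ⟨F, hF, hf⟩

/-- Every degree is at least 1, so the truncated subtraction loses nothing. -/
theorem FineOp.degree_sub_add (P : FineOp) : P.degree - 1 + 1 = P.degree := by
  cases P <;> rfl

theorem FineOp.kerL_eq (P : FineOp) {U : Set R6} (hU : IsOpen U) (hs : IsAxiallySymmetric U)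
    (hconn : IsConnected U) : P.kerL U = {f | ∃ α : ℕ → Cl ℝ, ∀ x ∈ U,
      f x = ∑ k ∈ Finset.range P.degree, x.toCl ^ k * α k} := by
  refine Set.ext fun f => ⟨fun ⟨hf, hz⟩ => ?_, fun ⟨c, hc⟩ => ⟨?_, fun x hx => ?_⟩⟩
  · obtain ⟨F, hF, hfF⟩ := SHL.exists_stem hf
    -- The kernel is the case g = 0 of the comparison of two functions with equal image; the zero
    -- function is presented as the polynomial with zero coefficients.
    have h0 : IsLeftSlice U (fun _ => 0) (polyStem P.degree fun _ => 0) :=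
      isLeftSlice_poly fun x _ => by simp
    have hP0 : ∀ x, P.applyL (fun _ => 0) x = 0 := fun x => by
      simpa using P.applyL_poly (fun _ => 0) x
    choose c hc using exists_polynomial_eq_sub hU hs hconn hF (isStem_polyStem U _ _) hfF h0 P
      fun x hx => (hz x hx).trans (hP0 x).symm
    refine ⟨fun k => ⟨fun A => c A k⟩, fun x hx => ?_⟩
    obtain ⟨J, hJ, hxJ⟩ := exists_slicePt_halfPt x
    have hm := halfPt_mem_sliceSet hs hx
    have hFp : ∀ A, F A x.halfPt = polyStem P.degree (fun k => ⟨fun A => c A k⟩) A x.halfPt :=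
      fun A => by
        have := hc A _ hm
        simpa [polyStem] using this
    rw [← hxJ, hfF _ hm J hJ, sum_toCl_slicePt_pow_mul hJ]
    simp only [stemRe, stemIm, hFp]
  · exact ⟨_, _, (isStem_polyStem U _ c).isSlicePair hU hs, isLeftSlice_poly hc⟩
  · rw [P.applyL_congr (eventually_of_mem (hU.mem_nhds hx) hc), P.applyL_poly]

/-! ### Reversion -/

namespace Cl

/-- The sign of `e_A` under the reversion. -/
def revSign (A : Finset (Fin 5)) : ℤ := sign A A * ∏ _a ∈ A, -1

theorem sign_mul_self (A B : Finset (Fin 5)) : sign A B * sign A B = 1 := by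
  rw [← sign_symmDiff_right, symmDiff_self]
  exact sign_empty_right A

theorem revSign_mul_self (A : Finset (Fin 5)) : revSign A * revSign A = 1 := by
  have h : (∏ _a ∈ A, (-1 : ℤ)) * ∏ _a ∈ A, -1 = 1 := by
    rw [← Finset.prod_mul_distrib]; simp
  rw [revSign]
  linear_combination (∏ _a ∈ A, (-1 : ℤ)) * (∏ _a ∈ A, (-1 : ℤ)) * sign_mul_self A A + h

/-- `sign` is multiplicative in each argument under symmetric difference, so the sign of A ∆ B
against itself splits into four factors. The two mixed ones record the cost of exchanging e_A and
e_B, which is what makes the reversion reverse products. -/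
theorem revSign_symmDiff (A B : Finset (Fin 5)) :
    revSign (symmDiff A B) = revSign A * revSign B * sign A B * sign B A := by
  rw [revSign, sign_symmDiff_left, sign_symmDiff_right, sign_symmDiff_right,
    prod_symmDiff (fun _ => -1) (fun _ => by norm_num), revSign, revSign]
  ring

instance instFiniteDimensional : FiniteDimensional ℝ (Cl ℝ) :=
  Module.Finite.of_surjective
    ({ toFun := Cl.mk
       map_add' := fun _ _ => rfl
       map_smul' := fun _ _ => rfl } : (Finset (Fin 5) → ℝ) →ₗ[ℝ] Cl ℝ) fun x => ⟨x.coeff, rfl⟩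

/-- The reversion, the linear map that reverses products. -/
noncomputable def rev : Cl ℝ ≃L[ℝ] Cl ℝ :=
  LinearEquiv.toContinuousLinearEquiv
    { toFun := fun x => ⟨fun A => revSign A • x.coeff A⟩
      invFun := fun x => ⟨fun A => revSign A • x.coeff A⟩
      map_add' := fun x y => ext_coeff fun A => smul_add _ _ _
      map_smul' := fun r x => ext_coeff fun A => smul_comm _ _ _
      left_inv := fun x => ext_coeff fun A => by simp only [smul_smul, revSign_mul_self, one_smul]
      right_inv := fun x => ext_coeff fun A => by simp only [smul_smul, revSign_mul_self, one_smul] }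

theorem coeff_rev (x : Cl ℝ) (A : Finset (Fin 5)) : (rev x).coeff A = revSign A • x.coeff A := rfl

theorem rev_rev (x : Cl ℝ) : rev (rev x) = x :=
  ext_coeff fun A => by simp only [coeff_rev, smul_smul, revSign_mul_self, one_smul]

theorem rev_single (A : Finset (Fin 5)) (r : ℝ) : rev (single A r) = single A (revSign A • r) := by
  refine ext_coeff fun C => ?_
  by_cases h : C = A <;> simp [coeff_rev, h]

theorem rev_mul (x y : Cl ℝ) : rev (x * y) = rev y * rev x := by
  rw [← sum_single x, ← sum_single y]
  simp only [Finset.sum_mul_sum, map_sum]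
  rw [Finset.sum_comm]
  refine Finset.sum_congr rfl fun B _ => Finset.sum_congr rfl fun A _ => ?_
  rw [single_mul_single, rev_single, rev_single, rev_single, single_mul_single, symmDiff_comm B A,
    revSign_symmDiff, smul_smul, smul_mul_smul_comm, smul_smul]
  congr 1
  rw [mul_comm (y.coeff B)]
  congr 1
  linear_combination (revSign A * revSign B * sign B A) * sign_mul_self A B

theorem rev_one : rev 1 = 1 := by
  rw [← single_empty_one, rev_single]
  simp [revSign, sign]

theorem rev_e (i : Fin 5) : rev (e i) = e i := by
  rw [e, rev_single]
  simp [revSign, sign]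

theorem rev_toCl (x : R6) : rev x.toCl = x.toCl := by
  simp only [R6.toCl, paravec, map_add, map_sum, rev_single]
  simp [revSign, sign]

theorem rev_toCl_pow (x : R6) (k : ℕ) : rev (x.toCl ^ k) = x.toCl ^ k := by
  induction k with
  | zero => rw [pow_zero, rev_one]
  | succ k ih => rw [pow_succ, rev_mul, ih, rev_toCl, ← pow_succ', pow_succ]

end Cl

/-- No differentiability is required: the reversion is a continuous linear equivalence, so it
commutes with `fderiv` even where that takes its default value. -/
theorem pderiv6_rev_comp (f : R6 → Cl ℝ) (i : Fin 6) :
    pderiv6 i (fun x => Cl.rev (f x)) = fun x => Cl.rev (pderiv6 i f x) := by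
  funext x
  unfold pderiv6 lineDeriv
  have h := Cl.rev.comp_fderiv (f := fun t : ℝ => f (x + t • EuclideanSpace.single i 1)) (x := 0)
  have h' := congrArg (fun L => L 1) h
  simpa [Function.comp_def] using h'

theorem diracL_rev_comp (f : R6 → Cl ℝ) :
    diracL (fun x => Cl.rev (f x)) = fun x => Cl.rev (diracR f x) := by
  funext x
  simp only [diracL, diracR, pderiv6_rev_comp, map_add, map_sum, Cl.rev_mul, Cl.rev_e]

theorem diracBarL_rev_comp (f : R6 → Cl ℝ) :
    diracBarL (fun x => Cl.rev (f x)) = fun x => Cl.rev (diracBarR f x) := by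
  funext x
  simp only [diracBarL, diracBarR, pderiv6_rev_comp, map_sub, map_sum, Cl.rev_mul, Cl.rev_e]

theorem laplacian_rev_comp (f : R6 → Cl ℝ) :
    Laplacian.laplacian (fun x => Cl.rev (f x)) = fun x => Cl.rev (Laplacian.laplacian f x) :=
  InnerProductSpace.laplacian_CLE_comp_left (l := Cl.rev) (f := f)

theorem FineOp.applyL_rev_comp (P : FineOp) (f : R6 → Cl ℝ) (x : R6) :
    P.applyL (fun x => Cl.rev (f x)) x = Cl.rev (P.applyR f x) := by
  cases P <;> simp only [applyL, applyR, diracL_rev_comp, diracBarL_rev_comp, laplacian_rev_comp]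

/-- `f` is the right slice function with the stem function `F`. -/
def IsRightSlice (U : Set R6) (f : R6 → Cl ℝ) (F : Finset (Fin 5) → ℂ → ℂ) : Prop :=
  ∀ z ∈ sliceSet U, ∀ J ∈ imagSphere, f (slicePt J z) = stemRe F z + stemIm F z * J.toCl

theorem SHR.exists_stem {U : Set R6} {f : R6 → Cl ℝ} (h : f ∈ SHR U) :
    ∃ F, IsStem U F ∧ IsRightSlice U f F := by
  obtain ⟨α, β, hp, hf⟩ := h
  obtain ⟨F, hF, rfl, rfl⟩ := hp.exists_isStem
  exact ⟨F, hF, hf⟩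

/-- The reversion of a stem function. -/
noncomputable def revStem (F : Finset (Fin 5) → ℂ → ℂ) (A : Finset (Fin 5)) (z : ℂ) : ℂ :=
  (Cl.revSign A : ℂ) * F A z

theorem IsStem.revStem {U : Set R6} {F : Finset (Fin 5) → ℂ → ℂ} (h : IsStem U F) :
    IsStem U (revStem F) :=
  ⟨fun A => (h.differentiableOn A).const_mul _,
    fun A z hz => by simp [_root_.revStem, h.conj A z hz]⟩

theorem stemRe_revStem (F : Finset (Fin 5) → ℂ → ℂ) (z : ℂ) :
    stemRe (revStem F) z = Cl.rev (stemRe F z) :=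
  Cl.ext_coeff fun A => by simp [stemRe, revStem, Cl.coeff_rev, Cl.coeff_mkCLM]

theorem stemIm_revStem (F : Finset (Fin 5) → ℂ → ℂ) (z : ℂ) :
    stemIm (revStem F) z = Cl.rev (stemIm F z) :=
  Cl.ext_coeff fun A => by simp [stemIm, revStem, Cl.coeff_rev, Cl.coeff_mkCLM]

/-- The reversion fixes J and moves it to the other side of the imaginary part. On the stem function
it only multiplies each coefficient by a sign, so all right-sided assertions reduce to left-sided
ones. -/
theorem IsRightSlice.rev_comp {U : Set R6} {f : R6 → Cl ℝ} {F : Finset (Fin 5) → ℂ → ℂ}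
    (h : IsRightSlice U f F) : IsLeftSlice U (fun x => Cl.rev (f x)) (revStem F) :=
  fun z hz J hJ => by
    change Cl.rev (f (slicePt J z)) = _
    rw [h z hz J hJ, map_add, Cl.rev_mul, Cl.rev_toCl, stemRe_revStem, stemIm_revStem]

theorem IsLeftSlice.rev_comp {U : Set R6} {f : R6 → Cl ℝ} {F : Finset (Fin 5) → ℂ → ℂ}
    (h : IsLeftSlice U f F) : IsRightSlice U (fun x => Cl.rev (f x)) (revStem F) :=
  fun z hz J hJ => by
    change Cl.rev (f (slicePt J z)) = _
    rw [h z hz J hJ, map_add, Cl.rev_mul, Cl.rev_toCl, stemRe_revStem, stemIm_revStem]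

theorem mem_SHR_iff {U : Set R6} (hU : IsOpen U) (hs : IsAxiallySymmetric U) {f : R6 → Cl ℝ} :
    f ∈ SHR U ↔ (fun x => Cl.rev (f x)) ∈ SHL U := by
  constructor
  · intro h
    obtain ⟨F, hF, hf⟩ := SHR.exists_stem h
    exact ⟨_, _, hF.revStem.isSlicePair hU hs, hf.rev_comp⟩
  · intro h
    obtain ⟨F, hF, hf⟩ := SHL.exists_stem h
    have := hf.rev_comp
    simp only [Cl.rev_rev] at this
    exact ⟨_, _, hF.revStem.isSlicePair hU hs, this⟩

theorem FineOp.kerR_eq (P : FineOp) {U : Set R6} (hU : IsOpen U) (hs : IsAxiallySymmetric U)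
    (hconn : IsConnected U) : P.kerR U = {f | ∃ α : ℕ → Cl ℝ, ∀ x ∈ U,
      f x = ∑ k ∈ Finset.range P.degree, α k * x.toCl ^ k} := by
  refine Set.ext fun f => ?_
  have h1 : f ∈ P.kerR U ↔ (fun x => Cl.rev (f x)) ∈ P.kerL U := by
    refine and_congr (mem_SHR_iff hU hs) (forall₂_congr fun x _ => ?_)
    rw [P.applyL_rev_comp, map_eq_zero_iff _ Cl.rev.injective]
  rw [h1, P.kerL_eq hU hs hconn]
  constructor
  · rintro ⟨c, hc⟩
    refine ⟨fun k => Cl.rev (c k), fun x hx => ?_⟩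
    have h := hc x hx
    change Cl.rev (f x) = _ at h
    rw [← Cl.rev_rev (f x), h, map_sum]
    simp only [Cl.rev_mul, Cl.rev_toCl_pow]
  · rintro ⟨c, hc⟩
    refine ⟨fun k => Cl.rev (c k), fun x hx => ?_⟩
    change Cl.rev (f x) = _
    rw [hc x hx, map_sum]
    simp only [Cl.rev_mul, Cl.rev_toCl_pow]

theorem exists_polynomial_eq_sub_right {U : Set R6} (hU : IsOpen U) (hs : IsAxiallySymmetric U)
    (hconn : IsConnected U) {f g : R6 → Cl ℝ} {F G : Finset (Fin 5) → ℂ → ℂ} (hF : IsStem U F)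
    (hG : IsStem U G) (hf : IsRightSlice U f F) (hg : IsRightSlice U g G) (P : FineOp)
    (hP : ∀ x ∈ U, P.applyR f x = P.applyR g x) (A : Finset (Fin 5)) :
    ∃ c : ℕ → ℝ, ∀ z ∈ sliceSet U, F A z - G A z = ∑ k ∈ Finset.range P.degree, z ^ k * c k := by
  obtain ⟨c, hc⟩ := exists_polynomial_eq_sub hU hs hconn hF.revStem hG.revStem hf.rev_comp
    hg.rev_comp P (fun x hx => by rw [P.applyL_rev_comp, P.applyL_rev_comp, hP x hx]) A
  refine ⟨fun k => Cl.revSign A * c k, fun z hz => ?_⟩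
  have h := congrArg (fun w => (Cl.revSign A : ℂ) * w) (hc z hz)
  have h1 : (Cl.revSign A : ℂ) * Cl.revSign A = 1 := by
    exact_mod_cast congrArg (Int.cast : ℤ → ℂ) (Cl.revSign_mul_self A)
  simp only [revStem, Finset.mul_sum] at h
  calc F A z - G A z = (Cl.revSign A : ℂ) * (Cl.revSign A * F A z - Cl.revSign A * G A z) := by
        linear_combination (G A z - F A z) * h1
    _ = _ := by
        rw [h]
        refine Finset.sum_congr rfl fun k _ => ?_
        push_cast
        ring

/-! ### Operator-valued stem functions -/

namespace Cl
section conj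
variable {𝒜 : Type*} [Ring 𝒜]

/-- The conjugate `a - b e` of `a + b e`. -/
def cxConj (x : Cl 𝒜) : Cl 𝒜 := cx (x.coeff ∅) (-x.coeff {0})

theorem cxConj_cx (a b : 𝒜) : cxConj (cx a b) = cx a (-b) := by
  rw [cxConj, coeff_cx_empty, coeff_cx_singleton]

theorem cxConj_add (x y : Cl 𝒜) : cxConj (x + y) = cxConj x + cxConj y := by
  simp only [cxConj, coeff_add, cx_add, neg_add]

theorem cxConj_mul {x y : Cl 𝒜} (hx : IsCx x) (hy : IsCx y) :
    cxConj (x * y) = cxConj x * cxConj y := by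
  obtain ⟨a, b, rfl⟩ := hx.exists_cx
  obtain ⟨c, d, rfl⟩ := hy.exists_cx
  simp only [cx_mul, cxConj_cx, mul_neg, neg_mul, neg_add, neg_neg]

theorem cxConj_one : cxConj (1 : Cl 𝒜) = 1 := by
  rw [← cx_one, cxConj_cx, neg_zero]

variable [Algebra ℝ 𝒜]

theorem cxConj_smul (r : ℝ) (x : Cl 𝒜) : cxConj (r • x) = r • cxConj x := by
  simp only [cxConj, coeff_smul, cx_smul, smul_neg]

theorem cxConj_hat (z : ℂ) : cxConj (hat 𝒜 z) = hat 𝒜 ((starRingEnd ℂ) z) := by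
  rw [hat, cxConj_cx, hat, Complex.conj_re, Complex.conj_im, map_neg]

theorem hat_eq_smul (z : ℂ) : hat 𝒜 z = z.re • 1 + z.im • e 0 := by
  rw [hat, cx, Algebra.algebraMap_eq_smul_one, Algebra.algebraMap_eq_smul_one, single_smul,
    single_smul, single_empty_one, e]

/-- The imaginary unit `e` of the first slice. -/
noncomputable def firstUnit : R6 := EuclideanSpace.single 1 1

theorem firstUnit_mem : firstUnit ∈ imagSphere :=
  ⟨by simp [firstUnit], by simp [firstUnit]⟩

theorem ofRealHom_firstUnit : ofRealHom 𝒜 firstUnit.toCl = single {0} 1 := by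
  have h : firstUnit.toCl = single {0} 1 := by
    have h0 : firstUnit 0 = 0 := firstUnit_mem.1
    have h1 : ∀ i : Fin 5, firstUnit i.succ = if i = 0 then 1 else 0 := fun i => by
      rw [firstUnit, PiLp.single_apply]
      exact if_congr (Fin.succ_inj (b := 0)) rfl rfl
    rw [R6.toCl, paravec, h0, single_zero, zero_add, Finset.sum_eq_single 0]
    · rw [h1, if_pos rfl]
    · intro i _ hi
      rw [h1, if_neg hi, single_zero]
    · exact fun h => absurd (Finset.mem_univ _) h
  rw [h, ofRealHom_single, map_one]

theorem IsCx.subst_firstUnit {x : Cl 𝒜} (hx : IsCx x) : subst firstUnit x = x := by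
  conv_rhs => rw [hx]
  rw [subst, ofRealHom_firstUnit, single_empty_mul_single, mul_one, cx]

end conj

section normed
variable {𝒜 : Type*} [NormedRing 𝒜] [NormedAlgebra ℝ 𝒜]

/-- `hat` as a continuous linear map. -/
noncomputable def hatCLM (𝒜 : Type*) [NormedRing 𝒜] [NormedAlgebra ℝ 𝒜] : ℂ →L[ℝ] Cl 𝒜 :=
  Complex.reCLM.smulRight (1 : Cl 𝒜) + Complex.imCLM.smulRight (e 0 : Cl 𝒜)

theorem hatCLM_apply (z : ℂ) : hatCLM 𝒜 z = hat 𝒜 z := by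
  rw [hat_eq_smul]; rfl

/-- Left multiplication of `d` by `hat w`, as a function of `w`. -/
noncomputable def hatMulCLM (d : Cl 𝒜) : ℂ →L[ℝ] Cl 𝒜 :=
  (ContinuousLinearMap.mul ℝ (Cl 𝒜)).flip d ∘L hatCLM 𝒜

theorem hatMulCLM_apply (d : Cl 𝒜) (w : ℂ) : hatMulCLM d w = hat 𝒜 w * d := by
  rw [hatMulCLM, ContinuousLinearMap.comp_apply, hatCLM_apply]; rfl

end normed
end Cl

section stem
variable {𝒜 : Type*} [NormedRing 𝒜] [NormedAlgebra ℝ 𝒜]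

open Cl

/-- Holomorphic functions off `K` with values in the elements `a + b e`, compatible with the
conjugations and of order `m` at infinity. -/
structure IsOpStem (K : Set ℂ) (m : ℤ) (h : ℂ → Cl 𝒜) : Prop where
  isCx : ∀ z ∉ K, IsCx (h z)
  hasFDerivAt : ∀ z ∉ K, ∃ d, HasFDerivAt h (hatMulCLM d) z
  conj : ∀ z ∉ K, h ((starRingEnd ℂ) z) = cxConj (h z)
  isBigO : h =O[Bornology.cobounded ℂ] fun z => ‖z‖ ^ m

theorem eventually_ne_zero_cobounded : ∀ᶠ z : ℂ in Bornology.cobounded ℂ, z ≠ 0 := by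
  filter_upwards [tendsto_norm_cobounded_atTop.eventually_gt_atTop 0] with z hz
  exact norm_pos_iff.mp hz

namespace IsOpStem
variable {K : Set ℂ} {m m' : ℤ} {h h' : ℂ → Cl 𝒜}

theorem mono (hh : IsOpStem K m h) (hm : m ≤ m') : IsOpStem K m' h where
  isCx := hh.isCx
  hasFDerivAt := hh.hasFDerivAt
  conj := hh.conj
  isBigO := hh.isBigO.trans <| by
    refine Asymptotics.IsBigO.of_bound 1 ?_
    filter_upwards [tendsto_norm_cobounded_atTop.eventually_ge_atTop 1] with z hz
    rw [one_mul, Real.norm_of_nonneg (by positivity), Real.norm_of_nonneg (by positivity)]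
    exact zpow_le_zpow_right₀ hz hm

theorem add (hh : IsOpStem K m h) (hh' : IsOpStem K m h') :
    IsOpStem K m fun z => h z + h' z where
  isCx z hz := (hh.isCx z hz).add (hh'.isCx z hz)
  hasFDerivAt z hz := by
    obtain ⟨d, hd⟩ := hh.hasFDerivAt z hz
    obtain ⟨d', hd'⟩ := hh'.hasFDerivAt z hz
    refine ⟨d + d', (hd.add hd').congr_fderiv ?_⟩
    ext1 w
    simp only [add_apply, hatMulCLM_apply, mul_add]
  conj z hz := by rw [hh.conj z hz, hh'.conj z hz, cxConj_add]
  isBigO := hh.isBigO.add hh'.isBigO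

theorem smul (hh : IsOpStem K m h) (r : ℝ) : IsOpStem K m fun z => r • h z where
  isCx z hz := (hh.isCx z hz).smul r
  hasFDerivAt z hz := by
    obtain ⟨d, hd⟩ := hh.hasFDerivAt z hz
    refine ⟨r • d, (hd.const_smul r).congr_fderiv ?_⟩
    ext1 w
    simp only [smul_apply, hatMulCLM_apply, mul_smul_comm]
  conj z hz := by rw [hh.conj z hz, cxConj_smul]
  isBigO := hh.isBigO.const_smul_left r

theorem mul (hh : IsOpStem K m h) (hh' : IsOpStem K m' h') :
    IsOpStem K (m + m') fun z => h z * h' z where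
  isCx z hz := (hh.isCx z hz).mul (hh'.isCx z hz)
  hasFDerivAt z hz := by
    obtain ⟨d, hd⟩ := hh.hasFDerivAt z hz
    obtain ⟨d', hd'⟩ := hh'.hasFDerivAt z hz
    refine ⟨h z * d' + d * h' z, (hd.mul' hd').congr_fderiv ?_⟩
    ext1 w
    -- In the product rule the increment `hat w` has to pass h z to reach the far left. This is
    -- possible because `hat w` has real coefficients and h z lies in the model slice.
    have hc := (hh.isCx z hz).hat_mul_comm w
    simp only [add_apply, smul_apply, hatMulCLM_apply, mul_add, ← mul_assoc, hc, smul_eq_mul,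
      MulOpposite.smul_eq_mul_unop, MulOpposite.unop_op]
  conj z hz := by
    rw [hh.conj z hz, hh'.conj z hz, cxConj_mul (hh.isCx z hz) (hh'.isCx z hz)]
  isBigO := (hh.isBigO.mul hh'.isBigO).congr' EventuallyEq.rfl <| by
    filter_upwards [eventually_ne_zero_cobounded] with z hz
    rw [zpow_add₀ (norm_ne_zero_iff.mpr hz)]

theorem hat (K : Set ℂ) : IsOpStem K 1 (Cl.hat 𝒜) where
  isCx z _ := isCx_hat z
  hasFDerivAt z _ := by
    refine ⟨1, ?_⟩
    have h1 : Cl.hat 𝒜 = hatCLM 𝒜 := funext fun w => (hatCLM_apply w).symm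
    rw [h1]
    refine (hatCLM 𝒜).hasFDerivAt.congr_fderiv ?_
    ext1 w
    rw [hatMulCLM_apply, hatCLM_apply, mul_one]
  conj z _ := (cxConj_hat z).symm
  isBigO := by
    have h1 : Cl.hat 𝒜 = hatCLM 𝒜 := funext fun w => (hatCLM_apply w).symm
    simp only [zpow_one, h1]
    exact ((hatCLM 𝒜).isBigO_id _).norm_right

theorem const (K : Set ℂ) (a : 𝒜) : IsOpStem K 0 fun _ => single ∅ a where
  isCx z _ := by
    have : single ∅ a = cx a 0 := by rw [cx, single_zero, add_zero]
    rw [this]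
    exact isCx_cx _ _
  hasFDerivAt z _ := by
    refine ⟨0, (hasFDerivAt_const _ _).congr_fderiv ?_⟩
    ext1 w
    rw [hatMulCLM_apply, mul_zero, zero_apply]
  conj z _ := by
    have : single ∅ a = cx a 0 := by rw [cx, single_zero, add_zero]
    rw [this, cxConj_cx, neg_zero]
  isBigO := by
    simp only [zpow_zero]
    exact Asymptotics.isBigO_const_const _ one_ne_zero _

/-- The derivative of inversion, -h⁻¹ (·) h⁻¹, keeps the required form because h⁻¹ again lies in the
model slice. At infinity h is normalised by z⁻², where it tends to 1; inversion is continuous at 1,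
so the normalised inverse is bounded and the factor z⁻² gives the order -2. -/
theorem inverse [CompleteSpace 𝒜] (hh : IsOpStem ∅ 2 h)
    (h1 : Tendsto (fun z => Cl.hat 𝒜 (z⁻¹ ^ 2) * h z) (Bornology.cobounded ℂ) (𝓝 1)) :
    IsOpStem {z | ¬ IsUnit (h z)} (-2) fun z => Ring.inverse (h z) where
  isCx z hz := by
    have hu : IsUnit (h z) := not_not.mp hz
    exact (hh.isCx z (notMem_empty z)).of_mul_eq_one (Ring.mul_inverse_cancel _ hu)
      (Ring.inverse_mul_cancel _ hu)
  hasFDerivAt z hz := by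
    obtain ⟨u, hu⟩ : IsUnit (h z) := not_not.mp hz
    obtain ⟨d, hd⟩ := hh.hasFDerivAt z (notMem_empty z)
    have hi := hasFDerivAt_ringInverse (𝕜 := ℝ) u
    rw [hu] at hi
    have hcx : IsCx (↑u⁻¹ : Cl 𝒜) := (hh.isCx z (notMem_empty z)).of_mul_eq_one
      (by rw [← hu, u.mul_inv]) (by rw [← hu, u.inv_mul])
    refine ⟨-(↑u⁻¹ * d * ↑u⁻¹), (hi.comp z hd).congr_fderiv ?_⟩
    ext1 w
    simp only [ContinuousLinearMap.comp_apply, neg_apply, ContinuousLinearMap.mulLeftRight_apply,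
      hatMulCLM_apply, mul_neg, ← mul_assoc, hcx.hat_mul_comm w]
  conj z hz := by
    have hu : IsUnit (h z) := not_not.mp hz
    have hcx := hh.isCx z (notMem_empty z)
    have hcx' : IsCx (Ring.inverse (h z)) := hcx.of_mul_eq_one (Ring.mul_inverse_cancel _ hu)
      (Ring.inverse_mul_cancel _ hu)
    have hc := hh.conj z (notMem_empty z)
    have e1 : h ((starRingEnd ℂ) z) * cxConj (Ring.inverse (h z)) = 1 := by
      rw [hc, ← cxConj_mul hcx hcx', Ring.mul_inverse_cancel _ hu, cxConj_one]
    have e2 : cxConj (Ring.inverse (h z)) * h ((starRingEnd ℂ) z) = 1 := by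
      rw [hc, ← cxConj_mul hcx' hcx, Ring.inverse_mul_cancel _ hu, cxConj_one]
    exact Ring.inverse_unit ⟨_, _, e1, e2⟩
  isBigO := by
    have hc : ContinuousAt Ring.inverse (1 : Cl 𝒜) := NormedRing.inverse_continuousAt (1 : (Cl 𝒜)ˣ)
    have hO := (hc.tendsto.comp h1).isBigO_one ℝ
    have hO2 : (fun z : ℂ => Cl.hat 𝒜 (z⁻¹ ^ 2)) =O[Bornology.cobounded ℂ]
        fun z => ‖z‖ ^ (-2 : ℤ) := by
      have h2 : Cl.hat 𝒜 = hatCLM 𝒜 := funext fun w => (hatCLM_apply w).symm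
      rw [h2]
      refine (((hatCLM 𝒜).isBigO_comp (fun z : ℂ => z⁻¹ ^ 2) _).norm_right).congr_right fun z => ?_
      rw [norm_pow, norm_inv, zpow_neg, inv_pow]
      norm_cast
    refine (hO.mul hO2).congr' ?_ (by simp)
    filter_upwards [eventually_ne_zero_cobounded] with z hz
    have hu1 : Cl.hat 𝒜 (z⁻¹ ^ 2) * Cl.hat 𝒜 (z ^ 2) = 1 := by
      rw [← hat_mul, inv_pow, inv_mul_cancel₀ (pow_ne_zero 2 hz), hat_one]
    have hu2 : Cl.hat 𝒜 (z ^ 2) * Cl.hat 𝒜 (z⁻¹ ^ 2) = 1 := by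
      rw [← hat_mul, inv_pow, mul_inv_cancel₀ (pow_ne_zero 2 hz), hat_one]
    set u : (Cl 𝒜)ˣ := ⟨_, _, hu1, hu2⟩
    change Ring.inverse (↑u * h z) * ↑u = _
    -- At a non-invertible value both sides are the default 0 of `Ring.inverse`, so the estimate at
    -- infinity does not require the set of such points to be known bounded.
    by_cases hz : IsUnit (h z)
    · obtain ⟨v, hv⟩ := hz
      rw [← hv, ← Units.val_mul, Ring.inverse_unit, Ring.inverse_unit, mul_inv_rev, Units.val_mul,
        mul_assoc, u.inv_mul, mul_one]
    · rw [Ring.inverse_non_unit _ hz, Ring.inverse_non_unit, zero_mul]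
      rwa [Units.isUnit_units_mul]

end IsOpStem
end stem

/-! ### The resolvent operators -/

theorem Commute.ringInverse_right {R : Type*} [Ring R] {a b : R} (h : Commute a b) :
    Commute a (Ring.inverse b) := by
  by_cases hb : IsUnit b
  · obtain ⟨u, rfl⟩ := hb
    rw [Ring.inverse_unit]
    exact h.units_inv_right
  · rw [Ring.inverse_non_unit _ hb]
    exact Commute.zero_right a

section algebra
variable {𝒜 : Type*} [Ring 𝒜] [Algebra ℝ 𝒜] {T : Fin 6 → 𝒜}

open Cl

/-- T + Tbar and T Tbar have no vector part when the components commute. Thus 𝒬 involves only s and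
coefficients at e_∅, which commute with s; this is why it fits into a slice although T itself does
not. -/
theorem Qc_eq (hT : ∀ i j, Commute (T i) (T j)) (s : R6) :
    Qc s T = scalarOp 𝒜 s * scalarOp 𝒜 s + (-1 : ℝ) • (scalarOp 𝒜 s * single ∅ (T 0 + T 0)) +
      single ∅ (∑ i, T i ^ 2) := by
  rw [Qc, paravec_add_conj, paravec_mul_conj hT, sq]
  module

theorem Qc_conj (hT : ∀ i j, Commute (T i) (T j)) (s : R6) : Qc s (Cl.conj T) = Qc s T := by
  have hT' : ∀ i j, Commute (Cl.conj T i) (Cl.conj T j) := fun i j => by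
    unfold Cl.conj
    split_ifs <;> simp [hT]
  have h : ∀ i, Cl.conj T i ^ 2 = T i ^ 2 := fun i => by
    unfold Cl.conj
    split_ifs with hi
    · rw [hi]
    · rw [neg_sq]
  rw [Qc_eq hT, Qc_eq hT']
  simp only [h]
  rfl

theorem commute_scalarOp_single (a : 𝒜) (s : R6) : Commute (scalarOp 𝒜 s) (single ∅ a) :=
  (commute_single_empty_ofRealHom a s.toCl).symm

theorem commute_single_single {R : Type*} [Ring R] {a b : R} (h : Commute a b) :
    Commute (single ∅ a : Cl R) (single ∅ b) := by
  rw [commute_iff_eq, single_empty_mul_single, single_empty_mul_single, h.eq]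

theorem commute_scalarOp_QcInv (hT : ∀ i j, Commute (T i) (T j)) (s : R6) :
    Commute (scalarOp 𝒜 s) (QcInv s T) := by
  refine Commute.ringInverse_right ?_
  rw [Qc_eq hT]
  exact (((Commute.refl _).mul_right (Commute.refl _)).add_right
    (((Commute.refl _).mul_right (commute_scalarOp_single _ s)).smul_right _)).add_right
    (commute_scalarOp_single _ s)

theorem commute_single_QcInv (hT : ∀ i j, Commute (T i) (T j)) (s : R6) :
    Commute (single ∅ (T 0)) (QcInv s T) := by
  refine Commute.ringInverse_right ?_
  rw [Qc_eq hT]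
  have h := (commute_scalarOp_single (T 0) s).symm
  refine ((h.mul_right h).add_right ((h.mul_right (commute_single_single
    ((hT 0 0).add_right (hT 0 0)))).smul_right _)).add_right (commute_single_single ?_)
  exact Commute.sum_right _ _ _ fun i _ => (hT 0 i).pow_right 2

end algebra

/-! ### The S-spectrum and the resolvents as slice functions of s. -/

section resolvent
variable {𝒜 : Type*} [NormedRing 𝒜] [NormedAlgebra ℝ 𝒜] {T : Fin 6 → 𝒜}

open Cl

/-- The function `z² - 2 z T₀ + ∑ T_i²` on the first slice. -/
noncomputable def pencil (T : Fin 6 → 𝒜) (z : ℂ) : Cl 𝒜 :=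
  Cl.hat 𝒜 z * Cl.hat 𝒜 z + (-1 : ℝ) • (Cl.hat 𝒜 z * single ∅ (T 0 + T 0)) +
    single ∅ (∑ i, T i ^ 2)

/-- The trace of the `S`-spectrum on a slice. -/
def pencilSpectrum (T : Fin 6 → 𝒜) : Set ℂ := {z | ¬ IsUnit (pencil T z)}

theorem isOpStem_pencil (T : Fin 6 → 𝒜) : IsOpStem ∅ 2 (pencil T) :=
  (((IsOpStem.hat ∅).mul (IsOpStem.hat ∅)).add
    ((((IsOpStem.hat ∅).mul (IsOpStem.const ∅ _)).smul (-1)).mono (by norm_num))).add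
    ((IsOpStem.const ∅ _).mono (by norm_num))

theorem tendsto_hat_mul_pencil (T : Fin 6 → 𝒜) :
    Tendsto (fun z => Cl.hat 𝒜 (z⁻¹ ^ 2) * pencil T z) (Bornology.cobounded ℂ) (𝓝 1) := by
  have hi : Tendsto (fun z : ℂ => z⁻¹) (Bornology.cobounded ℂ) (𝓝 0) := tendsto_inv₀_cobounded
  have hc : Continuous fun w : ℂ => 1 + (-1 : ℝ) • (Cl.hat 𝒜 w * single ∅ (T 0 + T 0)) +
      Cl.hat 𝒜 (w ^ 2) * single ∅ (∑ i, T i ^ 2) := by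
    simp only [← hatCLM_apply]
    fun_prop
  have h0 : Cl.hat 𝒜 0 = 0 := by rw [← hatCLM_apply, map_zero]
  have h1 := (hc.tendsto 0).comp hi
  simp only [ne_eq, OfNat.ofNat_ne_zero, not_false_eq_true, zero_pow, h0, zero_mul, smul_zero,
    add_zero] at h1
  refine h1.congr' ?_
  filter_upwards [eventually_ne_zero_cobounded] with z hz
  have e1 : Cl.hat 𝒜 (z⁻¹ ^ 2) * (Cl.hat 𝒜 z * Cl.hat 𝒜 z) = 1 := by
    rw [← hat_mul, ← hat_mul, ← sq, inv_pow, inv_mul_cancel₀ (pow_ne_zero 2 hz), hat_one]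
  have e2 : Cl.hat 𝒜 (z⁻¹ ^ 2) * Cl.hat 𝒜 z = Cl.hat 𝒜 z⁻¹ := by
    rw [← hat_mul, sq, mul_assoc, inv_mul_cancel₀ hz, mul_one]
  rw [pencil, mul_add, mul_add, e1, mul_smul_comm, ← mul_assoc, e2]
  rfl

theorem subst_single_empty (J : R6) (a : 𝒜) : subst J (single ∅ a) = single ∅ a := by
  have : (single ∅ a : Cl 𝒜) = cx a 0 := by rw [cx, single_zero, add_zero]
  rw [this, subst_cx, single_zero, zero_mul, add_zero, ← this]

theorem isCx_single_empty {R : Type*} [Ring R] (a : R) : IsCx (single ∅ a) := by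
  have : (single ∅ a : Cl R) = cx a 0 := by rw [cx, single_zero, add_zero]
  rw [this]
  exact isCx_cx _ _

theorem scalarOp_slicePt {J : R6} (hJ : J ∈ imagSphere) (z : ℂ) :
    scalarOp 𝒜 (slicePt J z) = subst J (Cl.hat 𝒜 z) :=
  ofRealHom_slicePt hJ z

/-- A single function of z governs 𝒬 on all slices at once, and with it invertibility and the
inverse. -/
theorem Qc_slicePt (hT : ∀ i j, Commute (T i) (T j)) {J : R6} (hJ : J ∈ imagSphere) (z : ℂ) :
    Qc (slicePt J z) T = subst J (pencil T z) := by
  rw [Qc_eq hT, pencil, subst_add, subst_add, subst_smul, subst_mul hJ (isCx_hat z) (isCx_hat z),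
    subst_mul hJ (isCx_hat z) (isCx_single_empty _), subst_single_empty, subst_single_empty,
    scalarOp_slicePt hJ]

theorem slicePt_firstUnit_mem_sSpectrum (hT : ∀ i j, Commute (T i) (T j)) {z : ℂ} :
    slicePt firstUnit z ∈ sSpectrum T ↔ z ∈ pencilSpectrum T := by
  rw [sSpectrum, mem_ofPred_eq, Qc_slicePt hT firstUnit_mem,
    ((isOpStem_pencil T).isCx z (notMem_empty z)).subst_firstUnit]
  rfl

theorem isClosed_pencilSpectrum [CompleteSpace 𝒜] : IsClosed (pencilSpectrum T) := by
  have hc : Continuous (pencil T) := continuous_iff_continuousAt.mpr fun z => by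
    obtain ⟨d, hd⟩ := (isOpStem_pencil T).hasFDerivAt z (notMem_empty z)
    exact hd.continuousAt
  exact (Units.isOpen.preimage hc).isClosed_compl

theorem conj_mem_pencilSpectrum {z : ℂ} (hz : z ∈ pencilSpectrum T) :
    (starRingEnd ℂ) z ∈ pencilSpectrum T := by
  intro hu
  refine hz ?_
  have hcx := (isOpStem_pencil T).isCx _ (notMem_empty ((starRingEnd ℂ) z))
  have hcx' := hcx.of_mul_eq_one (Ring.mul_inverse_cancel _ hu) (Ring.inverse_mul_cancel _ hu)
  have hc := (isOpStem_pencil T).conj _ (notMem_empty ((starRingEnd ℂ) z))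
  rw [Complex.conj_conj] at hc
  refine ⟨⟨pencil T z, cxConj (Ring.inverse (pencil T ((starRingEnd ℂ) z))), ?_, ?_⟩, rfl⟩
  · rw [hc, ← cxConj_mul hcx hcx', Ring.mul_inverse_cancel _ hu, cxConj_one]
  · rw [hc, ← cxConj_mul hcx' hcx, Ring.inverse_mul_cancel _ hu, cxConj_one]

/-- Slice functions with operator-valued stem functions. -/
def IsOpSlice (K : Set ℂ) (m : ℤ) (g : R6 → Cl 𝒜) : Prop :=
  ∃ h, IsOpStem K m h ∧ ∀ J ∈ imagSphere, ∀ z ∉ K, g (slicePt J z) = subst J (h z)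

namespace IsOpSlice
variable {K : Set ℂ} {m m' : ℤ} {g g' : R6 → Cl 𝒜}

theorem mono (hg : IsOpSlice K m g) (hm : m ≤ m') : IsOpSlice K m' g :=
  let ⟨h, hh, hgh⟩ := hg
  ⟨h, hh.mono hm, hgh⟩

theorem add (hg : IsOpSlice K m g) (hg' : IsOpSlice K m g') :
    IsOpSlice K m fun s => g s + g' s :=
  let ⟨_, hh, hgh⟩ := hg
  let ⟨_, hh', hgh'⟩ := hg'
  ⟨_, hh.add hh', fun J hJ z hz => by beta_reduce; rw [hgh J hJ z hz, hgh' J hJ z hz, subst_add]⟩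

theorem smul (hg : IsOpSlice K m g) (r : ℝ) : IsOpSlice K m fun s => r • g s :=
  let ⟨_, hh, hgh⟩ := hg
  ⟨_, hh.smul r, fun J hJ z hz => by beta_reduce; rw [hgh J hJ z hz, subst_smul]⟩

theorem mul (hg : IsOpSlice K m g) (hg' : IsOpSlice K m' g') :
    IsOpSlice K (m + m') fun s => g s * g' s :=
  let ⟨_, hh, hgh⟩ := hg
  let ⟨_, hh', hgh'⟩ := hg'
  ⟨_, hh.mul hh', fun J hJ z hz => by
    beta_reduce
    rw [hgh J hJ z hz, hgh' J hJ z hz, subst_mul hJ (hh.isCx z hz) (hh'.isCx z hz)]⟩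

theorem scalarOp (K : Set ℂ) : IsOpSlice K 1 (scalarOp 𝒜) :=
  ⟨_, IsOpStem.hat K, fun _ hJ z _ => scalarOp_slicePt hJ z⟩

theorem const (K : Set ℂ) (a : 𝒜) : IsOpSlice K 0 fun _ => single ∅ a :=
  ⟨_, IsOpStem.const K a, fun J _ _ _ => (subst_single_empty J a).symm⟩

theorem sub_const (K : Set ℂ) (a : 𝒜) :
    IsOpSlice K 1 fun s => _root_.scalarOp 𝒜 s + (-1 : ℝ) • single ∅ a :=
  (scalarOp K).add (((const K a).smul (-1)).mono (by norm_num))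

theorem qcInv [CompleteSpace 𝒜] (hT : ∀ i j, Commute (T i) (T j)) :
    IsOpSlice (pencilSpectrum T) (-2) fun s => QcInv s T := by
  refine ⟨_, (isOpStem_pencil T).inverse (tendsto_hat_mul_pencil T), fun J hJ z hz => ?_⟩
  have hu : IsUnit (pencil T z) := not_not.mp hz
  have hcx := (isOpStem_pencil T).isCx z (notMem_empty z)
  have hcx' := hcx.of_mul_eq_one (Ring.mul_inverse_cancel _ hu) (Ring.inverse_mul_cancel _ hu)
  change Ring.inverse (Qc (slicePt J z) T) = _
  rw [Qc_slicePt hT hJ]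
  have e1 : subst J (pencil T z) * subst J (Ring.inverse (pencil T z)) = 1 := by
    rw [← subst_mul hJ hcx hcx', Ring.mul_inverse_cancel _ hu, subst_one]
  have e2 : subst J (Ring.inverse (pencil T z)) * subst J (pencil T z) = 1 := by
    rw [← subst_mul hJ hcx' hcx, Ring.inverse_mul_cancel _ hu, subst_one]
  exact Ring.inverse_unit ⟨_, _, e1, e2⟩

end IsOpSlice

/-- The factor Tbar (T for 𝒟²) is the only one outside the slice algebra generated by s, T₀ and 𝒬⁻¹;
being constant in s it is split off as M. Counting s as order 1 and 𝒬⁻¹ as order -2, the remaining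
factors have order at most -(deg 𝖯 + 1) in all seven cases. They commute with each other, so the
right resolvents yield the same g₀ and g₁. -/
theorem FineOp.exists_isOpSlice [CompleteSpace 𝒜] (P : FineOp)
    (hT : ∀ i j, Commute (T i) (T j)) : ∃ (M : Cl 𝒜) (g₀ g₁ : R6 → Cl 𝒜),
      IsOpSlice (pencilSpectrum T) (-(P.degree + 1)) g₀ ∧
      IsOpSlice (pencilSpectrum T) (-(P.degree + 1)) g₁ ∧
      (∀ s, P.resolventL s T = g₀ s + M * g₁ s) ∧ ∀ s, P.resolventR s T = g₀ s + g₁ s * M := by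
  have hQ := IsOpSlice.qcInv hT
  have hs := IsOpSlice.scalarOp (𝒜 := 𝒜) (pencilSpectrum T)
  have ht := IsOpSlice.sub_const (pencilSpectrum T) (T 0)
  have hQ2 := hQ.mul hQ
  have hQ3 := hQ.mul hQ2
  have hsub : ∀ s, _root_.scalarOp 𝒜 s - single ∅ (T 0) =
      _root_.scalarOp 𝒜 s + (-1 : ℝ) • single ∅ (T 0) := fun s => by module
  have hc1 : ∀ s, QcInv s T * scalarOp 𝒜 s = scalarOp 𝒜 s * QcInv s T := fun s =>
    (commute_scalarOp_QcInv hT s).eq.symm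
  have hcT : ∀ s, Commute (scalarOp 𝒜 s) (scalarOp 𝒜 s + (-1 : ℝ) • single ∅ (T 0)) := fun s =>
    (Commute.refl _).add_right ((commute_scalarOp_single _ s).smul_right _)
  have hcQ : ∀ s, Commute (QcInv s T) (scalarOp 𝒜 s + (-1 : ℝ) • single ∅ (T 0)) := fun s =>
    (commute_scalarOp_QcInv hT s).symm.add_right ((commute_single_QcInv hT s).symm.smul_right _)
  have hQc : ∀ s, QcInv s (Cl.conj T) = QcInv s T := fun s => by rw [QcInv, Qc_conj hT, QcInv]
  set N := Cl.paravec (Cl.conj T)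
  cases P with
  | dirac =>
    refine ⟨0, _, _, (hQ.smul (-4)).mono (by norm_num [degree]),
      hQ.mono (by norm_num [degree]), fun s => ?_, fun s => ?_⟩
    · simp [resolventL]
    · simp [resolventR]
  | lapDirac =>
    refine ⟨0, _, _, (hQ2.smul 16).mono (by norm_num [degree]),
      hQ2.mono (by norm_num [degree]), fun s => ?_, fun s => ?_⟩
    · simp [resolventL, sq]
    · simp [resolventR, sq]
  | lap =>
    refine ⟨N, _, _, ((hs.mul hQ2).smul (-8)).mono (by norm_num [degree]),
      (hQ2.smul 8).mono (by norm_num [degree]), fun s => ?_, fun s => ?_⟩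
    · simp only [resolventL, resolventSL, mul_assoc, sub_mul, mul_smul_comm]
      module
    · simp only [resolventR, resolventSR, mul_sub, smul_mul_assoc, ← mul_assoc]
      rw [(((commute_scalarOp_QcInv hT s).symm.mul_left (commute_scalarOp_QcInv hT s).symm)).eq]
      simp only [mul_assoc]
      module
  | diracSq =>
    refine ⟨Cl.paravec (Cl.conj (Cl.conj T)), _, _,
      ((hs.mul hQ2).smul (-8)).mono (by norm_num [degree]),
      (hQ2.smul 8).mono (by norm_num [degree]), fun s => ?_, fun s => ?_⟩
    · simp only [resolventL, resolventSL, mul_assoc, sub_mul, mul_smul_comm, hQc]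
      module
    · simp only [resolventR, resolventSR, mul_sub, smul_mul_assoc, ← mul_assoc, hQc]
      rw [(((commute_scalarOp_QcInv hT s).symm.mul_left (commute_scalarOp_QcInv hT s).symm)).eq]
      simp only [mul_assoc]
      module
  | diracBar =>
    refine ⟨N, _, _, (((hs.mul (hQ2.mul ht)).smul 4).add (hQ.smul 2)).mono (by norm_num [degree]),
      ((hQ2.mul ht).smul (-4)).mono (by norm_num [degree]), fun s => ?_, fun s => ?_⟩
    · simp only [resolventL, hsub, sq, mul_assoc, sub_mul, mul_smul_comm]
      module
    · have h1 : Commute (QcInv s T ^ 2) (scalarOp 𝒜 s + (-1 : ℝ) • single ∅ (T 0)) :=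
        (hcQ s).pow_left 2
      simp only [resolventR, hsub, ← h1.eq]
      rw [mul_sub, ((commute_scalarOp_QcInv hT s).pow_right 2 |>.mul_right (hcT s)).eq.symm]
      simp only [sq, mul_assoc, smul_mul_assoc]
      module
  | diracBarSq =>
    refine ⟨N, _, _, ((hs.mul (hQ3.mul (ht.mul ht))).smul 32).mono (by norm_num [degree]),
      ((hQ3.mul (ht.mul ht)).smul (-32)).mono (by norm_num [degree]), fun s => ?_, fun s => ?_⟩
    · simp only [resolventL, hsub, pow_succ, pow_zero, one_mul, mul_assoc, sub_mul, mul_smul_comm]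
      module
    · have h1 : Commute (QcInv s T ^ 3) ((scalarOp 𝒜 s + (-1 : ℝ) • single ∅ (T 0)) ^ 2) :=
        (hcQ s).pow_pow 3 2
      simp only [resolventR, hsub, ← h1.eq]
      rw [mul_sub, ((commute_scalarOp_QcInv hT s).pow_right 3 |>.mul_right
        ((hcT s).pow_right 2)).eq.symm]
      simp only [pow_succ, pow_zero, one_mul, mul_assoc, smul_mul_assoc]
      module
  | lapDiracBar =>
    refine ⟨N, _, _, ((hs.mul (hQ3.mul ht)).smul (-64)).mono (by norm_num [degree]),
      ((hQ3.mul ht).smul 64).mono (by norm_num [degree]), fun s => ?_, fun s => ?_⟩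
    · simp only [resolventL, hsub, pow_succ, pow_zero, one_mul, mul_assoc, sub_mul, mul_smul_comm]
      module
    · have h1 : Commute (QcInv s T ^ 3) (scalarOp 𝒜 s + (-1 : ℝ) • single ∅ (T 0)) :=
        (hcQ s).pow_left 3
      simp only [resolventR, hsub, ← h1.eq]
      rw [mul_sub, ((commute_scalarOp_QcInv hT s).pow_right 3 |>.mul_right (hcT s)).eq.symm]
      simp only [pow_succ, pow_zero, one_mul, mul_assoc, smul_mul_assoc]
      module

end resolvent

/-! ### Integrals of operator-valued stem functions -/

section integral
variable {𝒜 : Type*} [NormedRing 𝒜] [NormedAlgebra ℝ 𝒜]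

open Cl

/-- The complex-valued function `a + b e ↦ φ a + i φ b`. -/
noncomputable def complexDual (φ : 𝒜 →L[ℝ] ℝ) : Cl 𝒜 →L[ℝ] ℂ :=
  Complex.ofRealCLM ∘L φ ∘L coeffCLM ∅ + (φ ∘L coeffCLM {0}).smulRight Complex.I

theorem complexDual_apply (φ : 𝒜 →L[ℝ] ℝ) (x : Cl 𝒜) :
    complexDual φ x = φ (x.coeff ∅) + φ (x.coeff {0}) * Complex.I := by
  simp [complexDual, coeffCLM_apply]

/-- The coefficients of `hat w` are real and pass through φ. A functional on the coefficients
therefore becomes complex linear on the model slice, and operator-valued contour integrals become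
ordinary ones. -/
theorem complexDual_hat_mul (φ : 𝒜 →L[ℝ] ℝ) (w : ℂ) (x : Cl 𝒜) :
    complexDual φ (Cl.hat 𝒜 w * x) = w * complexDual φ x := by
  rw [complexDual_apply, complexDual_apply, Cl.hat, coeff_cx_mul_empty, coeff_cx_mul_singleton]
  apply Complex.ext <;> simp [← Algebra.smul_def]

theorem complexDual_cxConj (φ : 𝒜 →L[ℝ] ℝ) (x : Cl 𝒜) :
    complexDual φ (cxConj x) = (starRingEnd ℂ) (complexDual φ x) := by
  rw [complexDual_apply, complexDual_apply, cxConj, coeff_cx_empty, coeff_cx_singleton]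
  simp

theorem complexDual_re (φ : 𝒜 →L[ℝ] ℝ) (x : Cl 𝒜) : (complexDual φ x).re = φ (x.coeff ∅) := by
  simp [complexDual_apply]

theorem complexDual_im (φ : 𝒜 →L[ℝ] ℝ) (x : Cl 𝒜) : (complexDual φ x).im = φ (x.coeff {0}) := by
  simp [complexDual_apply]

namespace IsOpStem
variable {K : Set ℂ} {m : ℤ} {h : ℂ → Cl 𝒜}

theorem differentiableOn_complexDual (hh : IsOpStem K m h) (φ : 𝒜 →L[ℝ] ℝ) :
    DifferentiableOn ℂ (fun z => complexDual φ (h z)) Kᶜ := fun z hz => by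
  obtain ⟨d, hd⟩ := hh.hasFDerivAt z hz
  have h1 : HasFDerivAt (fun z => complexDual φ (h z)) _ z :=
    (complexDual φ).hasFDerivAt.comp z hd
  refine (hasFDerivAt_of_restrictScalars ℝ (f' := ContinuousLinearMap.toSpanSingleton ℂ
    (complexDual φ d)) h1 ?_).differentiableAt.differentiableWithinAt
  ext1 w
  simp [hatMulCLM_apply, complexDual_hat_mul]

theorem continuousOn (hh : IsOpStem K m h) : ContinuousOn h Kᶜ := fun z hz => by
  obtain ⟨d, hd⟩ := hh.hasFDerivAt z hz
  exact hd.continuousAt.continuousWithinAt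

end IsOpStem

/-- The integral of `h(z) (-i dz) F(z)` over the curves `Γ_1, …, Γ_n`. -/
noncomputable def stemIntegral {n : ℕ} (h : ℂ → Cl 𝒜) (F : ℂ → ℂ) (Γ : Fin n → ℝ → ℂ) : Cl 𝒜 :=
  ∑ i, ∫ t in (0 : ℝ)..1,
    h (Γ i t) * Cl.hat 𝒜 (-Complex.I * (F (Γ i t) * deriv (Γ i) t))

section
variable {n n' : ℕ} {Γ : Fin n → ℝ → ℂ} {Γ' : Fin n' → ℝ → ℂ} {D D' U K : Set ℂ} {m : ℤ}
  {h : ℂ → Cl 𝒜} {F G : ℂ → ℂ}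

theorem IsOpStem.intervalIntegrable (hh : IsOpStem K m h) (hΓ : IsPositiveBoundary Γ D)
    (hD : IsOpen D) (hKD : K ⊆ D) (hDU : closure D ⊆ U) (hF : DifferentiableOn ℂ F U) (i : Fin n) :
    IntervalIntegrable (fun t => h (Γ i t) *
      Cl.hat 𝒜 (-Complex.I * (F (Γ i t) * deriv (Γ i) t))) volume 0 1 := by
  have hc := (hΓ.jordan i).continuousOn
  have h1 := (intervalIntegrable_continuousOn_mul (hF.continuousOn.comp hc
    fun t ht => hDU (hΓ.mem_closure i ht)) (hΓ.jordan i).intervalIntegrable_deriv).const_mul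
      (-Complex.I)
  have h2 : IntervalIntegrable
      (fun t => Cl.hat 𝒜 (-Complex.I * (F (Γ i t) * deriv (Γ i) t))) volume 0 1 := by
    simp only [← hatCLM_apply]
    rw [intervalIntegrable_iff] at h1 ⊢
    exact (hatCLM 𝒜).integrable_comp h1
  refine h2.continuousOn_mul ?_
  rw [uIcc_of_le zero_le_one]
  exact hh.continuousOn.comp hc fun t ht hK => hΓ.notMem hD i ht (hKD hK)

theorem subst_eq_single_of_coeff_eq_zero (J : R6) {x : Cl 𝒜} (hx : x.coeff {0} = 0) :
    subst J x = single ∅ (x.coeff ∅) := by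
  rw [subst, hx, single_zero, zero_mul, add_zero]

variable [CompleteSpace 𝒜]

theorem IsOpStem.complexDual_stemIntegral (hh : IsOpStem K m h) (hΓ : IsPositiveBoundary Γ D)
    (hD : IsOpen D) (hKD : K ⊆ D) (hDU : closure D ⊆ U) (hF : DifferentiableOn ℂ F U)
    (φ : 𝒜 →L[ℝ] ℝ) : complexDual φ (stemIntegral h F Γ) = -Complex.I *
      ∑ i, ∫ t in (0 : ℝ)..1, complexDual φ (h (Γ i t)) * F (Γ i t) * deriv (Γ i) t := by
  rw [stemIntegral, map_sum, Finset.mul_sum]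
  refine Finset.sum_congr rfl fun i _ => ?_
  rw [← (complexDual φ).intervalIntegral_comp_comm
    (hh.intervalIntegrable hΓ hD hKD hDU hF i), ← intervalIntegral.integral_const_mul]
  refine intervalIntegral.integral_congr fun t ht => ?_
  rw [uIcc_of_le zero_le_one] at ht
  have hcx := hh.isCx _ fun hK => hΓ.notMem hD i ht (hKD hK)
  rw [← hcx.hat_mul_comm, complexDual_hat_mul]
  ring

/-- Integrand and contour are symmetric under conjugation, so every scalar integral I satisfies conj
I = -I. The factor -i coming from ds_J makes it real, and real functionals separate points.
Substituting a unit J into the integral then has no effect, which gives independence of J. -/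
theorem IsOpStem.coeff_stemIntegral (hh : IsOpStem K m h) (hΓ : IsPositiveBoundary Γ D)
    (hD : IsOpen D) (hb : Bornology.IsBounded D) (hDs : ∀ z, (starRingEnd ℂ) z ∈ D ↔ z ∈ D)
    (hU : IsOpen U) (hK : IsClosed K) (hKD : K ⊆ D) (hDU : closure D ⊆ U)
    (hUs : ∀ z ∈ U, (starRingEnd ℂ) z ∈ U) (hKs : ∀ z ∈ K, (starRingEnd ℂ) z ∈ K)
    (hF : DifferentiableOn ℂ F U) (hFs : ∀ z ∈ U, F ((starRingEnd ℂ) z) = (starRingEnd ℂ) (F z)) :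
    (stemIntegral h F Γ).coeff {0} = 0 := by
  refine SeparatingDual.eq_zero_of_forall_dual_eq_zero (R := ℝ) fun φ => ?_
  rw [← complexDual_im, hh.complexDual_stemIntegral hΓ hD hKD hDU hF]
  have hst := hΓ.star_integral hD hb hDs hU hK hKD hDU hUs hKs
    (G := fun z => complexDual φ (h z) * F z)
    (((hh.differentiableOn_complexDual φ).mono fun z hz => hz.2).mul (hF.mono sdiff_subset))
    fun z hz => by
      rw [hh.conj z hz.2, complexDual_cxConj, hFs z hz.1, map_mul]
  have hre := congrArg Complex.re hst
  rw [Complex.conj_re, Complex.neg_re] at hre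
  simp only [Complex.mul_im, Complex.neg_re, Complex.neg_im, Complex.I_re, Complex.I_im]
  linarith

/-- After J has been eliminated, the contour of G is moved to Γ by Cauchy's theorem. What is left is
the integral over Γ of h times a polynomial, a function that is holomorphic off K and O(|z|⁻²). -/
theorem IsOpStem.subst_stemIntegral_eq {d : ℕ} (hh : IsOpStem K (-(d + 1)) h)
    (hΓ : IsPositiveBoundary Γ D) (hΓ' : IsPositiveBoundary Γ' D')
    (hD : IsOpen D) (hD' : IsOpen D') (hb : Bornology.IsBounded D) (hb' : Bornology.IsBounded D')
    (hDs : ∀ z, (starRingEnd ℂ) z ∈ D ↔ z ∈ D) (hDs' : ∀ z, (starRingEnd ℂ) z ∈ D' ↔ z ∈ D')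
    (hU : IsOpen U) (hK : IsClosed K) (hKD : K ⊆ D) (hKD' : K ⊆ D') (hDU : closure D ⊆ U)
    (hDU' : closure D' ⊆ U) (hUs : ∀ z ∈ U, (starRingEnd ℂ) z ∈ U)
    (hKs : ∀ z ∈ K, (starRingEnd ℂ) z ∈ K)
    (hF : DifferentiableOn ℂ F U) (hFs : ∀ z ∈ U, F ((starRingEnd ℂ) z) = (starRingEnd ℂ) (F z))
    (hG : DifferentiableOn ℂ G U) (hGs : ∀ z ∈ U, G ((starRingEnd ℂ) z) = (starRingEnd ℂ) (G z))
    {c : ℕ → ℝ} (hc : ∀ z ∈ U, F z - G z = ∑ k ∈ Finset.range d, z ^ k * c k) (J J' : R6) :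
    subst J (stemIntegral h F Γ) = subst J' (stemIntegral h G Γ') := by
  rw [subst_eq_single_of_coeff_eq_zero J
      (hh.coeff_stemIntegral hΓ hD hb hDs hU hK hKD hDU hUs hKs hF hFs),
    subst_eq_single_of_coeff_eq_zero J'
      (hh.coeff_stemIntegral hΓ' hD' hb' hDs' hU hK hKD' hDU' hUs hKs hG hGs)]
  congr 1
  refine (SeparatingDual.eq_iff_forall_dual_eq (R := ℝ)).mpr fun φ => ?_
  rw [← complexDual_re, ← complexDual_re, hh.complexDual_stemIntegral hΓ hD hKD hDU hF,
    hh.complexDual_stemIntegral hΓ' hD' hKD' hDU' hG]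
  congr 2
  have hk := hh.differentiableOn_complexDual φ
  have hk' : DifferentiableOn ℂ (fun z => complexDual φ (h z)) (U \ K) :=
    hk.mono fun z hz => hz.2
  rw [← hΓ.integral_eq_integral hΓ' hD hD' hb hb' hU hK hKD hKD' hDU hDU'
    (G := fun z => complexDual φ (h z) * G z) (hk'.mul (hG.mono sdiff_subset)), ← sub_eq_zero]
  have hint : ∀ {E : ℂ → ℂ}, DifferentiableOn ℂ E (U \ K) → ∀ i, IntervalIntegrable
      (fun t => E (Γ i t) * deriv (Γ i) t) volume 0 1 := fun {E} hE i =>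
    intervalIntegrable_continuousOn_mul (hE.continuousOn.comp (hΓ.jordan i).continuousOn
      fun t ht => ⟨hDU (hΓ.mem_closure i ht), fun hz => hΓ.notMem hD i ht (hKD hz)⟩)
      (hΓ.jordan i).intervalIntegrable_deriv
  have hpoly : Differentiable ℂ fun z : ℂ => ∑ k ∈ Finset.range d, z ^ k * (c k : ℂ) := by
    fun_prop
  have h0 := hΓ.integral_eq_zero hD hb hK hKD
    (G := fun z => complexDual φ (h z) * ∑ k ∈ Finset.range d, z ^ k * (c k : ℂ))
    (hk.mul hpoly.differentiableOn) ?_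
  · rw [← h0, ← Finset.sum_sub_distrib]
    refine Finset.sum_congr rfl fun i _ => ?_
    rw [← intervalIntegral.integral_sub
      (hint (E := fun z => complexDual φ (h z) * F z) (hk'.mul (hF.mono sdiff_subset)) i)
      (hint (E := fun z => complexDual φ (h z) * G z) (hk'.mul (hG.mono sdiff_subset)) i)]
    refine intervalIntegral.integral_congr fun t ht => ?_
    rw [uIcc_of_le zero_le_one] at ht
    rw [← hc _ (hDU (hΓ.mem_closure i ht))]
    ring
  · have hO1 : (fun z => complexDual φ (h z)) =O[Bornology.cobounded ℂ]
        fun z => ‖z‖ ^ (-(d + 1) : ℤ) := ((complexDual φ).isBigO_comp h _).trans hh.isBigO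
    -- The exponent d - 1 is an integer, so d = 0 (empty sum) needs no separate case. Added to -(d +
    -- 1) it gives -2, the decay at which the integrals over large circles tend to 0.
    have hO2 : (fun z : ℂ => ∑ k ∈ Finset.range d, z ^ k * (c k : ℂ)) =O[Bornology.cobounded ℂ]
        fun z => ‖z‖ ^ (d - 1 : ℤ) := by
      refine Asymptotics.IsBigO.fun_sum fun k hk => ?_
      refine Asymptotics.IsBigO.of_bound ‖(c k : ℂ)‖ ?_
      filter_upwards [tendsto_norm_cobounded_atTop.eventually_ge_atTop 1] with z hz
      rw [norm_mul, norm_pow, mul_comm, norm_zpow, norm_norm]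
      refine mul_le_mul_of_nonneg_left ?_ (norm_nonneg _)
      rw [← zpow_natCast]
      refine zpow_le_zpow_right₀ hz ?_
      have := Finset.mem_range.mp hk
      lia
    refine (hO1.mul hO2).congr' EventuallyEq.rfl ?_
    filter_upwards [eventually_ne_zero_cobounded] with z hz
    rw [← zpow_add₀ (norm_ne_zero_iff.mpr hz)]
    congr 1
    ring

end
end integral

/-! ### The functional calculi -/

theorem neg_toCl_eq {J : R6} (hJ : J ∈ imagSphere) : -J.toCl = (slicePt J (-Complex.I)).toCl := by
  rw [Cl.toCl_slicePt hJ]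
  simp [Cl.single_zero]

/-- Each F_A z is placed in ℂ_J to the left of e_A. There it can be multiplied with the kernel and
with ds_J inside one commutative slice, while the basis element e_A leaves the integral on the
right. -/
theorem IsLeftSlice.eq_sum {U : Set R6} {f : R6 → Cl ℝ} {F : Finset (Fin 5) → ℂ → ℂ}
    (hf : IsLeftSlice U f F) {z : ℂ} (hz : z ∈ sliceSet U) {J : R6} (hJ : J ∈ imagSphere) :
    f (slicePt J z) = ∑ A, (slicePt J (F A z)).toCl * Cl.single A 1 := by
  have h1 : ∀ (A : Finset (Fin 5)) (r : ℝ), (Cl.single A r : Cl ℝ) = r • Cl.single A 1 :=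
    fun A r => by rw [← Cl.single_smul, smul_eq_mul, mul_one]
  have h2 : ∀ A (r : ℝ), (Cl.single ∅ r * Cl.single A 1 : Cl ℝ) = Cl.single A r := fun A r => by
    rw [Cl.single_empty_mul_single, mul_one]
  rw [hf z hz J hJ, ← Cl.sum_single (stemRe F z), ← Cl.sum_single (stemIm F z), Finset.mul_sum,
    ← Finset.sum_add_distrib]
  refine Finset.sum_congr rfl fun A _ => ?_
  rw [Cl.toCl_slicePt hJ, add_mul, h2, h1 A ((stemIm F z).coeff A), mul_smul_comm, smul_mul_assoc]
  rfl

theorem IsRightSlice.eq_sum {U : Set R6} {f : R6 → Cl ℝ} {F : Finset (Fin 5) → ℂ → ℂ}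
    (hf : IsRightSlice U f F) {z : ℂ} (hz : z ∈ sliceSet U) {J : R6} (hJ : J ∈ imagSphere) :
    f (slicePt J z) = ∑ A, Cl.single A 1 * (slicePt J (F A z)).toCl := by
  have h1 : ∀ (A : Finset (Fin 5)) (r : ℝ), (Cl.single A r : Cl ℝ) = r • Cl.single A 1 :=
    fun A r => by rw [← Cl.single_smul, smul_eq_mul, mul_one]
  have h2 : ∀ A (r : ℝ), (Cl.single A 1 * Cl.single ∅ r : Cl ℝ) = Cl.single A r := fun A r => by
    rw [Cl.single_mul_single_empty, one_mul]
  rw [hf z hz J hJ, ← Cl.sum_single (stemRe F z), ← Cl.sum_single (stemIm F z), Finset.sum_mul,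
    ← Finset.sum_add_distrib]
  refine Finset.sum_congr rfl fun A _ => ?_
  rw [Cl.toCl_slicePt hJ, mul_add, h2, h1 A ((stemIm F z).coeff A), mul_smul_comm, smul_mul_assoc]
  rfl

section calculus
variable {𝒜 : Type*} [NormedRing 𝒜] [NormedAlgebra ℝ 𝒜]

open Cl

theorem IsLeftSlice.ofReal_mul {U : Set R6} {f : R6 → Cl ℝ} {F : Finset (Fin 5) → ℂ → ℂ}
    (hf : IsLeftSlice U f F) {z : ℂ} (hz : z ∈ sliceSet U) {J : R6} (hJ : J ∈ imagSphere) (w : ℂ) :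
    Cl.ofReal 𝒜 ((slicePt J w).toCl * -J.toCl * f (slicePt J z)) =
      ∑ A, subst J (Cl.hat 𝒜 (-Complex.I * (F A z * w))) * single A 1 := by
  rw [hf.eq_sum hz hJ, neg_toCl_eq hJ, toCl_slicePt_mul hJ, ofReal_eq, Finset.mul_sum, map_sum]
  refine Finset.sum_congr rfl fun A _ => ?_
  rw [← mul_assoc, toCl_slicePt_mul hJ, map_mul, ofRealHom_slicePt hJ, ofRealHom_single, map_one]
  congr 3
  ring

theorem IsRightSlice.ofReal_mul {U : Set R6} {f : R6 → Cl ℝ} {F : Finset (Fin 5) → ℂ → ℂ}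
    (hf : IsRightSlice U f F) {z : ℂ} (hz : z ∈ sliceSet U) {J : R6} (hJ : J ∈ imagSphere) (w : ℂ) :
    Cl.ofReal 𝒜 (f (slicePt J z) * ((slicePt J w).toCl * -J.toCl)) =
      ∑ A, single A 1 * subst J (Cl.hat 𝒜 (-Complex.I * (F A z * w))) := by
  rw [hf.eq_sum hz hJ, neg_toCl_eq hJ, toCl_slicePt_mul hJ, ofReal_eq, Finset.sum_mul, map_sum]
  refine Finset.sum_congr rfl fun A _ => ?_
  rw [mul_assoc, toCl_slicePt_mul hJ, map_mul, ofRealHom_slicePt hJ, ofRealHom_single, map_one]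
  congr 3
  ring

/-- The inclusion `a ↦ a e_∅` as a continuous linear map. -/
noncomputable def singleCLM (𝒜 : Type*) [NormedRing 𝒜] [NormedAlgebra ℝ 𝒜] : 𝒜 →L[ℝ] Cl 𝒜 :=
  LinearMap.mkContinuous ⟨⟨single ∅, single_add ∅⟩, single_smul ∅⟩ 1 fun x => by
    rw [one_mul, norm_def, Finset.sum_eq_single ∅]
    · exact le_of_eq (by simp)
    · intro A _ hA
      simp [hA]
    · simp

/-- The substitution `e ↦ J` as a continuous linear map. -/
noncomputable def substCLM (𝒜 : Type*) [NormedRing 𝒜] [NormedAlgebra ℝ 𝒜] (J : R6) :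
    Cl 𝒜 →L[ℝ] Cl 𝒜 :=
  singleCLM 𝒜 ∘L coeffCLM ∅ + (ContinuousLinearMap.mul ℝ (Cl 𝒜)).flip (ofRealHom 𝒜 J.toCl) ∘L
    singleCLM 𝒜 ∘L coeffCLM {0}

theorem substCLM_apply (J : R6) (x : Cl 𝒜) : substCLM 𝒜 J x = subst J x := rfl

theorem sum_integral_apply [CompleteSpace 𝒜] {ι : Type*} {s : Finset ι} {n : ℕ}
    (L₀ L₁ : ι → Cl 𝒜 →L[ℝ] Cl 𝒜) {u₀ u₁ : ι → Fin n → ℝ → Cl 𝒜}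
    (h₀ : ∀ A i, IntervalIntegrable (u₀ A i) volume 0 1)
    (h₁ : ∀ A i, IntervalIntegrable (u₁ A i) volume 0 1) :
    ∑ i, ∫ t in (0 : ℝ)..1, ∑ A ∈ s, (L₀ A (u₀ A i t) + L₁ A (u₁ A i t)) =
      ∑ A ∈ s, (L₀ A (∑ i, ∫ t in (0 : ℝ)..1, u₀ A i t) +
        L₁ A (∑ i, ∫ t in (0 : ℝ)..1, u₁ A i t)) := by
  have hL : ∀ (L : Cl 𝒜 →L[ℝ] Cl 𝒜) {u : ℝ → Cl 𝒜}, IntervalIntegrable u volume 0 1 →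
      IntervalIntegrable (fun t => L (u t)) volume 0 1 := fun L u hu => by
    rw [intervalIntegrable_iff] at hu ⊢
    exact L.integrable_comp hu
  have h : ∀ i, ∫ t in (0 : ℝ)..1, ∑ A ∈ s, (L₀ A (u₀ A i t) + L₁ A (u₁ A i t)) =
      ∑ A ∈ s, (L₀ A (∫ t in (0 : ℝ)..1, u₀ A i t) + L₁ A (∫ t in (0 : ℝ)..1, u₁ A i t)) :=
    fun i => by
      rw [intervalIntegral.integral_finsetSum fun A _ =>
        (hL (L₀ A) (h₀ A i)).add (hL (L₁ A) (h₁ A i))]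
      refine Finset.sum_congr rfl fun A _ => ?_
      rw [intervalIntegral.integral_add (hL (L₀ A) (h₀ A i)) (hL (L₁ A) (h₁ A i)),
        (L₀ A).intervalIntegral_comp_comm (h₀ A i), (L₁ A).intervalIntegral_comp_comm (h₁ A i)]
  simp only [h, map_sum]
  rw [Finset.sum_comm]
  simp only [Finset.sum_add_distrib]

variable {T : Fin 6 → 𝒜} {U : Set R6}

namespace CalculusContour
variable (c : CalculusContour T U)

theorem isOpen_sliceSet : IsOpen (sliceSet c.W) :=
  _root_.isOpen_sliceSet c.isSliceCauchyDomain.isOpen c.isSliceCauchyDomain.axiallySymmetric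

theorem isPositiveBoundary_sliceSet : IsPositiveBoundary c.Γ (sliceSet c.W) := by
  rw [← c.isSliceCauchyDomain.axiallySymmetric.preimage_slicePt c.mem_imagSphere]
  exact c.isPositiveBoundary

theorem isBounded_sliceSet : Bornology.IsBounded (sliceSet c.W) := by
  obtain ⟨R, hR⟩ := c.isBounded.exists_norm_le
  refine (isBounded_iff_forall_norm_le).mpr ⟨R, fun z hz => ?_⟩
  rw [← norm_slicePt c.mem_imagSphere z]
  exact hR _ (hz _ c.mem_imagSphere)

theorem closure_sliceSet_subset : closure (sliceSet c.W) ⊆ sliceSet U := fun _ hz J hJ =>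
  c.closure_subset (map_mem_closure (continuous_slicePt J) hz fun _ hw => hw J hJ)

/-- A point of the planar spectrum gives a spectral point on the slice of the first unit, and the
axial symmetry of W carries it to every other slice. -/
theorem pencilSpectrum_subset (hT : ∀ i j, Commute (T i) (T j)) :
    pencilSpectrum T ⊆ sliceSet c.W := fun z hz J hJ =>
  c.isSliceCauchyDomain.axiallySymmetric z _ firstUnit_mem
    (c.spectrum_subset ((slicePt_firstUnit_mem_sSpectrum hT).mpr hz)) J hJ

theorem mem_sliceSet (i : Fin c.n) {t : ℝ} (ht : t ∈ Icc (0 : ℝ) 1) : c.Γ i t ∈ sliceSet U :=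
  c.closure_sliceSet_subset (c.isPositiveBoundary_sliceSet.mem_closure i ht)

theorem notMem_pencilSpectrum (hT : ∀ i j, Commute (T i) (T j)) (i : Fin c.n) {t : ℝ}
    (ht : t ∈ Icc (0 : ℝ) 1) : c.Γ i t ∉ pencilSpectrum T := fun h =>
  c.isPositiveBoundary_sliceSet.notMem c.isOpen_sliceSet i ht (c.pencilSpectrum_subset hT h)

theorem intervalIntegrable (hT : ∀ i j, Commute (T i) (T j)) {m : ℤ} {h : ℂ → Cl 𝒜}
    (hh : IsOpStem (pencilSpectrum T) m h) {F : Finset (Fin 5) → ℂ → ℂ} (hF : IsStem U F)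
    (A : Finset (Fin 5)) (i : Fin c.n) :
    IntervalIntegrable (fun t => h (c.Γ i t) *
      Cl.hat 𝒜 (-Complex.I * (F A (c.Γ i t) * deriv (c.Γ i) t))) volume 0 1 :=
  hh.intervalIntegrable c.isPositiveBoundary_sliceSet c.isOpen_sliceSet
    (c.pencilSpectrum_subset hT) c.closure_sliceSet_subset (hF.differentiableOn A) i

end CalculusContour

variable [CompleteSpace 𝒜]

/-- Multiplication by M, by e_A and the substitution of J are bounded linear maps and can be taken
out of the integral. J then occurs only as a substitution applied to an integral over the model
slice. -/
theorem fineCalculusL_eq (P : FineOp) (hT : ∀ i j, Commute (T i) (T j)) {M : Cl 𝒜}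
    {g₀ g₁ : R6 → Cl 𝒜} (hR : ∀ s, P.resolventL s T = g₀ s + M * g₁ s) {m : ℤ} {h₀ h₁ : ℂ → Cl 𝒜}
    (hh₀ : IsOpStem (pencilSpectrum T) m h₀) (hh₁ : IsOpStem (pencilSpectrum T) m h₁)
    (hg₀ : ∀ J ∈ imagSphere, ∀ z ∉ pencilSpectrum T, g₀ (slicePt J z) = subst J (h₀ z))
    (hg₁ : ∀ J ∈ imagSphere, ∀ z ∉ pencilSpectrum T, g₁ (slicePt J z) = subst J (h₁ z))
    {f : R6 → Cl ℝ} {F : Finset (Fin 5) → ℂ → ℂ} (hF : IsStem U F) (hf : IsLeftSlice U f F)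
    (c : CalculusContour T U) :
    fineCalculusL P f c = (1 / (2 * Real.pi)) • ∑ A,
      (subst c.J (stemIntegral h₀ (F A) c.Γ) * single A 1 +
        M * subst c.J (stemIntegral h₁ (F A) c.Γ) * single A 1) := by
  rw [fineCalculusL]
  congr 1
  have key := sum_integral_apply (s := Finset.univ)
    (fun A => (ContinuousLinearMap.mul ℝ (Cl 𝒜)).flip (single A 1) ∘L substCLM 𝒜 c.J)
    (fun A => (ContinuousLinearMap.mul ℝ (Cl 𝒜)).flip (single A 1) ∘L
      ContinuousLinearMap.mul ℝ (Cl 𝒜) M ∘L substCLM 𝒜 c.J)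
    (c.intervalIntegrable hT hh₀ hF) (c.intervalIntegrable hT hh₁ hF)
  refine Eq.trans (Finset.sum_congr rfl fun i _ => ?_) key
  refine intervalIntegral.integral_congr fun t ht => ?_
  rw [uIcc_of_le zero_le_one] at ht
  have hK := c.notMem_pencilSpectrum hT i ht
  have hJ := c.mem_imagSphere
  simp only [ContinuousLinearMap.comp_apply, ContinuousLinearMap.flip_apply,
    ContinuousLinearMap.mul_apply', substCLM_apply]
  rw [hf.ofReal_mul (c.mem_sliceSet i ht) hJ, hR, hg₀ _ hJ _ hK, hg₁ _ hJ _ hK, Finset.mul_sum]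
  refine Finset.sum_congr rfl fun A _ => ?_
  rw [subst_mul hJ (hh₀.isCx _ hK) (isCx_hat _), subst_mul hJ (hh₁.isCx _ hK) (isCx_hat _),
    add_mul]
  simp only [mul_assoc]

theorem fineCalculusR_eq (P : FineOp) (hT : ∀ i j, Commute (T i) (T j)) {M : Cl 𝒜}
    {g₀ g₁ : R6 → Cl 𝒜} (hR : ∀ s, P.resolventR s T = g₀ s + g₁ s * M) {m : ℤ} {h₀ h₁ : ℂ → Cl 𝒜}
    (hh₀ : IsOpStem (pencilSpectrum T) m h₀) (hh₁ : IsOpStem (pencilSpectrum T) m h₁)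
    (hg₀ : ∀ J ∈ imagSphere, ∀ z ∉ pencilSpectrum T, g₀ (slicePt J z) = subst J (h₀ z))
    (hg₁ : ∀ J ∈ imagSphere, ∀ z ∉ pencilSpectrum T, g₁ (slicePt J z) = subst J (h₁ z))
    {f : R6 → Cl ℝ} {F : Finset (Fin 5) → ℂ → ℂ} (hF : IsStem U F) (hf : IsRightSlice U f F)
    (c : CalculusContour T U) :
    fineCalculusR P f c = (1 / (2 * Real.pi)) • ∑ A,
      (single A 1 * subst c.J (stemIntegral h₀ (F A) c.Γ) +
        single A 1 * (subst c.J (stemIntegral h₁ (F A) c.Γ) * M)) := by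
  rw [fineCalculusR]
  congr 1
  have key := sum_integral_apply (s := Finset.univ)
    (fun A => ContinuousLinearMap.mul ℝ (Cl 𝒜) (single A 1) ∘L substCLM 𝒜 c.J)
    (fun A => ContinuousLinearMap.mul ℝ (Cl 𝒜) (single A 1) ∘L
      (ContinuousLinearMap.mul ℝ (Cl 𝒜)).flip M ∘L substCLM 𝒜 c.J)
    (c.intervalIntegrable hT hh₀ hF) (c.intervalIntegrable hT hh₁ hF)
  refine Eq.trans (Finset.sum_congr rfl fun i _ => ?_) key
  refine intervalIntegral.integral_congr fun t ht => ?_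
  rw [uIcc_of_le zero_le_one] at ht
  have hK := c.notMem_pencilSpectrum hT i ht
  have hJ := c.mem_imagSphere
  simp only [ContinuousLinearMap.comp_apply, ContinuousLinearMap.flip_apply,
    ContinuousLinearMap.mul_apply', substCLM_apply]
  rw [hf.ofReal_mul (c.mem_sliceSet i ht) hJ, hR, hg₀ _ hJ _ hK, hg₁ _ hJ _ hK, Finset.sum_mul]
  refine Finset.sum_congr rfl fun A _ => ?_
  -- Here ds_J and F_A stand to the left of the kernel; commutativity of the model slice brings the
  -- product to the same stem integrals as on the left side.
  rw [← (hh₀.isCx _ hK).hat_mul_comm, ← (hh₁.isCx _ hK).hat_mul_comm,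
    subst_mul hJ (isCx_hat _) (hh₀.isCx _ hK), subst_mul hJ (isCx_hat _) (hh₁.isCx _ hK), mul_add]
  simp only [mul_assoc]

theorem CalculusContour.subst_stemIntegral_eq (hU : IsOpen U) (hs : IsAxiallySymmetric U)
    (hT : ∀ i j, Commute (T i) (T j)) {d : ℕ} {h : ℂ → Cl 𝒜}
    (hh : IsOpStem (pencilSpectrum T) (-(d + 1)) h) {F G : Finset (Fin 5) → ℂ → ℂ}
    (hF : IsStem U F) (hG : IsStem U G) (A : Finset (Fin 5))
    (hp : ∃ p : ℕ → ℝ, ∀ z ∈ sliceSet U, F A z - G A z = ∑ k ∈ Finset.range d, z ^ k * p k)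
    (c c' : CalculusContour T U) :
    subst c.J (stemIntegral h (F A) c.Γ) = subst c'.J (stemIntegral h (G A) c'.Γ) := by
  obtain ⟨p, hp⟩ := hp
  exact hh.subst_stemIntegral_eq c.isPositiveBoundary_sliceSet c'.isPositiveBoundary_sliceSet
    c.isOpen_sliceSet c'.isOpen_sliceSet c.isBounded_sliceSet c'.isBounded_sliceSet
    (fun _ => conj_mem_sliceSet_iff) (fun _ => conj_mem_sliceSet_iff)
    (_root_.isOpen_sliceSet hU hs) isClosed_pencilSpectrum (c.pencilSpectrum_subset hT)
    (c'.pencilSpectrum_subset hT) c.closure_sliceSet_subset c'.closure_sliceSet_subset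
    (fun _ => conj_mem_sliceSet) (fun _ => conj_mem_pencilSpectrum)
    (hF.differentiableOn A) (hF.conj A) (hG.differentiableOn A) (hG.conj A) hp c.J c'.J

/-- The polynomial difference of the stem functions has degree below deg 𝖯, and the resolvent parts
have order -(deg 𝖯 + 1). These are the exponents under which all stem integrals of f and g agree,
whatever the two contours. -/
theorem fineCalculusL_eq_of_applyL_eq (P : FineOp) (hU : IsOpen U) (hs : IsAxiallySymmetric U)
    (hconn : IsConnected U) (hT : ∀ i j, Commute (T i) (T j)) {f g : R6 → Cl ℝ} (hf : f ∈ SHL U)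
    (hg : g ∈ SHL U) (hP : ∀ x ∈ U, P.applyL f x = P.applyL g x) (c c' : CalculusContour T U) :
    fineCalculusL P f c = fineCalculusL P g c' := by
  obtain ⟨F, hF, hfF⟩ := SHL.exists_stem hf
  obtain ⟨G, hG, hgG⟩ := SHL.exists_stem hg
  obtain ⟨M, g₀, g₁, ⟨h₀, hh₀, hg₀⟩, ⟨h₁, hh₁, hg₁⟩, hL, -⟩ := P.exists_isOpSlice hT
  have hp := exists_polynomial_eq_sub hU hs hconn hF hG hfF hgG P hP
  rw [fineCalculusL_eq P hT hL hh₀ hh₁ hg₀ hg₁ hF hfF,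
    fineCalculusL_eq P hT hL hh₀ hh₁ hg₀ hg₁ hG hgG]
  congr 1
  refine Finset.sum_congr rfl fun A _ => ?_
  rw [CalculusContour.subst_stemIntegral_eq hU hs hT hh₀ hF hG A (hp A) c c',
    CalculusContour.subst_stemIntegral_eq hU hs hT hh₁ hF hG A (hp A) c c']

theorem fineCalculusR_eq_of_applyR_eq (P : FineOp) (hU : IsOpen U) (hs : IsAxiallySymmetric U)
    (hconn : IsConnected U) (hT : ∀ i j, Commute (T i) (T j)) {f g : R6 → Cl ℝ} (hf : f ∈ SHR U)
    (hg : g ∈ SHR U) (hP : ∀ x ∈ U, P.applyR f x = P.applyR g x) (c c' : CalculusContour T U) :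
    fineCalculusR P f c = fineCalculusR P g c' := by
  obtain ⟨F, hF, hfF⟩ := SHR.exists_stem hf
  obtain ⟨G, hG, hgG⟩ := SHR.exists_stem hg
  obtain ⟨M, g₀, g₁, ⟨h₀, hh₀, hg₀⟩, ⟨h₁, hh₁, hg₁⟩, -, hR⟩ := P.exists_isOpSlice hT
  have hp := exists_polynomial_eq_sub_right hU hs hconn hF hG hfF hgG P hP
  rw [fineCalculusR_eq P hT hR hh₀ hh₁ hg₀ hg₁ hF hfF,
    fineCalculusR_eq P hT hR hh₀ hh₁ hg₀ hg₁ hG hgG]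
  congr 1
  refine Finset.sum_congr rfl fun A _ => ?_
  rw [CalculusContour.subst_stemIntegral_eq hU hs hT hh₀ hF hG A (hp A) c c',
    CalculusContour.subst_stemIntegral_eq hU hs hT hh₁ hF hG A (hp A) c c']

end calculus

theorem mainTheorem5 (P : FineOp) (Ω : Set R6) (hΩ : IsSliceCauchyDomain Ω)
    (hconn : IsConnected Ω) :
    (P.kerL Ω = {f | ∃ α : ℕ → Cl ℝ, ∀ x ∈ Ω,
        f x = ∑ k ∈ Finset.range (P.degree - 1 + 1), x.toCl ^ k * α k}) ∧
    (P.kerR Ω = {f | ∃ α : ℕ → Cl ℝ, ∀ x ∈ Ω,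
        f x = ∑ k ∈ Finset.range (P.degree - 1 + 1), α k * x.toCl ^ k}) ∧
    (∀ (V : Type*) [NormedAddCommGroup V] [NormedSpace ℝ V] [CompleteSpace V]
      (T : Fin 6 → (V →L[ℝ] V)), (∀ i j, Commute (T i) (T j)) → sSpectrum T ⊆ Ω →
      (∀ f ∈ SHL Ω, ∀ g ∈ SHL Ω, (∀ x ∈ Ω, P.applyL f x = P.applyL g x) →
        ∀ c c' : CalculusContour T Ω, fineCalculusL P f c = fineCalculusL P g c') ∧
      (∀ f ∈ SHR Ω, ∀ g ∈ SHR Ω, (∀ x ∈ Ω, P.applyR f x = P.applyR g x) →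
        ∀ c c' : CalculusContour T Ω, fineCalculusR P f c = fineCalculusR P g c')) := by
  obtain ⟨hU, hs, -⟩ := hΩ
  refine ⟨?_, ?_, fun V _ _ _ T hT _ => ⟨fun f hf g hg hP c c' => ?_, fun f hf g hg hP c c' => ?_⟩⟩
  · rw [P.degree_sub_add, P.kerL_eq hU hs hconn]
  · rw [P.degree_sub_add, P.kerR_eq hU hs hconn]
  · exact fineCalculusL_eq_of_applyL_eq P hU hs hconn hT hf hg hP c c'
  · exact fineCalculusR_eq_of_applyR_eq P hU hs hconn hT hf hg hP c c'
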